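/- **Theorem (discrete Miranda–Talenti-type identity for oblique boundary conditions).** *Domain and oblique field.* Let $\Omega\subset\mathbb R^2$ be a bounded domain with $C^2$ boundary, i.e. $\Omega$ lies on one side of $\partial\Omega$, which is a disjoint union of finitely many simple closed $C^2$ curves (one, if $\Omega$ is simply connected). Each curve is parametrized by arc length, $\boldsymbol x:[0,L]\to\mathbb R^2$ with $C^2$ periodic extension, and oriented so that $n=(\dot x_2,-\dot x_1)$ is the unit outward normal of $\Omega$. A dot denotes $\mathrm d/\mathrm d\varphi$, with $\varphi$ the arc length, and $\chi=\ddot x_1\dot x_2-\ddot x_2\dot x_1$. Let $\ell$ be a unit vector field on $\partial\Omega$ that on each curve is $C^1$ in $\varphi\in[0,L]$ with $\ell(0)=\ell(L)$, and let $\theta:[0,L]\to\mathbb R$ be a continuous choice of the oriented (anticlockwise) angle from $n$ to $\ell$. No condition on the winding number $(\theta(L)-\theta(0))/2\pi$ is imposed. Put $\ell^\perp=(-\ell_2,\ell_1)$, $\frac{\partial v}{\partial \ell}=\ell\cdot\nabla v$ and $\frac{\partial v}{\partial\ell^\perp}=\ell^\perp\cdot\nabla v$. *Triangulation.* Let $\hat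 K$ be the closed triangle with vertices $(0,0),(1,0),(0,1)$. A curved triangle is a set $K=F_K(\hat K)$ with $F_K(\hat x)=B_K\hat x+b_K+\Phi_K(\hat x)$, where $B_K$ is an invertible matrix and $\Phi_K$ is $C^1$ on $\hat K$ with $\sup_{\hat K}\|D\Phi_K B_K^{-1}\|<1$; its vertices and edges are the images of those of $\hat K$. Let $\mathcal T_h$ be an exact conforming triangulation of $\Omega$: finitely many curved triangles with union $\overline\Omega$, any two of which are disjoint or meet exactly in a common vertex or exactly in a common edge, each having at most one edge that is not a straight segment, and every such edge being contained in $\partial\Omega$. Assume that the maps $F_K$ are of class $C^2$ on $\hat K$. Let $\mathcal F_h^\partial$ be the set of edges contained in $\partial\Omega$ and $\mathcal F_h^i$ the set of the other edges. For each $F\in\mathcal F_h^i$ fix a unit tangent $t_F$. *Finite element space.* For $k\ge 3$ let $V_h$ be the set of all $v\in H^1(\Omega)$ such that, on each closed triangle $K\in\mathcal T_h$, $v|_K=\hat v\circ F_K^{-1}$ for a polynomial $\hat v$ of total degree at most $k$ (so that $v$ is continuous on $\overline\Omega$), and such that $v$ is $C^1$ at all vertices, i.e. the gradients of the restrictions $v|_K$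 to the triangles $K$ that meet at a vertex agree there. For $F\in\mathcal F_h^i$ with $F=\partial K^+\cap\partial K^-$ put $[\frac{\partial v}{\partial n}]=\frac{\partial v^+}{\partial n^+}+\frac{\partial v^-}{\partial n^-}$, where $v^\pm=v|_{K^\pm}$ and $n^\pm$ is the unit outward normal of $K^\pm$. *Claim.* For every $v_h\in V_h$ all the integrands below are integrable, and $$ \begin{aligned} \sum_{K\in\mathcal T_h}\int_K(\Delta v_h)^2\,\mathrm dx={}&\sum_{K\in\mathcal T_h}\int_K|D^2v_h|^2\,\mathrm dx+2\sum_{F\in\mathcal F_h^i}\int_F\Big[\frac{\partial v_h}{\partial n}\Big]\frac{\partial^2v_h}{\partial t_F^2}\,\mathrm ds\\ &+\sum_{F\in\mathcal F_h^\partial}\int_F|\nabla v_h|^2(\dot\theta-\chi)-2\,\frac{\partial v_h}{\partial\ell^\perp}\,\frac{\mathrm d}{\mathrm d\varphi}\Big(\frac{\partial v_h}{\partial\ell}(\boldsymbol x(\varphi))\Big)\,\mathrm ds . \end{aligned} $$ Here derivatives of $v_h$ in $K$ are those of $v_h|_K$ (one-sided on $\partial K$), and $|D^2v_h|$ is the Frobenius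 norm. -/

import Mathlib

open Set Filter Topology MeasureTheory
open scoped ContDiff

noncomputable section

/-- The Euclidean plane. -/
abbrev Plane : Type := EuclideanSpace ℝ (Fin 2)

/-- Anticlockwise rotation by a right angle, `(w₁, w₂) ↦ (-w₂, w₁)`. -/
def rot90 (w : Plane) : Plane := !₂[-w 1, w 0]

/-- The coordinate unit vectors. -/
def unitVec (i : Fin 2) : Plane := EuclideanSpace.single i 1

/-! ### Domains with `C²` boundary, parametrized by arc length -/

/-- The normal `(ẋ₂, -ẋ₁)` to the right of a curve `γ`. -/
def curveNormal (γ : ℝ → Plane) (φ : ℝ) : Plane := !₂[deriv γ φ 1, -deriv γ φ 0]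

/-- The curvature `χ = ẍ₁ ẋ₂ - ẍ₂ ẋ₁` of a unit-speed curve (it is `-1` for the unit circle run
through anticlockwise). -/
def curveCurvature (γ : ℝ → Plane) (φ : ℝ) : ℝ :=
  deriv (deriv γ) φ 0 * deriv γ φ 1 - deriv (deriv γ) φ 1 * deriv γ φ 0

/-- The boundary of `Ω` is the disjoint union of finitely many simple closed `C²` curves `x b`
of length `L b`, parametrized by arc length and oriented so that `curveNormal (x b)` points out of
`Ω`, which lies on one side of its boundary. -/
structure IsC2BoundaryParam {β : Type*} (Ω : Set Plane) (L : β → ℝ) (x : β → ℝ → Plane) :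
    Prop where
  length_pos : ∀ b, 0 < L b
  contDiff : ∀ b, ContDiff ℝ 2 (x b)
  periodic : ∀ b, Function.Periodic (x b) (L b)
  unit_speed : ∀ b φ, ‖deriv (x b) φ‖ = 1
  simple_disjoint : ∀ b b' φ φ', φ ∈ Ico 0 (L b) → φ' ∈ Ico 0 (L b') →
    x b φ = x b' φ' → b = b' ∧ φ = φ'
  range_eq : ⋃ b, range (x b) = frontier Ω
  outward : ∀ b φ, ∀ᶠ s in 𝓝[>] (0 : ℝ),
    x b φ + s • curveNormal (x b) φ ∉ closure Ω ∧ x b φ - s • curveNormal (x b) φ ∈ Ω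

/-- `ℓ` is a `C¹` unit vector field on the boundary curves, as a function of arc length. -/
structure IsObliqueField {β : Type*} (L : β → ℝ) (ℓ : β → ℝ → Plane) : Prop where
  contDiffOn : ∀ b, ContDiffOn ℝ 1 (ℓ b) (Icc 0 (L b))
  closed : ∀ b, ℓ b 0 = ℓ b (L b)
  unit : ∀ b, ∀ φ ∈ Icc 0 (L b), ‖ℓ b φ‖ = 1

/-- `θ` is a continuous determination of the oriented (anticlockwise) angle from the outward normal
`n` to `ℓ`: the field `ℓ` is `n` rotated by `θ`. -/
structure IsObliqueAngle {β : Type*} (L : β → ℝ) (x ℓ : β → ℝ → Plane) (θ : β → ℝ → ℝ) :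
    Prop where
  continuousOn : ∀ b, ContinuousOn (θ b) (Icc 0 (L b))
  eq_rotation : ∀ b, ∀ φ ∈ Icc 0 (L b),
    ℓ b φ = Real.cos (θ b φ) • curveNormal (x b) φ
      + Real.sin (θ b φ) • rot90 (curveNormal (x b) φ)

/-! ### Curved triangles -/

/-- Vertices `(0,0)`, `(1,0)`, `(0,1)` of the reference triangle. -/
def refVertex : Fin 3 → Plane := ![0, unitVec 0, unitVec 1]

/-- The closed straight reference triangle. -/
def refTriangle : Set Plane := convexHull ℝ (range refVertex)

/-- A curved triangle, given by its map `F = F̃ + Φ` where `F̃ x̂ = B x̂ + b` is an invertible affine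
map and `Φ` is `C¹` on the reference triangle with `sup ‖DΦ B⁻¹‖ < 1`. -/
structure CurvedTriangle where
  B : Plane ≃L[ℝ] Plane
  b : Plane
  Φ : Plane → Plane
  contDiffOn : ContDiffOn ℝ 1 Φ refTriangle
  contraction : ∃ c < (1 : ℝ), ∀ y ∈ refTriangle,
    ‖(fderivWithin ℝ Φ refTriangle y).comp (B.symm : Plane →L[ℝ] Plane)‖ ≤ c

namespace CurvedTriangle

variable (K : CurvedTriangle)

/-- The map `F_K`. -/
def map (y : Plane) : Plane := K.B y + K.b + K.Φ y

/-- The closed set `K = F_K(K̂)`. -/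
def carrier : Set Plane := K.map '' refTriangle

/-- The three vertices. -/
def vertex (a : Fin 3) : Plane := K.map (refVertex a)

/-- The edge opposite to the vertex `a`. -/
def edge (a : Fin 3) : Set Plane :=
  K.map '' segment ℝ (refVertex (a + 1)) (refVertex (a + 2))

/-- The edge opposite to the vertex `a` is a straight segment. -/
def IsStraightEdge (a : Fin 3) : Prop :=
  K.edge a = segment ℝ (K.vertex (a + 1)) (K.vertex (a + 2))

/-- The restriction of `v` to `K` lies in `P_K = {v̂ ∘ F_K⁻¹ : v̂ ∈ 𝒫_k(K̂)}`. -/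
def MemShape (k : ℕ) (v : Plane → ℝ) : Prop :=
  ∃ p : MvPolynomial (Fin 2) ℝ, p.totalDegree ≤ k ∧
    ∀ y ∈ refTriangle, v (K.map y) = MvPolynomial.eval (fun i => y i) p

end CurvedTriangle

/-! ### Exact conforming triangulations -/

/-- A finite family of curved triangles is an exact conforming triangulation of `Ω`. -/
structure IsExactTriangulation {ι : Type*} (Ω : Set Plane) (T : ι → CurvedTriangle) : Prop where
  cover : ⋃ i, (T i).carrier = closure Ω
  conforming : ∀ i j, i ≠ j →
    (T i).carrier ∩ (T j).carrier = ∅ ∨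
    (∃ a c, (T i).vertex a = (T j).vertex c ∧
      (T i).carrier ∩ (T j).carrier = {(T i).vertex a}) ∨
    (∃ a c, (T i).edge a = (T j).edge c ∧
      (T i).carrier ∩ (T j).carrier = (T i).edge a)
  straight_or_boundary : ∀ i a, (T i).IsStraightEdge a ∨ (T i).edge a ⊆ frontier Ω
  curved_unique : ∀ i a c, ¬ (T i).IsStraightEdge a → ¬ (T i).IsStraightEdge c → a = c

section Edges

open scoped Classical

variable {ι : Type*} [Fintype ι]

/-- All edges of the triangulation, each counted once. -/
def meshEdges (T : ι → CurvedTriangle) : Finset (Set Plane) :=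
  Finset.univ.image fun q : ι × Fin 3 => (T q.1).edge q.2

/-- Edges contained in `∂Ω`. -/
def boundaryEdges (Ω : Set Plane) (T : ι → CurvedTriangle) : Finset (Set Plane) :=
  (meshEdges T).filter fun F => F ⊆ frontier Ω

/-- Edges not contained in `∂Ω`. -/
def interiorEdges (Ω : Set Plane) (T : ι → CurvedTriangle) : Finset (Set Plane) :=
  (meshEdges T).filter fun F => ¬ F ⊆ frontier Ω

/-- The triangles that have `F` as an edge (two of them if `F` is an interior edge). -/
def edgeNeighbors (T : ι → CurvedTriangle) (F : Set Plane) : Finset ι :=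
  Finset.univ.filter fun i => ∃ a, (T i).edge a = F

end Edges

/-! ### Derivatives, normals, tangents and jumps -/

/-- `∂ᵢ∂ⱼ` of the restriction of `v` to the closed set `K` (one-sided at the boundary of `K`). -/
def secondPartial (v : Plane → ℝ) (K : Set Plane) (i j : Fin 2) (y : Plane) : ℝ :=
  fderivWithin ℝ (fun z => fderivWithin ℝ v K z (unitVec j)) K y (unitVec i)

/-- The Laplacian of `v` restricted to `K`. -/
def laplacianOn (v : Plane → ℝ) (K : Set Plane) (y : Plane) : ℝ :=
  ∑ i, secondPartial v K i i y

/-- The squared Frobenius norm `|D²v|²` of the Hessian of `v` restricted to `K`. -/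
def hessianNormSqOn (v : Plane → ℝ) (K : Set Plane) (y : Plane) : ℝ :=
  ∑ i, ∑ j, secondPartial v K i j y ^ 2

/-- `n` is the unit normal of the straight edge `F` of `K` that points out of `K`. -/
def IsOutwardNormal (K F : Set Plane) (n : Plane) : Prop :=
  ‖n‖ = 1 ∧ (∀ y ∈ F, ∀ z ∈ F, inner ℝ n (z - y) = 0) ∧
    ∀ y ∈ F, ∀ᶠ s in 𝓝[>] (0 : ℝ), y + s • n ∉ K

/-- The unit outward normal of `K` on its straight edge `F`. -/
def outwardNormal (K F : Set Plane) : Plane := Classical.epsilon (IsOutwardNormal K F)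

/-- `t` is a unit vector tangent to the straight edge `F`. -/
def IsUnitTangent (F : Set Plane) (t : Plane) : Prop :=
  ‖t‖ = 1 ∧ ∀ y ∈ F, ∀ z ∈ F, ∃ c : ℝ, z - y = c • t

/-- The jump `[∂v/∂n] = ∂v⁺/∂n⁺ + ∂v⁻/∂n⁻` on the interior edge `F`, at the point `y` of `F`:
the sum of the outward normal derivatives over the triangles adjacent to `F`. -/
def normalJump {ι : Type*} [Fintype ι] (T : ι → CurvedTriangle) (v : Plane → ℝ)
    (F : Set Plane) (y : Plane) : ℝ :=
  ∑ i ∈ edgeNeighbors T F,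
    fderivWithin ℝ v (T i).carrier y (outwardNormal (T i).carrier F)

/-- The second tangential derivative `∂²v/∂t²` at `y`. -/
def secondTangential (v : Plane → ℝ) (t y : Plane) : ℝ :=
  iteratedDeriv 2 (fun s : ℝ => v (y + s • t)) 0

/-- `∂v/∂ℓ` on a boundary curve `γ`, as a function of arc length; `v` is a function on `closure Ω`
and its derivative at a boundary point is taken from within `closure Ω`. -/
def boundaryDeriv (Ω : Set Plane) (v : Plane → ℝ) (γ ℓ : ℝ → Plane) (φ : ℝ) : ℝ :=
  fderivWithin ℝ v (closure Ω) (γ φ) (ℓ φ)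

/-- The integrand `|∇v|² (θ̇ - χ) - 2 (∂v/∂ℓ^⊥) d/dφ(∂v/∂ℓ)` on a boundary curve `γ`. -/
def boundaryIntegrand (Ω : Set Plane) (v : Plane → ℝ) (γ ℓ : ℝ → Plane) (θ : ℝ → ℝ)
    (φ : ℝ) : ℝ :=
  (∑ i, fderivWithin ℝ v (closure Ω) (γ φ) (unitVec i) ^ 2)
      * (deriv θ φ - curveCurvature γ φ)
    - 2 * boundaryDeriv Ω v γ (fun ψ => rot90 (ℓ ψ)) φ * deriv (boundaryDeriv Ω v γ ℓ) φ

/-- The arc length parameters in one period of the closed curve `γ` at which `γ` is in `F`. -/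
def edgeParams (l : ℝ) (γ : ℝ → Plane) (F : Set Plane) : Set ℝ :=
  {φ | φ ∈ Ico 0 l ∧ γ φ ∈ F}

/-! ### The finite element space -/

/-- `v ∈ H¹(Ω)`: both `v` and its weak gradient are square integrable. -/
def MemH1 (Ω : Set Plane) (v : Plane → ℝ) : Prop :=
  MemLp v 2 (volume.restrict Ω) ∧
    ∃ g : Plane → Plane, MemLp g 2 (volume.restrict Ω) ∧
      ∀ η : Plane → ℝ, ContDiff ℝ ∞ η → HasCompactSupport η → tsupport η ⊆ Ω →
        ∀ i : Fin 2,
          ∫ y in Ω, v y * fderiv ℝ η y (unitVec i) = -∫ y in Ω, g y i * η y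

/-- The space `V_h`: functions in `H¹(Ω)` whose restriction to each (closed) triangle `K` is in
`P_K` and that are `C¹` at all vertices, i.e. the gradients of the restrictions of `v` to the
triangles that meet at a vertex agree there. -/
structure MemVh {ι : Type*} (k : ℕ) (Ω : Set Plane) (T : ι → CurvedTriangle)
    (v : Plane → ℝ) : Prop where
  memH1 : MemH1 Ω v
  memShape : ∀ i, (T i).MemShape k v
  c1_vertex : ∀ i j a c, (T i).vertex a = (T j).vertex c →
    fderivWithin ℝ v (T i).carrier ((T i).vertex a) =
      fderivWithin ℝ v (T j).carrier ((T j).vertex c)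

end

/-! Pointwise `(Δv)² - |D²v|² = 2 det D²v`, and `det D²v` is the Jacobian determinant of the pair
`(∂₁v, ∂₂v)`, hence a null Lagrangian. Green's theorem on each triangle turns the difference of the
two volume integrals into the integral of the form `∂₁v d(∂₂v) - ∂₂v d(∂₁v)` along the boundary of
the triangle (`CurvedTriangle.integral_laplacianOn_sq`). This form is the determinant of `∇v` and
its increment, so at each point it may be computed in any positively oriented orthonormal basis. The
theorem results from a choice of basis adapted to each edge.

On a straight interior edge use the constant basis of outward normal `n` and tangent `τ`. The form
equals `2 ∂ₙv d(∂_τ v) - d(∂ₙv ∂_τ v)`. The first part contains the second tangential derivative,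
which is the same from both sides because `v` is single-valued on the edge, so the two triangles
together produce the jump of the normal derivative. The exact part leaves values at the endpoints,
and these cancel between the two triangles because the gradients agree at vertices
(`IsExactTriangulation.interior_edge`).

On the boundary use the basis `(ℓ, ℓ^⊥)`, which turns at the rate `θ̇ - χ`. The form becomes the
boundary integrand of the claim plus `d(∂v/∂ℓ ∂v/∂ℓ^⊥)` (`covCross_rotating_frame`). Agreement of
gradients at vertices makes `∇v` continuous along each closed curve, so the exact part integrates to
zero (`IsPiecewiseC2.integral_deriv_obliqueProduct`). Only `ℓ` has to close up, not `θ`, whence the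
freedom in the winding number.

The remaining work is geometric. Each `F_K` is bi-Lipschitz with a differentiable inverse, so
one-sided calculus on closed triangles is available. An interior edge has exactly two triangles, on
opposite sides; a boundary edge has exactly one, whose positive orientation agrees with that of the
boundary curve. These facts come from small displacements across an edge
(`eventually_mem_openCarrier`, `eventually_notMem_carrier`). -/

noncomputable section

/-! ### Plane geometry -/

/-- The cross product `u₁ w₂ - u₂ w₁`. -/
def planeCross (u w : Plane) : ℝ := u 0 * w 1 - u 1 * w 0

@[simp] lemma rot90_apply_zero (w : Plane) : rot90 w 0 = -w 1 := rfl
@[simp] lemma rot90_apply_one (w : Plane) : rot90 w 1 = w 0 := rfl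
@[simp] lemma unitVec_zero_zero : unitVec 0 0 = 1 := by simp [unitVec]
@[simp] lemma unitVec_zero_one : unitVec 0 1 = 0 := by simp [unitVec]
@[simp] lemma unitVec_one_zero : unitVec 1 0 = 0 := by simp [unitVec]
@[simp] lemma unitVec_one_one : unitVec 1 1 = 1 := by simp [unitVec]

lemma plane_ext {u w : Plane} (h0 : u 0 = w 0) (h1 : u 1 = w 1) : u = w := by
  ext i; fin_cases i <;> assumption

lemma plane_eq_smul_unitVec (u : Plane) : u = u 0 • unitVec 0 + u 1 • unitVec 1 := by
  apply plane_ext <;> simp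

lemma plane_inner (u w : Plane) : inner ℝ u w = u 0 * w 0 + u 1 * w 1 := by
  simp [PiLp.inner_apply, Fin.sum_univ_two, mul_comm]

lemma plane_norm_sq (u : Plane) : ‖u‖ ^ 2 = u 0 ^ 2 + u 1 ^ 2 := by
  simp [EuclideanSpace.norm_sq_eq, Fin.sum_univ_two]

lemma plane_norm_eq_one_iff (u : Plane) : ‖u‖ = 1 ↔ u 0 ^ 2 + u 1 ^ 2 = 1 := by
  rw [← plane_norm_sq]
  constructor
  · intro h; rw [h]; norm_num
  · intro h
    have := norm_nonneg u
    nlinarith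

lemma clm_apply_plane {E : Type*} [NormedAddCommGroup E] [NormedSpace ℝ E] (A : Plane →L[ℝ] E)
    (u : Plane) : A u = u 0 • A (unitVec 0) + u 1 • A (unitVec 1) := by
  conv_lhs => rw [plane_eq_smul_unitVec u]
  simp

/-- The cross product as a continuous linear functional of the second factor. -/
def planeCrossL (u : Plane) : Plane →L[ℝ] ℝ := innerSL ℝ (rot90 u)

lemma planeCrossL_apply (u w : Plane) : planeCrossL u w = planeCross u w := by
  simp [planeCrossL, innerSL_apply_apply, plane_inner, planeCross]; ring

lemma planeCross_smul_right (u w : Plane) (c : ℝ) :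
    planeCross u (c • w) = c * planeCross u w := by simp [planeCross]; ring

lemma planeCross_smul_left (u w : Plane) (c : ℝ) :
    planeCross (c • u) w = c * planeCross u w := by simp [planeCross]; ring

lemma planeCross_neg_right (u w : Plane) : planeCross u (-w) = -planeCross u w := by
  simp [planeCross]; ring

lemma planeCross_rot90_left (u w : Plane) : planeCross (rot90 u) w = - inner ℝ u w := by
  rw [plane_inner]; simp [planeCross]; ring

lemma continuous_plane_apply (i : Fin 2) : Continuous fun y : Plane => y i := by fun_prop

/-- The determinant of a linear map of the plane, computed from the standard basis. -/
def planeDet (A : Plane →L[ℝ] Plane) : ℝ := planeCross (A (unitVec 0)) (A (unitVec 1))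

lemma planeCross_map (A : Plane →L[ℝ] Plane) (u w : Plane) :
    planeCross (A u) (A w) = planeDet A * planeCross u w := by
  rw [clm_apply_plane A u, clm_apply_plane A w]
  simp [planeCross, planeDet]; ring

lemma det_eq_planeDet (A : Plane →L[ℝ] Plane) : A.det = planeDet A := by
  have := LinearMap.det_toMatrix (EuclideanSpace.basisFun (Fin 2) ℝ).toBasis (A : Plane →ₗ[ℝ] Plane)
  rw [ContinuousLinearMap.det, ← this, Matrix.det_fin_two]
  simp [LinearMap.toMatrix_apply, planeDet, planeCross, unitVec]
  ring

lemma continuous_planeDet : Continuous planeDet := by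
  unfold planeDet planeCross
  fun_prop

lemma planeDet_ne_zero_of_injective {A : Plane →L[ℝ] Plane} (hA : Function.Injective A) :
    planeDet A ≠ 0 := by
  intro h
  rw [← det_eq_planeDet, ContinuousLinearMap.det] at h
  have := LinearMap.bot_lt_ker_of_det_eq_zero h
  rw [LinearMap.ker_eq_bot.2 hA] at this
  exact lt_irrefl _ this

/-- An injective endomorphism of the plane as an equivalence. -/
def planeEquivOfInjective (A : Plane →L[ℝ] Plane) (hA : Function.Injective A) : Plane ≃L[ℝ] Plane :=
  (LinearEquiv.ofInjectiveEndo (A : Plane →ₗ[ℝ] Plane) hA).toContinuousLinearEquiv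

lemma coe_planeEquivOfInjective (A : Plane →L[ℝ] Plane) (hA : Function.Injective A) :
    (planeEquivOfInjective A hA : Plane →L[ℝ] Plane) = A := by
  ext; rfl

/-! ### The reference triangle -/

/-- The direction of the edge opposite to the vertex `a`, in anticlockwise order. -/
def refEdgeDir (a : Fin 3) : Plane := refVertex (a + 2) - refVertex (a + 1)

/-- The affine parametrization of the edge opposite to `a` over `[0, 1]`. -/
def refEdgePt (a : Fin 3) (s : ℝ) : Plane := refVertex (a + 1) + s • refEdgeDir a

/-- The barycentric coordinate of the vertex `a`. -/
def refBary (a : Fin 3) (z : Plane) : ℝ := planeCross (refEdgeDir a) (z - refVertex (a + 1))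

lemma refVertex_zero : refVertex 0 = 0 := rfl
lemma refVertex_one : refVertex 1 = unitVec 0 := rfl
lemma refVertex_two : refVertex 2 = unitVec 1 := rfl

lemma refEdgeDir_zero : refEdgeDir 0 = unitVec 1 - unitVec 0 := rfl
lemma refEdgeDir_one : refEdgeDir 1 = -unitVec 1 := by
  simp [refEdgeDir, show (1 : Fin 3) + 2 = 0 from rfl, show (1 : Fin 3) + 1 = 2 from rfl,
    refVertex_zero, refVertex_two]
lemma refEdgeDir_two : refEdgeDir 2 = unitVec 0 := by
  simp [refEdgeDir, show (2 : Fin 3) + 2 = 1 from rfl, show (2 : Fin 3) + 1 = 0 from rfl,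
    refVertex_zero, refVertex_one]

lemma refBary_zero (z : Plane) : refBary 0 z = 1 - z 0 - z 1 := by
  simp [refBary, refEdgeDir_zero, refVertex_one, planeCross]; ring
lemma refBary_one (z : Plane) : refBary 1 z = z 0 := by
  simp [refBary, refEdgeDir_one, show (1 : Fin 3) + 1 = 2 from rfl, refVertex_two, planeCross]
lemma refBary_two (z : Plane) : refBary 2 z = z 1 := by
  simp [refBary, refEdgeDir_two, show (2 : Fin 3) + 1 = 0 from rfl, refVertex_zero, planeCross]

lemma refEdgePt_zero (s : ℝ) : refEdgePt 0 s = !₂[1 - s, s] := by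
  apply plane_ext <;> simp [refEdgePt, refEdgeDir_zero, refVertex_one] <;> ring
lemma refEdgePt_one (s : ℝ) : refEdgePt 1 s = !₂[0, 1 - s] := by
  apply plane_ext <;>
    simp [refEdgePt, refEdgeDir_one, show (1 : Fin 3) + 1 = 2 from rfl, refVertex_two]
  ring
lemma refEdgePt_two (s : ℝ) : refEdgePt 2 s = !₂[s, 0] := by
  apply plane_ext <;>
    simp [refEdgePt, refEdgeDir_two, show (2 : Fin 3) + 1 = 0 from rfl, refVertex_zero]

lemma refEdgePt_left (a : Fin 3) : refEdgePt a 0 = refVertex (a + 1) := by simp [refEdgePt]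
lemma refEdgePt_right (a : Fin 3) : refEdgePt a 1 = refVertex (a + 2) := by
  simp [refEdgePt, refEdgeDir]

lemma refBary_edgePt_self (a : Fin 3) (s : ℝ) : refBary a (refEdgePt a s) = 0 := by
  simp [refBary, refEdgePt, planeCross]; ring

lemma refBary_edgePt_succ (a : Fin 3) (s : ℝ) : refBary (a + 1) (refEdgePt a s) = 1 - s := by
  fin_cases a
  · simp [refBary_one, refEdgePt_zero]
  · simp [refEdgePt_one, show (1 : Fin 3) + 1 = 2 from rfl, refBary_two]
  · simp [refEdgePt_two, show (2 : Fin 3) + 1 = 0 from rfl, refBary_zero]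

lemma refBary_edgePt_add_two (a : Fin 3) (s : ℝ) : refBary (a + 2) (refEdgePt a s) = s := by
  fin_cases a
  · simp [refBary_two, refEdgePt_zero]
  · simp [refEdgePt_one, show (1 : Fin 3) + 2 = 0 from rfl, refBary_zero]
  · simp [refEdgePt_two, show (2 : Fin 3) + 2 = 1 from rfl, refBary_one]

lemma sum_refBary (z : Plane) : ∑ a, refBary a z = 1 := by
  simp [Fin.sum_univ_three, refBary_zero, refBary_one, refBary_two]
  ring

lemma refBary_add (a : Fin 3) (z w : Plane) :
    refBary a (z + w) = refBary a z + planeCross (refEdgeDir a) w := by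
  simp [refBary, planeCross]; ring

lemma refBary_sub (a : Fin 3) (z w : Plane) :
    refBary a z - refBary a w = planeCross (refEdgeDir a) (z - w) := by
  simp [refBary, planeCross]; ring

lemma continuous_refBary (a : Fin 3) : Continuous (refBary a) := by
  unfold refBary planeCross; fun_prop

lemma continuous_refEdgePt (a : Fin 3) : Continuous (refEdgePt a) := by
  unfold refEdgePt; fun_prop

lemma refBary_vertex (a b : Fin 3) : refBary a (refVertex b) = if a = b then 1 else 0 := by
  fin_cases a <;> fin_cases b <;>
    simp [refBary_zero, refBary_one, refBary_two, refVertex_zero, refVertex_one, refVertex_two]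

lemma eq_sum_refBary (z : Plane) : z = ∑ a, refBary a z • refVertex a := by
  apply plane_ext <;>
    simp [Fin.sum_univ_three, refBary_one, refBary_two, refVertex_zero, refVertex_one,
      refVertex_two]

lemma mem_refTriangle (z : Plane) : z ∈ refTriangle ↔ ∀ a, 0 ≤ refBary a z := by
  constructor
  · intro hz a
    have hconv : Convex ℝ {z : Plane | 0 ≤ refBary a z} := by
      intro u hu w hw p q hp hq hpq
      have : refBary a (p • u + q • w) = p * refBary a u + q * refBary a w := by
        obtain rfl : q = 1 - p := by linarith
        simp [refBary, planeCross]; ring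
      simp only [mem_ofPred_eq] at *
      rw [this]; positivity
    refine convexHull_min ?_ hconv hz
    rintro _ ⟨b, rfl⟩
    simp only [mem_ofPred_eq, refBary_vertex]
    split_ifs <;> norm_num
  · intro h
    rw [eq_sum_refBary z]
    exact (convex_convexHull ℝ _).sum_mem (fun a _ => h a) (sum_refBary z)
      (fun a _ => subset_convexHull ℝ _ ⟨a, rfl⟩)

/-- The open reference triangle. -/
def refInterior : Set Plane := {z | ∀ a, 0 < refBary a z}

lemma isOpen_refInterior : IsOpen refInterior := by
  simp only [refInterior, ofPred_forall]
  exact isOpen_iInter_of_finite fun a => isOpen_lt continuous_const (continuous_refBary a)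

lemma refInterior_subset : refInterior ⊆ refTriangle := fun z hz =>
  (mem_refTriangle z).2 fun a => (hz a).le

lemma convex_refTriangle : Convex ℝ refTriangle := convex_convexHull ℝ _

lemma isCompact_refTriangle : IsCompact refTriangle :=
  Set.Finite.isCompact_convexHull ℝ (finite_range refVertex)

lemma refInterior_nonempty : refInterior.Nonempty := by
  refine ⟨!₂[1/3, 1/3], fun a => ?_⟩
  fin_cases a <;> simp [refBary_zero, refBary_one, refBary_two]
  norm_num

lemma refInterior_subset_interior : refInterior ⊆ interior refTriangle :=
  interior_maximal refInterior_subset isOpen_refInterior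

/-- A small step towards a fixed interior point makes every barycentric coordinate positive. -/
lemma refTriangle_subset_closure : refTriangle ⊆ closure refInterior := by
  intro z hz
  obtain ⟨c, hc⟩ := refInterior_nonempty
  have hcont : Continuous fun s : ℝ => z + s • (c - z) := by fun_prop
  have h1 : Tendsto (fun s : ℝ => z + s • (c - z)) (𝓝[>] 0) (𝓝 z) := by
    have := (hcont.tendsto 0).mono_left (nhdsWithin_le_nhds (s := Ioi 0))
    simpa using this
  refine mem_closure_of_tendsto h1 ?_
  have : ∀ᶠ s : ℝ in 𝓝[>] 0, s ∈ Ioo (0 : ℝ) 1 := Ioo_mem_nhdsGT one_pos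
  filter_upwards [this] with s hs a
  have h2 : refBary a (z + s • (c - z)) = (1 - s) * refBary a z + s * refBary a c := by
    simp [refBary, planeCross]; ring
  rw [h2]
  have := (mem_refTriangle z).1 hz a
  have := hc a
  have := hs.1
  have := hs.2
  have : 0 ≤ (1 - s) * refBary a z := mul_nonneg (by linarith) (by assumption)
  positivity

lemma uniqueDiffOn_refTriangle : UniqueDiffOn ℝ refTriangle :=
  uniqueDiffOn_convex convex_refTriangle
    (refInterior_nonempty.mono refInterior_subset_interior)

lemma refVertex_mem (a : Fin 3) : refVertex a ∈ refTriangle :=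
  subset_convexHull ℝ _ ⟨a, rfl⟩

lemma refEdge_eq_image (a : Fin 3) :
    segment ℝ (refVertex (a + 1)) (refVertex (a + 2)) = refEdgePt a '' Icc 0 1 := by
  rw [segment_eq_image']; rfl

lemma refEdgePt_mem {a : Fin 3} {s : ℝ} (hs : s ∈ Icc (0 : ℝ) 1) :
    refEdgePt a s ∈ refTriangle := by
  have : refEdgePt a s ∈ segment ℝ (refVertex (a + 1)) (refVertex (a + 2)) := by
    rw [refEdge_eq_image]; exact ⟨s, hs, rfl⟩
  exact convex_refTriangle.segment_subset (refVertex_mem _) (refVertex_mem _) this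

lemma fin3_cases (a b : Fin 3) : b = a ∨ b = a + 1 ∨ b = a + 2 := by
  fin_cases a <;> fin_cases b <;> decide

lemma eq_refEdgePt_of_bary_eq_zero {a : Fin 3} {z : Plane} (hz : refBary a z = 0) :
    z = refEdgePt a (refBary (a + 2) z) := by
  have h1 := sum_refBary z
  rw [Fin.sum_univ_three] at h1
  fin_cases a
  · simp only [Fin.zero_eta, refBary_zero] at hz
    apply plane_ext <;> simp [refEdgePt_zero, refBary_two] <;> linarith
  · simp only [Fin.mk_one, refBary_one] at hz
    apply plane_ext <;>
      simp [refEdgePt_one, show (1 : Fin 3) + 2 = 0 from rfl, refBary_zero] <;> linarith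
  · simp only [Fin.reduceFinMk, refBary_two] at hz
    apply plane_ext <;>
      simp [refEdgePt_two, show (2 : Fin 3) + 2 = 1 from rfl, refBary_one] <;> linarith

lemma mem_refEdge_of_bary_eq_zero {a : Fin 3} {z : Plane} (hz : z ∈ refTriangle)
    (h : refBary a z = 0) : ∃ s ∈ Icc (0 : ℝ) 1, z = refEdgePt a s := by
  refine ⟨_, ⟨(mem_refTriangle z).1 hz _, ?_⟩, eq_refEdgePt_of_bary_eq_zero h⟩
  have h1 := refBary_edgePt_succ a (refBary (a + 2) z)
  rw [← eq_refEdgePt_of_bary_eq_zero h] at h1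
  have := (mem_refTriangle z).1 hz (a + 1)
  linarith

lemma refInterior_or_edge {z : Plane} (hz : z ∈ refTriangle) :
    z ∈ refInterior ∨ ∃ a, ∃ s ∈ Icc (0 : ℝ) 1, z = refEdgePt a s := by
  by_cases h : z ∈ refInterior
  · exact Or.inl h
  · right
    simp only [refInterior, mem_ofPred_eq, not_forall, not_lt] at h
    obtain ⟨a, ha⟩ := h
    exact ⟨a, mem_refEdge_of_bary_eq_zero hz (le_antisymm ha ((mem_refTriangle z).1 hz a))⟩

lemma refEdgePt_notMem_refInterior (a : Fin 3) (s : ℝ) : refEdgePt a s ∉ refInterior := by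
  intro h
  have := h a
  rw [refBary_edgePt_self] at this
  exact lt_irrefl _ this

/-- A point in the relative interior of an edge lies on no other edge. -/
lemma refEdgePt_edge_unique {a c : Fin 3} {s r : ℝ} (hs : s ∈ Ioo (0 : ℝ) 1)
    (h : refEdgePt a s = refEdgePt c r) : c = a := by
  have h0 := refBary_edgePt_self c r
  rw [← h] at h0
  rcases fin3_cases a c with rfl | rfl | rfl
  · rfl
  · rw [refBary_edgePt_succ] at h0; linarith [hs.2]
  · rw [refBary_edgePt_add_two] at h0; linarith [hs.1]

lemma refEdgePt_injective (a : Fin 3) : Function.Injective (refEdgePt a) := fun s r h => by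
  rw [← refBary_edgePt_add_two a s, h, refBary_edgePt_add_two]

lemma refEdgePt_ne_vertex {a c : Fin 3} {s : ℝ} (hs : s ∈ Ioo (0 : ℝ) 1) :
    refEdgePt a s ≠ refVertex c := by
  intro h
  have h1 := refBary_edgePt_succ a s
  have h2 := refBary_edgePt_add_two a s
  have h3 := refBary_edgePt_self a s
  rw [h, refBary_vertex] at h1 h2 h3
  have := hs.1
  have := hs.2
  rcases fin3_cases a c with rfl | rfl | rfl
  · simp at h3
  · simp at h2; linarith
  · simp at h1; linarith

lemma refEdgeDir_ne_zero (a : Fin 3) : refEdgeDir a ≠ 0 := by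
  intro h
  have h0 := refEdgePt_right a
  have h1 := refBary_edgePt_add_two a 1
  have h2 := refBary_edgePt_add_two a 0
  simp only [refEdgePt, h, smul_zero] at h1 h2
  linarith

lemma hasDerivAt_refEdgePt (a : Fin 3) (s : ℝ) : HasDerivAt (refEdgePt a) (refEdgeDir a) s := by
  have h := (hasDerivAt_id s).smul_const (refEdgeDir a)
  rw [one_smul] at h
  exact HasDerivAt.const_add _ h

/-! ### Green's formula for `C¹` functions -/

/-- Difference quotients of a function with bounded derivative are bounded. -/
lemma norm_slope_le_of_hasDerivWithinAt {f f' : ℝ → ℝ} {M : ℝ} {I : Set ℝ} (hI : Convex ℝ I)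
    (hf : ∀ s ∈ I, HasDerivWithinAt f (f' s) I s) (hM : ∀ s ∈ I, ‖f' s‖ ≤ M) {s r : ℝ}
    (hs : s ∈ I) (hr : r ∈ I) : ‖slope f s r‖ ≤ M := by
  have h := hI.norm_image_sub_le_of_norm_hasDerivWithin_le hf hM hs hr
  have hM0 : 0 ≤ M := (norm_nonneg _).trans (hM s hs)
  rw [slope_def_field, norm_div]
  exact div_le_of_le_mul₀ (norm_nonneg _) hM0 h

/-- The derivative in `s` of `∫ F ∂ᵤG du` for `C¹` functions `F`, `G` on the unit square. -/
lemma hasDerivAt_integral_mul_partial {F G Fu Fs Gu Gs : ℝ → ℝ → ℝ}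
    (cF : Continuous (Function.uncurry F)) (cG : Continuous (Function.uncurry G))
    (cFu : Continuous (Function.uncurry Fu)) (cFs : Continuous (Function.uncurry Fs))
    (cGu : Continuous (Function.uncurry Gu)) (cGs : Continuous (Function.uncurry Gs))
    (hFu : ∀ u ∈ Icc (0 : ℝ) 1, ∀ s ∈ Icc (0 : ℝ) 1,
      HasDerivWithinAt (fun u => F u s) (Fu u s) (Icc 0 1) u)
    (hFs : ∀ u ∈ Icc (0 : ℝ) 1, ∀ s ∈ Icc (0 : ℝ) 1,
      HasDerivWithinAt (fun s => F u s) (Fs u s) (Icc 0 1) s)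
    (hGu : ∀ u ∈ Icc (0 : ℝ) 1, ∀ s ∈ Icc (0 : ℝ) 1,
      HasDerivWithinAt (fun u => G u s) (Gu u s) (Icc 0 1) u)
    (hGs : ∀ u ∈ Icc (0 : ℝ) 1, ∀ s ∈ Icc (0 : ℝ) 1,
      HasDerivWithinAt (fun s => G u s) (Gs u s) (Icc 0 1) s) {s : ℝ} (hs : s ∈ Ioo (0 : ℝ) 1) :
    HasDerivAt (fun s => ∫ u in (0 : ℝ)..1, F u s * Gu u s)
      ((∫ u in (0 : ℝ)..1, (Fs u s * Gu u s - Fu u s * Gs u s))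
        + (F 1 s * Gs 1 s - F 0 s * Gs 0 s)) s := by
  have hsI : s ∈ Icc (0 : ℝ) 1 := Ioo_subset_Icc_self hs
  have hnhds : Icc (0 : ℝ) 1 ∈ 𝓝 s := Icc_mem_nhds hs.1 hs.2
  have hcomp : IsCompact (Icc (0 : ℝ) 1 ×ˢ Icc (0 : ℝ) 1) := isCompact_Icc.prod isCompact_Icc
  have hbd : ∀ H : ℝ → ℝ → ℝ, Continuous (Function.uncurry H) →
      ∃ M, ∀ u ∈ Icc (0 : ℝ) 1, ∀ s ∈ Icc (0 : ℝ) 1, ‖H u s‖ ≤ M := by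
    intro H hH
    obtain ⟨M, hM⟩ := hcomp.exists_bound_of_continuousOn hH.continuousOn
    exact ⟨M, fun u hu s hs => hM (u, s) ⟨hu, hs⟩⟩
  obtain ⟨M1, hM1⟩ := hbd Fs cFs
  obtain ⟨M2, hM2⟩ := hbd Gs cGs
  obtain ⟨M3, hM3⟩ := hbd Gu cGu
  obtain ⟨M4, hM4⟩ := hbd Fu cFu
  have cu : ∀ H : ℝ → ℝ → ℝ, Continuous (Function.uncurry H) → ∀ r, Continuous fun u => H u r :=
    fun H hH r => hH.comp (by fun_prop : Continuous fun u : ℝ => (u, r))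
  have cs : ∀ H : ℝ → ℝ → ℝ, Continuous (Function.uncurry H) → ∀ r, Continuous fun u => H r u :=
    fun H hH r => hH.comp (by fun_prop : Continuous fun u : ℝ => (r, u))
  rw [hasDerivAt_iff_tendsto_slope]
  -- The increment of `F ∂ᵤG` splits into `(F(r) - F(s)) ∂ᵤG(r)` and `F(s) ∂ᵤ(G(r) - G(s))`.
  -- Integrating the second by parts in `u` moves `∂ᵤ` onto `F`, so the mixed derivative of `G`,
  -- which need not exist, never appears.
  have key : ∀ᶠ r in 𝓝[≠] s, slope (fun s => ∫ u in (0 : ℝ)..1, F u s * Gu u s) s r =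
      (∫ u in (0 : ℝ)..1, (slope (F u) s r * Gu u r - Fu u s * slope (G u) s r))
        + (F 1 s * slope (G 1) s r - F 0 s * slope (G 0) s r) := by
    filter_upwards [self_mem_nhdsWithin, mem_nhdsWithin_of_mem_nhds hnhds] with r hr hrI
    have hr' : r - s ≠ 0 := sub_ne_zero.2 hr
    have parts := intervalIntegral.integral_mul_deriv_eq_deriv_mul_of_hasDerivWithinAt
      (a := 0) (b := 1) (u := fun u => F u s) (v := fun u => G u r - G u s) (u' := fun u => Fu u s)
      (v' := fun u => Gu u r - Gu u s)
      (by rw [uIcc_of_le zero_le_one]; exact fun u hu => hFu u hu s hsI)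
      (by rw [uIcc_of_le zero_le_one]; exact fun u hu => (hGu u hu r hrI).sub (hGu u hu s hsI))
      ((cu _ cFu s).intervalIntegrable _ _)
      (((cu _ cGu r).sub (cu _ cGu s)).intervalIntegrable _ _)
    have i1 : IntervalIntegrable (fun u => F u r * Gu u r) volume 0 1 :=
      ((cu _ cF r).mul (cu _ cGu r)).intervalIntegrable _ _
    have i2 : IntervalIntegrable (fun u => F u s * Gu u s) volume 0 1 :=
      ((cu _ cF s).mul (cu _ cGu s)).intervalIntegrable _ _
    have i3 : IntervalIntegrable (fun u => F u s * (Gu u r - Gu u s)) volume 0 1 :=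
      ((cu _ cF s).mul ((cu _ cGu r).sub (cu _ cGu s))).intervalIntegrable _ _
    have i4 : IntervalIntegrable (fun u => Fu u s * (G u r - G u s)) volume 0 1 :=
      ((cu _ cFu s).mul ((cu _ cG r).sub (cu _ cG s))).intervalIntegrable _ _
    have i5 : IntervalIntegrable (fun u => (F u r - F u s) * Gu u r) volume 0 1 :=
      (((cu _ cF r).sub (cu _ cF s)).mul (cu _ cGu r)).intervalIntegrable _ _
    have e1 : (∫ u in (0 : ℝ)..1, F u r * Gu u r) - ∫ u in (0 : ℝ)..1, F u s * Gu u s =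
        (∫ u in (0 : ℝ)..1, (F u r - F u s) * Gu u r)
          + ∫ u in (0 : ℝ)..1, F u s * (Gu u r - Gu u s) := by
      rw [← intervalIntegral.integral_sub i1 i2, ← intervalIntegral.integral_add i5 i3]
      congr 1; ext u; ring
    have e2 : (∫ u in (0 : ℝ)..1, (slope (F u) s r * Gu u r - Fu u s * slope (G u) s r)) =
        (r - s)⁻¹ * ((∫ u in (0 : ℝ)..1, (F u r - F u s) * Gu u r)
          - ∫ u in (0 : ℝ)..1, Fu u s * (G u r - G u s)) := by
      rw [← intervalIntegral.integral_sub i5 i4, ← intervalIntegral.integral_const_mul]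
      congr 1; ext u; simp only [slope_def_field]; ring
    rw [e2]
    simp only [slope_def_field]
    rw [e1, parts]
    field_simp
    ring
  refine Tendsto.congr' (EventuallyEq.symm key) ?_
  have hsl : ∀ H Hs : ℝ → ℝ → ℝ, (∀ u ∈ Icc (0 : ℝ) 1, ∀ s ∈ Icc (0 : ℝ) 1,
      HasDerivWithinAt (fun s => H u s) (Hs u s) (Icc 0 1) s) → ∀ u ∈ Icc (0 : ℝ) 1,
      Tendsto (fun r => slope (H u) s r) (𝓝[≠] s) (𝓝 (Hs u s)) := fun H Hs h u hu =>
    hasDerivAt_iff_tendsto_slope.1 ((h u hu s hsI).hasDerivAt hnhds)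
  refine Tendsto.add ?_ (Tendsto.sub ((hsl G Gs hGs 1 (by simp)).const_mul _)
    ((hsl G Gs hGs 0 (by simp)).const_mul _))
  -- By the mean value inequality the slopes of `F` and `G` in `s` are bounded by the bounds `M1`,
  -- `M2` of their derivatives, which gives a constant dominating function.
  refine intervalIntegral.tendsto_integral_filter_of_dominated_convergence
    (fun _ => M1 * M3 + M4 * M2) ?_ ?_ (by simp) ?_
  · refine Eventually.of_forall fun r => Continuous.aestronglyMeasurable ?_
    simp only [slope_def_field]
    exact ((((cu _ cF r).sub (cu _ cF s)).div_const _).mul (cu _ cGu r)).sub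
      ((cu _ cFu s).mul (((cu _ cG r).sub (cu _ cG s)).div_const _))
  · filter_upwards [mem_nhdsWithin_of_mem_nhds hnhds] with r hrI
    refine Eventually.of_forall fun u hu => ?_
    rw [uIoc_of_le zero_le_one] at hu
    have hu' := Ioc_subset_Icc_self hu
    have b1 := norm_slope_le_of_hasDerivWithinAt (convex_Icc 0 1) (hFs u hu') (hM1 u hu') hsI hrI
    have b2 := norm_slope_le_of_hasDerivWithinAt (convex_Icc 0 1) (hGs u hu') (hM2 u hu') hsI hrI
    have b3 := hM3 u hu' r hrI
    have b4 := hM4 u hu' s hsI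
    refine (norm_sub_le _ _).trans ?_
    rw [norm_mul, norm_mul]
    have := (norm_nonneg _).trans b1
    have := (norm_nonneg _).trans b4
    gcongr
  · refine Eventually.of_forall fun u hu => ?_
    rw [uIoc_of_le zero_le_one] at hu
    have hu' := Ioc_subset_Icc_self hu
    refine Tendsto.sub (Tendsto.mul (hsl F Fs hFs u hu') ?_) ((hsl G Gs hGs u hu').const_mul _)
    exact ((cs _ cGu u).tendsto s).mono_left nhdsWithin_le_nhds

/-- Green's formula on the unit square for `C¹` functions. -/
lemma green_unit_square {F G Fu Fs Gu Gs : ℝ → ℝ → ℝ}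
    (cF : Continuous (Function.uncurry F)) (cG : Continuous (Function.uncurry G))
    (cFu : Continuous (Function.uncurry Fu)) (cFs : Continuous (Function.uncurry Fs))
    (cGu : Continuous (Function.uncurry Gu)) (cGs : Continuous (Function.uncurry Gs))
    (hFu : ∀ u ∈ Icc (0 : ℝ) 1, ∀ s ∈ Icc (0 : ℝ) 1,
      HasDerivWithinAt (fun u => F u s) (Fu u s) (Icc 0 1) u)
    (hFs : ∀ u ∈ Icc (0 : ℝ) 1, ∀ s ∈ Icc (0 : ℝ) 1,
      HasDerivWithinAt (fun s => F u s) (Fs u s) (Icc 0 1) s)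
    (hGu : ∀ u ∈ Icc (0 : ℝ) 1, ∀ s ∈ Icc (0 : ℝ) 1,
      HasDerivWithinAt (fun u => G u s) (Gu u s) (Icc 0 1) u)
    (hGs : ∀ u ∈ Icc (0 : ℝ) 1, ∀ s ∈ Icc (0 : ℝ) 1,
      HasDerivWithinAt (fun s => G u s) (Gs u s) (Icc 0 1) s) :
    ∫ s in (0 : ℝ)..1, ∫ u in (0 : ℝ)..1, (Fu u s * Gs u s - Fs u s * Gu u s) =
      (∫ u in (0 : ℝ)..1, F u 0 * Gu u 0) + (∫ s in (0 : ℝ)..1, F 1 s * Gs 1 s)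
        - (∫ u in (0 : ℝ)..1, F u 1 * Gu u 1) - ∫ s in (0 : ℝ)..1, F 0 s * Gs 0 s := by
  have cs : ∀ H : ℝ → ℝ → ℝ, Continuous (Function.uncurry H) → ∀ r, Continuous fun u => H r u :=
    fun H hH r => hH.comp (by fun_prop : Continuous fun u : ℝ => (r, u))
  have swap : ∀ H : ℝ → ℝ → ℝ, Continuous (Function.uncurry H) →
      Continuous (Function.uncurry fun s u => H u s) := fun H hH =>
    hH.comp (continuous_swap)
  have c1 : Continuous fun s => ∫ u in (0 : ℝ)..1, F u s * Gu u s :=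
    intervalIntegral.continuous_parametric_intervalIntegral_of_continuous'
      ((swap F cF).mul (swap Gu cGu)) 0 1
  have c2 : Continuous fun s => ∫ u in (0 : ℝ)..1, (Fs u s * Gu u s - Fu u s * Gs u s) :=
    intervalIntegral.continuous_parametric_intervalIntegral_of_continuous'
      (((swap Fs cFs).mul (swap Gu cGu)).sub ((swap Fu cFu).mul (swap Gs cGs))) 0 1
  have c3 : Continuous fun s => F 1 s * Gs 1 s := (cs F cF 1).mul (cs Gs cGs 1)
  have c4 : Continuous fun s => F 0 s * Gs 0 s := (cs F cF 0).mul (cs Gs cGs 0)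
  have c5 : Continuous fun s => F 1 s * Gs 1 s - F 0 s * Gs 0 s := c3.sub c4
  -- Integrating the derivative of the row integral over `s` yields the horizontal sides as end
  -- values and the vertical sides as the boundary terms of the integration by parts.
  have ftc := intervalIntegral.integral_eq_sub_of_hasDeriv_right_of_le zero_le_one
    c1.continuousOn (fun s hs => (hasDerivAt_integral_mul_partial cF cG cFu cFs cGu cGs hFu hFs
      hGu hGs hs).hasDerivWithinAt) ((c2.add c5).intervalIntegrable _ _)
  rw [intervalIntegral.integral_add (c2.intervalIntegrable _ _)
    (c5.intervalIntegrable _ _),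
    intervalIntegral.integral_sub (c3.intervalIntegrable _ _) (c4.intervalIntegrable _ _)] at ftc
  have e : (∫ s in (0 : ℝ)..1, ∫ u in (0 : ℝ)..1, (Fu u s * Gs u s - Fs u s * Gu u s)) =
      -∫ s in (0 : ℝ)..1, ∫ u in (0 : ℝ)..1, (Fs u s * Gu u s - Fu u s * Gs u s) := by
    rw [← intervalIntegral.integral_neg]
    congr 1; ext s
    rw [← intervalIntegral.integral_neg]
    congr 1; ext u; ring
  rw [e]
  linarith


/-! ### From the unit square to the reference triangle by collapsing one side. -/

/-- Collapsed coordinates `(u, s) ↦ (u (1 - s), s)` on the reference triangle. -/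
def collapsed (u s : ℝ) : Plane := !₂[u * (1 - s), s]

/-- The nearest point of `[0, 1]`. -/
def unitClamp (x : ℝ) : ℝ := max 0 (min 1 x)

lemma continuous_unitClamp : Continuous unitClamp := by unfold unitClamp; fun_prop

lemma unitClamp_mem (x : ℝ) : unitClamp x ∈ Icc (0 : ℝ) 1 := by
  simp [unitClamp]

lemma unitClamp_of_mem {x : ℝ} (hx : x ∈ Icc (0 : ℝ) 1) : unitClamp x = x := by
  simp [unitClamp, hx.1, hx.2]

lemma collapsed_mem {u s : ℝ} (hu : u ∈ Icc (0 : ℝ) 1) (hs : s ∈ Icc (0 : ℝ) 1) :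
    collapsed u s ∈ refTriangle := by
  rw [mem_refTriangle]
  intro a
  have h1 : 0 ≤ 1 - u := by linarith [hu.2]
  have h2 : 0 ≤ 1 - s := by linarith [hs.2]
  have h3 := mul_nonneg h1 h2
  have h4 := mul_nonneg hu.1 h2
  fin_cases a
  · simp [refBary_zero, collapsed]; linarith
  · simpa [refBary_one, collapsed] using h4
  · simpa [refBary_two, collapsed] using hs.1

lemma continuous_collapsed_clamp :
    Continuous fun q : ℝ × ℝ => collapsed (unitClamp q.1) (unitClamp q.2) := by
  have := continuous_unitClamp
  unfold collapsed
  fun_prop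

lemma collapsed_clamp_mem (q : ℝ × ℝ) :
    collapsed (unitClamp q.1) (unitClamp q.2) ∈ refTriangle :=
  collapsed_mem (unitClamp_mem _) (unitClamp_mem _)

lemma hasDerivAt_collapsed_left (u s : ℝ) :
    HasDerivAt (fun u => collapsed u s) ((1 - s) • unitVec 0) u := by
  have : (fun u => collapsed u s) = fun u => u • ((1 - s) • unitVec 0) + s • unitVec 1 := by
    ext1 u
    apply plane_ext <;> simp [collapsed]
  rw [this]
  have h := ((hasDerivAt_id u).smul_const ((1 - s) • unitVec 0)).add_const (s • unitVec 1)
  rw [one_smul] at h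
  exact h

lemma hasDerivAt_collapsed_right (u s : ℝ) :
    HasDerivAt (fun s => collapsed u s) (unitVec 1 - u • unitVec 0) s := by
  have : (fun s => collapsed u s) = fun s => s • (unitVec 1 - u • unitVec 0) + u • unitVec 0 := by
    ext1 s
    apply plane_ext <;> simp [collapsed]
    ring
  rw [this]
  have h := ((hasDerivAt_id s).smul_const (unitVec 1 - u • unitVec 0)).add_const (u • unitVec 0)
  rw [one_smul] at h
  exact h

/-- Fubini over horizontal rows; the row at height `s` has length `1 - s` and is rescaled to `[0,
1]`, which produces the weight. -/
lemma integral_refTriangle {h : Plane → ℝ} (hc : ContinuousOn h refTriangle) :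
    ∫ z in refTriangle, h z =
      ∫ s in (0 : ℝ)..1, ∫ u in (0 : ℝ)..1, (1 - s) * h (collapsed u s) := by
  have hmp : MeasurePreserving
      ((MeasurableEquiv.toLp 2 (Fin 2 → ℝ)).symm.trans MeasurableEquiv.finTwoArrow)
      (volume : Measure Plane) (volume : Measure (ℝ × ℝ)) :=
    (volume_preserving_finTwoArrow ℝ).comp
      (EuclideanSpace.volume_preserving_symm_measurableEquiv_toLp (Fin 2))
  set e := ((MeasurableEquiv.toLp 2 (Fin 2 → ℝ)).symm.trans MeasurableEquiv.finTwoArrow) with he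
  have hes : ∀ p : ℝ × ℝ, e.symm p = !₂[p.1, p.2] := by
    intro p
    apply e.injective
    rw [e.apply_symm_apply]
    rfl
  have hint : IntegrableOn h refTriangle := hc.integrableOn_compact isCompact_refTriangle
  have hm : MeasurableSet refTriangle := isCompact_refTriangle.isClosed.measurableSet
  have hmps := hmp.symm
  have hme : MeasurableEmbedding e.symm := e.symm.measurableEmbedding
  have h1 : ∫ z in refTriangle, h z = ∫ p : ℝ × ℝ, indicator refTriangle h (e.symm p) := by
    rw [hmps.integral_comp hme, integral_indicator hm]
  have hi : Integrable (fun p : ℝ × ℝ => indicator refTriangle h (e.symm p)) :=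
    (hmps.integrable_comp_emb hme).2 (hint.integrable_indicator hm)
  rw [h1, Measure.volume_eq_prod, integral_prod_symm _ (by rwa [← Measure.volume_eq_prod])]
  have h2 : ∀ s : ℝ, ∫ x : ℝ, indicator refTriangle h (e.symm (x, s)) =
      indicator (Icc (0 : ℝ) 1)
        (fun s => ∫ u in (0 : ℝ)..1, (1 - s) * h (collapsed u s)) s := by
    intro s
    by_cases hs : s ∈ Icc (0 : ℝ) 1
    · rw [indicator_of_mem hs]
      have h3 : (fun x : ℝ => indicator refTriangle h (e.symm (x, s))) =
          indicator (Icc 0 (1 - s)) fun x => h !₂[x, s] := by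
        ext x
        have : e.symm (x, s) ∈ refTriangle ↔ x ∈ Icc 0 (1 - s) := by
          rw [hes, mem_refTriangle]
          constructor
          · intro H
            have H0 := H 0
            have H1 := H 1
            simp only [refBary_zero, refBary_one] at H0 H1
            simp at H0 H1
            exact ⟨H1, by linarith⟩
          · intro H a
            fin_cases a
            · simp [refBary_zero]; linarith [H.2]
            · simpa [refBary_one] using H.1
            · simpa [refBary_two] using hs.1
        by_cases hx : x ∈ Icc 0 (1 - s)
        · rw [indicator_of_mem hx, indicator_of_mem (this.2 hx), hes]
        · rw [indicator_of_notMem hx, indicator_of_notMem (fun h => hx (this.1 h))]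
      rw [h3, integral_indicator measurableSet_Icc, integral_Icc_eq_integral_Ioc,
        ← intervalIntegral.integral_of_le (by linarith [hs.2]),
        intervalIntegral.integral_const_mul]
      have := intervalIntegral.mul_integral_comp_mul_right (a := 0) (b := 1)
        (f := fun x => h !₂[x, s]) (1 - s)
      rw [zero_mul, one_mul] at this
      exact this.symm
    · rw [indicator_of_notMem hs]
      have : ∀ x : ℝ, indicator refTriangle h (e.symm (x, s)) = 0 := by
        intro x
        refine indicator_of_notMem (fun H => hs ?_) _
        rw [hes, mem_refTriangle] at H
        have H0 := H 0
        have H1 := H 1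
        have H2 := H 2
        simp only [refBary_zero, refBary_one, refBary_two] at H0 H1 H2
        simp at H0 H1 H2
        exact ⟨H2, by linarith⟩
      simp [this]
  simp_rw [h2]
  rw [integral_indicator measurableSet_Icc, integral_Icc_eq_integral_Ioc,
    ← intervalIntegral.integral_of_le zero_le_one]

/-- Green's formula on the reference triangle for `C¹` functions. -/
lemma green_refTriangle {f g : Plane → ℝ} {f' g' : Plane → Plane →L[ℝ] ℝ}
    (hf : ∀ z ∈ refTriangle, HasFDerivWithinAt f (f' z) refTriangle z)
    (hg : ∀ z ∈ refTriangle, HasFDerivWithinAt g (g' z) refTriangle z)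
    (cf' : ContinuousOn f' refTriangle) (cg' : ContinuousOn g' refTriangle) :
    ∫ z in refTriangle,
        (f' z (unitVec 0) * g' z (unitVec 1) - f' z (unitVec 1) * g' z (unitVec 0)) =
      ∑ a, ∫ s in (0 : ℝ)..1, f (refEdgePt a s) * g' (refEdgePt a s) (refEdgeDir a) := by
  have cf : ContinuousOn f refTriangle := fun z hz => (hf z hz).continuousWithinAt
  have cg : ContinuousOn g refTriangle := fun z hz => (hg z hz).continuousWithinAt
  -- Clamping both coordinates extends the data continuously to the whole plane, as
  -- `green_unit_square` requires, without changing anything on the square.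
  set σ : ℝ × ℝ → Plane := fun q => collapsed (unitClamp q.1) (unitClamp q.2) with hσ
  have cσ : Continuous σ := continuous_collapsed_clamp
  have mσ : ∀ q, σ q ∈ refTriangle := collapsed_clamp_mem
  have e : ∀ u ∈ Icc (0 : ℝ) 1, ∀ s ∈ Icc (0 : ℝ) 1, σ (u, s) = collapsed u s := by
    intro u hu s hs
    simp only [hσ, unitClamp_of_mem hu, unitClamp_of_mem hs]
  have derivs : ∀ (k : Plane → ℝ) (k' : Plane → Plane →L[ℝ] ℝ),
      (∀ z ∈ refTriangle, HasFDerivWithinAt k (k' z) refTriangle z) →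
      ContinuousOn k' refTriangle → ContinuousOn k refTriangle →
      Continuous (Function.uncurry fun u s => k (σ (u, s))) ∧
      Continuous (Function.uncurry fun u s => k' (σ (u, s)) ((1 - s) • unitVec 0)) ∧
      Continuous (Function.uncurry fun u s => k' (σ (u, s)) (unitVec 1 - u • unitVec 0)) ∧
      (∀ u ∈ Icc (0 : ℝ) 1, ∀ s ∈ Icc (0 : ℝ) 1, HasDerivWithinAt (fun u => k (σ (u, s)))
        (k' (σ (u, s)) ((1 - s) • unitVec 0)) (Icc 0 1) u) ∧
      (∀ u ∈ Icc (0 : ℝ) 1, ∀ s ∈ Icc (0 : ℝ) 1, HasDerivWithinAt (fun s => k (σ (u, s)))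
        (k' (σ (u, s)) (unitVec 1 - u • unitVec 0)) (Icc 0 1) s) := by
    intro k k' hk ck' ck
    refine ⟨ck.comp_continuous cσ mσ, ?_, ?_, ?_, ?_⟩
    · exact (ck'.comp_continuous cσ mσ).clm_apply
        (by fun_prop : Continuous fun q : ℝ × ℝ => (1 - q.2) • unitVec 0)
    · exact (ck'.comp_continuous cσ mσ).clm_apply
        (by fun_prop : Continuous fun q : ℝ × ℝ => unitVec 1 - q.1 • unitVec 0)
    · intro u hu s hs
      rw [e u hu s hs]
      refine HasDerivWithinAt.congr (f := fun u => k (collapsed u s)) ?_ ?_ ?_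
      · exact (hk _ (collapsed_mem hu hs)).comp_hasDerivWithinAt u
          (hasDerivAt_collapsed_left u s).hasDerivWithinAt fun u' hu' => collapsed_mem hu' hs
      · intro u' hu'; rw [e u' hu' s hs]
      · rw [e u hu s hs]
    · intro u hu s hs
      rw [e u hu s hs]
      refine HasDerivWithinAt.congr (f := fun s => k (collapsed u s)) ?_ ?_ ?_
      · exact (hk _ (collapsed_mem hu hs)).comp_hasDerivWithinAt s
          (hasDerivAt_collapsed_right u s).hasDerivWithinAt fun s' hs' => collapsed_mem hu hs'
      · intro s' hs'; rw [e u hu s' hs']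
      · rw [e u hu s hs]
  obtain ⟨f1, f2, f3, f4, f5⟩ := derivs f f' hf cf' cf
  obtain ⟨g1, g2, g3, g4, g5⟩ := derivs g g' hg cg' cg
  have sq := green_unit_square f1 g1 f2 f3 g2 g3 f4 f5 g4 g5
  have cint : ContinuousOn (fun z => f' z (unitVec 0) * g' z (unitVec 1)
      - f' z (unitVec 1) * g' z (unitVec 0)) refTriangle := by fun_prop
  rw [integral_refTriangle cint]
  have hcongr : ∀ k k' : ℝ → ℝ, (∀ s ∈ Icc (0 : ℝ) 1, k s = k' s) →
      ∫ s in (0 : ℝ)..1, k s = ∫ s in (0 : ℝ)..1, k' s := by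
    intro k k' h
    refine intervalIntegral.integral_congr fun s hs => h s ?_
    rwa [uIcc_of_le zero_le_one] at hs
  have hL : (∫ s in (0 : ℝ)..1, ∫ u in (0 : ℝ)..1, (1 - s) *
      (f' (collapsed u s) (unitVec 0) * g' (collapsed u s) (unitVec 1)
      - f' (collapsed u s) (unitVec 1) * g' (collapsed u s) (unitVec 0))) =
      ∫ s in (0 : ℝ)..1, ∫ u in (0 : ℝ)..1, (f' (σ (u, s)) ((1 - s) • unitVec 0)
          * g' (σ (u, s)) (unitVec 1 - u • unitVec 0) -
        f' (σ (u, s)) (unitVec 1 - u • unitVec 0) * g' (σ (u, s)) ((1 - s) • unitVec 0)) := by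
    refine hcongr _ _ fun s hs => hcongr _ _ fun u hu => ?_
    rw [e u hu s hs]
    simp only [map_sub, map_smul, smul_eq_mul]
    ring
  rw [hL, sq, Fin.sum_univ_three]
  have e0 : ∫ s in (0 : ℝ)..1, f (refEdgePt 0 s) * g' (refEdgePt 0 s) (refEdgeDir 0) =
      ∫ s in (0 : ℝ)..1, f (σ (1, s)) * g' (σ (1, s)) (unitVec 1 - (1 : ℝ) • unitVec 0) := by
    refine hcongr _ _ fun s hs => ?_
    rw [e 1 (by simp) s hs, refEdgeDir_zero, refEdgePt_zero, one_smul, collapsed, one_mul]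
  -- The anticlockwise edge opposite to vertex `1` runs downwards, against the collapsed coordinate
  -- `s`, hence the reflection and the sign.
  have e1 : ∫ s in (0 : ℝ)..1, f (refEdgePt 1 s) * g' (refEdgePt 1 s) (refEdgeDir 1) =
      -∫ s in (0 : ℝ)..1, f (σ (0, s)) * g' (σ (0, s)) (unitVec 1 - (0 : ℝ) • unitVec 0) := by
    have hrefl := intervalIntegral.integral_comp_sub_left (a := 0) (b := 1)
      (fun s => f (σ (0, s)) * g' (σ (0, s)) (unitVec 1 - (0 : ℝ) • unitVec 0)) 1
    rw [sub_self, sub_zero] at hrefl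
    rw [← hrefl, ← intervalIntegral.integral_neg]
    refine hcongr _ _ fun s hs => ?_
    rw [e 0 (by simp) (1 - s) ⟨by linarith [hs.2], by linarith [hs.1]⟩, refEdgeDir_one,
      refEdgePt_one, zero_smul, sub_zero, collapsed, zero_mul, map_neg]
    ring
  have e2 : ∫ s in (0 : ℝ)..1, f (refEdgePt 2 s) * g' (refEdgePt 2 s) (refEdgeDir 2) =
      ∫ s in (0 : ℝ)..1, f (σ (s, 0)) * g' (σ (s, 0)) ((1 - (0 : ℝ)) • unitVec 0) := by
    refine hcongr _ _ fun s hs => ?_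
    rw [e s hs 0 (by simp), refEdgeDir_two, refEdgePt_two, sub_zero, one_smul, collapsed, sub_zero,
      mul_one]
  -- The side `s = 1` of the square is collapsed to a vertex and contributes nothing.
  have e3 : ∫ s in (0 : ℝ)..1, f (σ (s, 1)) * g' (σ (s, 1)) ((1 - (1 : ℝ)) • unitVec 0) = 0 := by
    simp
  rw [e0, e1, e2, e3]
  ring

/-! ### Curved triangles as diffeomorphic images of the reference triangle -/

namespace CurvedTriangle

variable (K : CurvedTriangle)

/-- The derivative of `F_K`, one-sided at the boundary of the reference triangle. -/
def jac (z : Plane) : Plane →L[ℝ] Plane := fderivWithin ℝ K.map refTriangle z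

lemma contDiffOn_map : ContDiffOn ℝ 1 K.map refTriangle := by
  have h : ContDiff ℝ 1 fun y : Plane => K.B y + K.b := by fun_prop
  exact h.contDiffOn.add K.contDiffOn

lemma hasFDerivWithinAt_map {z : Plane} (hz : z ∈ refTriangle) :
    HasFDerivWithinAt K.map (K.jac z) refTriangle z :=
  ((K.contDiffOn_map.differentiableOn one_ne_zero) z hz).hasFDerivWithinAt

lemma hasFDerivWithinAt_Φ {z : Plane} (hz : z ∈ refTriangle) :
    HasFDerivWithinAt K.Φ (fderivWithin ℝ K.Φ refTriangle z) refTriangle z :=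
  ((K.contDiffOn.differentiableOn one_ne_zero) z hz).hasFDerivWithinAt

lemma jac_eq {z : Plane} (hz : z ∈ refTriangle) :
    K.jac z = (K.B : Plane →L[ℝ] Plane) + fderivWithin ℝ K.Φ refTriangle z := by
  have h1 : HasFDerivWithinAt (fun y : Plane => K.B y + K.b) (K.B : Plane →L[ℝ] Plane)
      refTriangle z := (K.B.hasFDerivAt.add_const K.b).hasFDerivWithinAt
  exact (h1.add (K.hasFDerivWithinAt_Φ hz)).fderivWithin (uniqueDiffOn_refTriangle z hz)

lemma continuousOn_jac : ContinuousOn K.jac refTriangle :=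
  K.contDiffOn_map.continuousOn_fderivWithin uniqueDiffOn_refTriangle le_rfl

lemma contDiffOn_jac (hK : ContDiffOn ℝ 2 K.map refTriangle) : ContDiffOn ℝ 1 K.jac refTriangle :=
  hK.fderivWithin uniqueDiffOn_refTriangle (by norm_num)

/-- `Φ_K ∘ B_K⁻¹` is a contraction. -/
lemma exists_contraction : ∃ c : ℝ, 0 ≤ c ∧ c < 1 ∧
    (∀ z ∈ refTriangle, ∀ u, ‖fderivWithin ℝ K.Φ refTriangle z u‖ ≤ c * ‖K.B u‖) ∧
    ∀ z ∈ refTriangle, ∀ w ∈ refTriangle, ‖K.Φ w - K.Φ z‖ ≤ c * ‖K.B w - K.B z‖ := by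
  obtain ⟨c, hc, h⟩ := K.contraction
  have hc0 : 0 ≤ c := (norm_nonneg _).trans (h _ (refVertex_mem 0))
  refine ⟨c, hc0, hc, fun z hz u => ?_, fun z hz w hw => ?_⟩
  · have := ((fderivWithin ℝ K.Φ refTriangle z).comp
      (K.B.symm : Plane →L[ℝ] Plane)).le_of_opNorm_le (h z hz) (K.B u)
    simpa using this
  -- The hypothesis bounds the derivative of `Φ ∘ B⁻¹`, so the mean value inequality is applied on
  -- the convex image of the triangle under `B`.
  · have hconv : Convex ℝ (K.B '' refTriangle) :=
      convex_refTriangle.linear_image (K.B : Plane →ₗ[ℝ] Plane)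
    have hd : ∀ y ∈ K.B '' refTriangle, HasFDerivWithinAt (K.Φ ∘ K.B.symm)
        ((fderivWithin ℝ K.Φ refTriangle (K.B.symm y)).comp (K.B.symm : Plane →L[ℝ] Plane))
        (K.B '' refTriangle) y := by
      rintro _ ⟨z, hz, rfl⟩
      refine HasFDerivWithinAt.comp _ (t := refTriangle) ?_
        K.B.symm.hasFDerivAt.hasFDerivWithinAt ?_
      · rw [K.B.symm_apply_apply]; exact K.hasFDerivWithinAt_Φ hz
      · rintro _ ⟨w, hw, rfl⟩; rwa [K.B.symm_apply_apply]
    have := hconv.norm_image_sub_le_of_norm_hasFDerivWithin_le hd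
      (C := c) (by rintro _ ⟨z, hz, rfl⟩; rw [K.B.symm_apply_apply]; exact h z hz)
      (mem_image_of_mem K.B hz) (mem_image_of_mem K.B hw)
    simpa using this

/-- The perturbation `Φ` undoes at most the fraction `c < 1` of an increment of `B`, and `B` is
bounded below since it is invertible. The same constant serves for the derivative and for the map
itself; injectivity of both and the Lipschitz bound for the inverse follow. -/
lemma exists_expansion : ∃ m : ℝ, 0 < m ∧
    (∀ z ∈ refTriangle, ∀ u, m * ‖u‖ ≤ ‖K.jac z u‖) ∧
    ∀ z ∈ refTriangle, ∀ w ∈ refTriangle, m * ‖w - z‖ ≤ ‖K.map w - K.map z‖ := by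
  obtain ⟨c, hc0, hc, h1, h2⟩ := K.exists_contraction
  obtain ⟨b, hb, hB⟩ : ∃ b : ℝ, 0 < b ∧ ∀ u, b * ‖u‖ ≤ ‖K.B u‖ := by
    refine ⟨(‖(K.B.symm : Plane →L[ℝ] Plane)‖ + 1)⁻¹, by positivity, fun u => ?_⟩
    rw [inv_mul_le_iff₀ (by positivity)]
    have := (K.B.symm : Plane →L[ℝ] Plane).le_opNorm (K.B u)
    simp only [ContinuousLinearEquiv.coe_coe, ContinuousLinearEquiv.symm_apply_apply] at this
    nlinarith [norm_nonneg (K.B u)]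
  refine ⟨(1 - c) * b, mul_pos (by linarith) hb, fun z hz u => ?_, fun z hz w hw => ?_⟩
  · rw [K.jac_eq hz, add_apply]
    have h3 := h1 z hz u
    have h4 := norm_sub_le_norm_add (K.B u) (fderivWithin ℝ K.Φ refTriangle z u)
    have h5 := hB u
    simp only [ContinuousLinearEquiv.coe_coe]
    nlinarith
  · have h3 := h2 z hz w hw
    have h4 := norm_sub_le_norm_add (K.B w - K.B z) (K.Φ w - K.Φ z)
    have h5 := hB (w - z)
    rw [map_sub] at h5
    have h6 : K.map w - K.map z = K.B w - K.B z + (K.Φ w - K.Φ z) := by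
      simp only [map]; abel
    rw [h6]
    nlinarith

lemma jac_injective {z : Plane} (hz : z ∈ refTriangle) : Function.Injective (K.jac z) := by
  obtain ⟨m, hm, h, -⟩ := K.exists_expansion
  refine (injective_iff_map_eq_zero _).2 fun u hu => ?_
  have := h z hz u
  rw [hu, norm_zero] at this
  have : ‖u‖ ≤ 0 := by
    by_contra! h'
    have := mul_pos hm h'
    linarith
  exact norm_le_zero_iff.1 this

lemma injOn_map : InjOn K.map refTriangle := by
  obtain ⟨m, hm, -, h⟩ := K.exists_expansion
  intro z hz w hw hzw
  have := h w hw z hz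
  rw [hzw, sub_self, norm_zero] at this
  have : ‖z - w‖ ≤ 0 := by
    by_contra! h'
    have := mul_pos hm h'
    linarith
  exact sub_eq_zero.1 (norm_le_zero_iff.1 this)

/-- The derivative of `F_K` as an equivalence. -/
def jacEquiv {z : Plane} (hz : z ∈ refTriangle) : Plane ≃L[ℝ] Plane :=
  planeEquivOfInjective (K.jac z) (K.jac_injective hz)

lemma coe_jacEquiv {z : Plane} (hz : z ∈ refTriangle) :
    (K.jacEquiv hz : Plane →L[ℝ] Plane) = K.jac z := coe_planeEquivOfInjective _ _

/-- The inverse of the derivative of `F_K`. -/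
def jacInv (z : Plane) : Plane →L[ℝ] Plane := (K.jac z).inverse

lemma jacInv_eq {z : Plane} (hz : z ∈ refTriangle) :
    K.jacInv z = ((K.jacEquiv hz).symm : Plane →L[ℝ] Plane) := by
  rw [jacInv, ← K.coe_jacEquiv hz, ContinuousLinearMap.inverse_equiv]

lemma jac_jacInv {z : Plane} (hz : z ∈ refTriangle) (u : Plane) : K.jac z (K.jacInv z u) = u := by
  rw [K.jacInv_eq hz]
  exact (K.jacEquiv hz).apply_symm_apply u

lemma contDiffOn_jacInv (hK : ContDiffOn ℝ 2 K.map refTriangle) :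
    ContDiffOn ℝ 1 K.jacInv refTriangle := by
  intro z hz
  have h : ContDiffAt ℝ 1 ContinuousLinearMap.inverse (K.jac z) := by
    rw [← K.coe_jacEquiv hz]; exact contDiffAt_map_inverse _
  exact h.comp_contDiffWithinAt z (K.contDiffOn_jac hK z hz)

lemma planeDet_jac_ne_zero {z : Plane} (hz : z ∈ refTriangle) : planeDet (K.jac z) ≠ 0 :=
  planeDet_ne_zero_of_injective (K.jac_injective hz)

/-- The orientation `±1` of `F_K`. -/
def orient : ℝ := if 0 < planeDet (K.jac (refVertex 0)) then 1 else -1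

lemma orient_sq : K.orient * K.orient = 1 := by unfold orient; split_ifs <;> norm_num

/-- The determinant is continuous and nowhere zero on a connected set, so its sign is the one at the
vertex used to define `orient`. -/
lemma orient_mul_planeDet_pos {z : Plane} (hz : z ∈ refTriangle) :
    0 < K.orient * planeDet (K.jac z) := by
  have hcont : ContinuousOn (fun z => planeDet (K.jac z)) refTriangle :=
    continuous_planeDet.comp_continuousOn K.continuousOn_jac
  have hne := fun z hz => K.planeDet_jac_ne_zero (z := z) hz
  have hpre := convex_refTriangle.isPreconnected.image _ hcont
  have hord := hpre.ordConnected
  have h0 : planeDet (K.jac (refVertex 0)) ∈ (fun z => planeDet (K.jac z)) '' refTriangle :=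
    mem_image_of_mem _ (refVertex_mem 0)
  have hz' : planeDet (K.jac z) ∈ (fun z => planeDet (K.jac z)) '' refTriangle :=
    mem_image_of_mem _ hz
  have hz0 : (0 : ℝ) ∉ (fun z => planeDet (K.jac z)) '' refTriangle := by
    rintro ⟨w, hw, h⟩; exact hne w hw h
  unfold orient
  split_ifs with h
  · rw [one_mul]
    by_contra! h'
    exact hz0 (hord.out hz' h0 ⟨h', h.le⟩)
  · have : planeDet (K.jac z) < 0 := by
      by_contra! h'
      exact hz0 (hord.out h0 hz' ⟨not_lt.1 h, h'⟩)
    linarith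

lemma abs_planeDet_jac {z : Plane} (hz : z ∈ refTriangle) :
    |planeDet (K.jac z)| = K.orient * planeDet (K.jac z) := by
  have h := K.orient_mul_planeDet_pos hz
  unfold orient at h ⊢
  split_ifs at h ⊢
  · rw [one_mul] at h ⊢; exact abs_of_pos h
  · rw [neg_one_mul] at h ⊢; exact abs_of_neg (by linarith)

/-! #### The inverse map -/

/-- The inverse of `F_K` on `K`. -/
def inv : Plane → Plane := Function.invFunOn K.map refTriangle

variable {K}

lemma inv_mem {y : Plane} (hy : y ∈ K.carrier) : K.inv y ∈ refTriangle :=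
  Function.invFunOn_mem hy

lemma map_inv {y : Plane} (hy : y ∈ K.carrier) : K.map (K.inv y) = y :=
  Function.invFunOn_eq hy

lemma inv_map {z : Plane} (hz : z ∈ refTriangle) : K.inv (K.map z) = z :=
  K.injOn_map.leftInvOn_invFunOn hz

lemma map_mem {z : Plane} (hz : z ∈ refTriangle) : K.map z ∈ K.carrier := mem_image_of_mem _ hz

variable (K)

lemma isCompact_carrier : IsCompact K.carrier :=
  isCompact_refTriangle.image_of_continuousOn K.contDiffOn_map.continuousOn

lemma isClosed_carrier : IsClosed K.carrier := K.isCompact_carrier.isClosed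

lemma continuousOn_inv : ContinuousOn K.inv K.carrier := by
  obtain ⟨m, hm, -, h⟩ := K.exists_expansion
  have : LipschitzOnWith (Real.toNNReal m⁻¹) K.inv K.carrier := by
    refine LipschitzOnWith.of_dist_le_mul fun y hy y' hy' => ?_
    have := h _ (inv_mem hy') _ (inv_mem hy)
    rw [map_inv hy, map_inv hy'] at this
    rw [dist_eq_norm, dist_eq_norm, Real.coe_toNNReal _ (by positivity)]
    rwa [le_inv_mul_iff₀ hm]
  exact this.continuousOn

/-- One-sided version of the inverse function theorem, valid up to the boundary: the inverse is
already known to be continuous, and an invertible derivative then suffices. -/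
lemma hasFDerivWithinAt_inv {y : Plane} (hy : y ∈ K.carrier) :
    HasFDerivWithinAt K.inv (K.jacInv (K.inv y)) K.carrier y := by
  rw [K.jacInv_eq (inv_mem hy)]
  refine HasFDerivWithinAt.of_local_left_inverse (f := K.map) (t := refTriangle) ?_ ?_ hy ?_
  · exact (K.continuousOn_inv y hy).tendsto_nhdsWithin fun y hy => inv_mem hy
  · rw [K.coe_jacEquiv]; exact K.hasFDerivWithinAt_map (inv_mem hy)
  · filter_upwards [self_mem_nhdsWithin] with y hy using map_inv hy

/-- Tangent directions of the reference triangle are carried to tangent directions of `K` by a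
surjective derivative, so derivatives within the curved triangle are unambiguous. -/
lemma uniqueDiffOn_carrier : UniqueDiffOn ℝ K.carrier := by
  rintro _ ⟨z, hz, rfl⟩
  refine (K.hasFDerivWithinAt_map hz).uniqueDiffWithinAt (uniqueDiffOn_refTriangle z hz) ?_
  refine Function.Surjective.denseRange fun u => ⟨K.jacInv z u, K.jac_jacInv hz u⟩

/-! #### Openness of the interior -/

/-- A quantitative open mapping property of `F_K`. -/
lemma exists_preimage_of_near {S : Set Plane} (hS : S ⊆ refTriangle) :
    ∃ q : ℝ, 0 < q ∧ ∀ (z : Plane) (ρ : ℝ), 0 ≤ ρ → (∀ u, ‖u - z‖ ≤ ρ → u ∈ S) →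
      ∀ y, ‖y - K.map z‖ ≤ q * ρ → ∃ u ∈ S, K.map u = y := by
  obtain ⟨c, hc0, hc, -, h2⟩ := K.exists_contraction
  set n : ℝ := ‖(K.B.symm : Plane →L[ℝ] Plane)‖ + 1 with hn
  have hn0 : 0 < n := by positivity
  refine ⟨(1 - c) * n⁻¹, mul_pos (by linarith) (by positivity), fun z ρ hρ hz y hy => ?_⟩
  have hball : ∀ y ∈ Metric.closedBall (K.B z) (n⁻¹ * ρ), K.B.symm y ∈ S := by
    intro y hy
    refine hz _ ?_
    have h3 := (K.B.symm : Plane →L[ℝ] Plane).le_opNorm (y - K.B z)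
    simp only [ContinuousLinearEquiv.coe_coe, map_sub,
      ContinuousLinearEquiv.symm_apply_apply] at h3
    rw [mem_closedBall_iff_norm] at hy
    have h4 : ‖y - K.B z‖ * n ≤ ρ := by
      rw [inv_mul_eq_div, le_div_iff₀ hn0] at hy
      exact hy
    nlinarith [norm_nonneg (y - K.B z)]
  -- In the coordinates `B z` the map `F_K` is the identity plus a `c`-contraction, so it maps a
  -- ball of radius `r` onto a set containing the ball of radius `(1 - c) r`. The factor `n⁻¹` makes
  -- the preimage under `B` of a ball of radius `n⁻¹ ρ` fit into radius `ρ`.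
  have happ : ApproximatesLinearOn (K.map ∘ K.B.symm) (ContinuousLinearMap.id ℝ Plane)
      (K.B '' refTriangle) (Real.toNNReal c) := by
    rintro _ ⟨u, hu, rfl⟩ _ ⟨w, hw, rfl⟩
    rw [Real.coe_toNNReal _ hc0]
    have h5 : (K.map ∘ K.B.symm) (K.B u) - (K.map ∘ K.B.symm) (K.B w) -
        (ContinuousLinearMap.id ℝ Plane) (K.B u - K.B w) = K.Φ u - K.Φ w := by
      simp only [Function.comp_apply, ContinuousLinearEquiv.symm_apply_apply, map,
        ContinuousLinearMap.id_apply]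
      abel
    rw [h5]
    exact h2 w hw u hu
  let R : (ContinuousLinearMap.id ℝ Plane).NonlinearRightInverse :=
    { toFun := id, nnnorm := 1, bound' := by simp, right_inv' := by simp }
  have hsurj := happ.surjOn_closedBall_of_nonlinearRightInverse R (ε := n⁻¹ * ρ) (b := K.B z)
    (by positivity) (fun y hy => ⟨K.B.symm y, hS (hball y hy), K.B.apply_symm_apply y⟩)
  have hy' : y ∈ Metric.closedBall ((K.map ∘ K.B.symm) (K.B z))
      (((R.nnnorm : ℝ)⁻¹ - (Real.toNNReal c : ℝ)) * (n⁻¹ * ρ)) := by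
    rw [mem_closedBall_iff_norm, Real.coe_toNNReal _ hc0]
    simpa [R, mul_assoc] using hy
  obtain ⟨u', hu', hy''⟩ := hsurj hy'
  exact ⟨K.B.symm u', hball u' hu', hy''⟩

/-- The image of the open reference triangle. -/
def openCarrier : Set Plane := K.map '' refInterior

lemma openCarrier_subset : K.openCarrier ⊆ K.carrier := image_mono refInterior_subset

lemma isOpen_openCarrier : IsOpen K.openCarrier := by
  obtain ⟨q, hq, h⟩ := K.exists_preimage_of_near refInterior_subset
  rw [Metric.isOpen_iff]
  rintro _ ⟨z, hz, rfl⟩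
  obtain ⟨ρ, hρ, hball⟩ := Metric.nhds_basis_closedBall.mem_iff.1 (isOpen_refInterior.mem_nhds hz)
  refine ⟨q * ρ, by positivity, fun y hy => ?_⟩
  rw [mem_ball_iff_norm] at hy
  obtain ⟨u, hu, huy⟩ := h z ρ hρ.le (fun u hu => hball (mem_closedBall_iff_norm.2 hu)) y hy.le
  exact ⟨u, hu, huy⟩

lemma carrier_subset_closure : K.carrier ⊆ closure K.openCarrier := by
  rintro _ ⟨z, hz, rfl⟩
  have h1 := refTriangle_subset_closure hz
  exact ((K.hasFDerivWithinAt_map hz).continuousWithinAt.mono refInterior_subset).mem_closure_image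
    h1

lemma carrier_subset_closure_interior : K.carrier ⊆ closure (interior K.carrier) :=
  K.carrier_subset_closure.trans
    (closure_mono (interior_maximal K.openCarrier_subset K.isOpen_openCarrier))

/-! #### Directions pointing into and out of a curved triangle -/

/-- The parametrized edge opposite to `a`. -/
def edgeCurve (a : Fin 3) (s : ℝ) : Plane := K.map (refEdgePt a s)

/-- The velocity of `edgeCurve`. -/
def edgeVel (a : Fin 3) (s : ℝ) : Plane := K.jac (refEdgePt a s) (refEdgeDir a)

variable {K}

lemma edgeCurve_mem {a : Fin 3} {s : ℝ} (hs : s ∈ Icc (0 : ℝ) 1) : K.edgeCurve a s ∈ K.carrier :=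
  map_mem (refEdgePt_mem hs)

lemma planeCross_edgeVel {a : Fin 3} {s : ℝ} (hs : s ∈ Icc (0 : ℝ) 1) (w : Plane) :
    planeCross (K.edgeVel a s) w = planeDet (K.jac (refEdgePt a s)) *
      planeCross (refEdgeDir a) (K.jacInv (refEdgePt a s) w) := by
  rw [← planeCross_map, K.jac_jacInv (refEdgePt_mem hs)]
  rfl

lemma orient_mul_planeCross_edgeVel_pos {a : Fin 3} {s : ℝ} (hs : s ∈ Icc (0 : ℝ) 1) (w : Plane) :
    0 < K.orient * planeCross (K.edgeVel a s) w ↔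
      0 < planeCross (refEdgeDir a) (K.jacInv (refEdgePt a s) w) := by
  rw [planeCross_edgeVel hs, ← mul_assoc]
  exact mul_pos_iff_of_pos_left (K.orient_mul_planeDet_pos (refEdgePt_mem hs))

lemma orient_mul_planeCross_edgeVel_neg {a : Fin 3} {s : ℝ} (hs : s ∈ Icc (0 : ℝ) 1) (w : Plane) :
    K.orient * planeCross (K.edgeVel a s) w < 0 ↔
      planeCross (refEdgeDir a) (K.jacInv (refEdgePt a s) w) < 0 := by
  have := orient_mul_planeCross_edgeVel_pos (K := K) (a := a) hs (-w)
  rw [map_neg, planeCross_neg_right, planeCross_neg_right] at this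
  constructor
  · intro h; have := this.1 (by linarith); linarith
  · intro h; have := this.2 (by linarith); linarith

/-- Leaving `K` through an edge. -/
lemma eventually_notMem_carrier {a : Fin 3} {s : ℝ} (hs : s ∈ Icc (0 : ℝ) 1) {w : Plane}
    (hw : K.orient * planeCross (K.edgeVel a s) w < 0) :
    ∀ᶠ h in 𝓝[>] (0 : ℝ), K.edgeCurve a s + h • w ∉ K.carrier := by
  rw [orient_mul_planeCross_edgeVel_neg hs] at hw
  set z := refEdgePt a s with hz
  set y := K.edgeCurve a s with hy
  have hyK : y ∈ K.carrier := edgeCurve_mem hs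
  have hinv : K.inv y = z := inv_map (refEdgePt_mem hs)
  set Λ := planeCrossL (refEdgeDir a) with hΛ
  set δ := -planeCross (refEdgeDir a) (K.jacInv z w) with hδ
  have hδ0 : 0 < δ := by rw [hδ]; linarith
  have hD := K.hasFDerivWithinAt_inv hyK
  rw [hinv] at hD
  -- Were `y + h w` in `K`, the barycentric coordinate of its preimage would be nonnegative; to
  -- first order it is `-h δ`. With this `κ` the linearization error `‖Λ‖ κ h ‖w‖` is strictly
  -- smaller than `h δ`, a contradiction.
  set κ := δ / ((‖Λ‖ + 1) * (‖w‖ + 1)) with hκ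
  have hκ0 : 0 < κ := by positivity
  have hbound := hD.isLittleO.def hκ0
  have htend : Tendsto (fun h : ℝ => y + h • w) (𝓝[>] 0) (𝓝 y) := by
    have hc : Continuous fun h : ℝ => y + h • w := by fun_prop
    simpa using (hc.tendsto 0).mono_left (nhdsWithin_le_nhds (s := Ioi 0))
  have hev := htend.eventually (eventually_nhdsWithin_iff.1 hbound)
  filter_upwards [hev, self_mem_nhdsWithin] with h hh hpos hmem
  have hpos : 0 < h := hpos
  have h1 := hh hmem
  rw [hinv, add_sub_cancel_left, norm_smul, Real.norm_of_nonneg hpos.le, map_smul] at h1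
  have h2 : 0 ≤ Λ (K.inv (y + h • w) - z) := by
    rw [hΛ, planeCrossL_apply, ← refBary_sub, hz, refBary_edgePt_self, sub_zero]
    exact (mem_refTriangle _).1 (inv_mem hmem) a
  have h3 := Λ.le_opNorm (K.inv (y + h • w) - z - h • K.jacInv z w)
  rw [map_sub, map_smul] at h3
  have h4 : Λ (K.jacInv z w) = -δ := by rw [hΛ, planeCrossL_apply, hδ, neg_neg]
  rw [h4, Real.norm_eq_abs, smul_eq_mul] at h3
  have h5 := (le_abs_self _).trans h3
  have h6 : ‖Λ‖ * ‖K.inv (y + h • w) - z - h • K.jacInv z w‖ ≤ ‖Λ‖ * (κ * (h * ‖w‖)) := by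
    gcongr
  have h7 : ‖Λ‖ * (κ * (h * ‖w‖)) < h * δ := by
    have : κ * ((‖Λ‖ + 1) * (‖w‖ + 1)) = δ := by rw [hκ]; field_simp
    rw [← this]
    have e : h * (κ * ((‖Λ‖ + 1) * (‖w‖ + 1))) - ‖Λ‖ * (κ * (h * ‖w‖)) =
        h * κ * (‖Λ‖ + ‖w‖ + 1) := by ring
    have : 0 < h * κ * (‖Λ‖ + ‖w‖ + 1) := by positivity
    linarith
  linarith

/-- Entering `K` through the relative interior of an edge. -/
lemma eventually_mem_openCarrier {a : Fin 3} {s : ℝ} (hs : s ∈ Ioo (0 : ℝ) 1) {w : Plane}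
    (hw : 0 < K.orient * planeCross (K.edgeVel a s) w) :
    ∀ᶠ h in 𝓝[>] (0 : ℝ), K.edgeCurve a s + h • w ∈ K.openCarrier := by
  have hsI := Ioo_subset_Icc_self hs
  rw [orient_mul_planeCross_edgeVel_pos hsI] at hw
  set z := refEdgePt a s with hz
  set m := K.jacInv z w with hm
  have hzT : z ∈ refTriangle := refEdgePt_mem hsI
  set Λ := planeCrossL (refEdgeDir a) with hΛ
  set δ := planeCross (refEdgeDir a) m with hδ
  -- At `z + h m` the coordinate belonging to `a` equals `h δ`, and it varies by at most `‖Λ‖ κ h <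
  -- h δ` on the ball of radius `κ h` around that point. The other two coordinates stay positive by
  -- continuity, so the whole ball lies in the open triangle.
  set κ := δ / (2 * (‖Λ‖ + 1)) with hκ
  have hκ0 : 0 < κ := by positivity
  obtain ⟨q, hq, hpre⟩ := K.exists_preimage_of_near refInterior_subset
  set V : Set Plane := {u | 0 < refBary (a + 1) u ∧ 0 < refBary (a + 2) u} with hV
  have hVo : IsOpen V := (isOpen_lt continuous_const (continuous_refBary _)).inter
    (isOpen_lt continuous_const (continuous_refBary _))
  have hzV : z ∈ V := by
    refine ⟨?_, ?_⟩
    · rw [hz, refBary_edgePt_succ]; linarith [hs.2]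
    · rw [hz, refBary_edgePt_add_two]; exact hs.1
  obtain ⟨r, hr, hrV⟩ := Metric.isOpen_iff.1 hVo z hzV
  have hball : ∀ h : ℝ, 0 < h → h * (‖m‖ + κ) < r → ∀ u, ‖u - (z + h • m)‖ ≤ κ * h →
      u ∈ refInterior := by
    intro h h0 hr' u hu
    have hu1 : u ∈ V := by
      refine hrV ?_
      rw [mem_ball_iff_norm]
      calc ‖u - z‖ = ‖(u - (z + h • m)) + h • m‖ := by congr 1; abel
        _ ≤ κ * h + h * ‖m‖ := by
          refine (norm_add_le _ _).trans (add_le_add hu ?_)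
          rw [norm_smul, Real.norm_of_nonneg h0.le]
        _ < r := by linarith
    have hu2 : 0 < refBary a u := by
      have e : refBary a u = Λ (u - (z + h • m)) + h * δ := by
        rw [hΛ, planeCrossL_apply, ← refBary_sub, refBary_add, planeCross_smul_right, hz,
          refBary_edgePt_self]
        ring
      have h3 := Λ.le_opNorm (u - (z + h • m))
      rw [Real.norm_eq_abs] at h3
      have h4 := (neg_le_abs _).trans h3
      have h5 : ‖Λ‖ * ‖u - (z + h • m)‖ ≤ ‖Λ‖ * (κ * h) := by gcongr
      have h6 : κ * (2 * (‖Λ‖ + 1)) = δ := by rw [hκ]; field_simp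
      have h7 : 0 < κ * h * (‖Λ‖ + 2) := by positivity
      rw [e, ← h6]
      nlinarith
    intro b
    rcases fin3_cases a b with rfl | rfl | rfl
    exacts [hu2, hu1.1, hu1.2]
  have hD := K.hasFDerivWithinAt_map hzT
  have hm1 : 0 < ‖m‖ + 1 := by positivity
  -- The error of the linearization at `z + h m` is at most this constant times `h ‖m‖`, hence at
  -- most `q κ h`, which is within reach of the open mapping property on the ball of radius `κ h`.
  have hbound := hD.isLittleO.def (c := q * κ / (‖m‖ + 1)) (by positivity)
  have htend : Tendsto (fun h : ℝ => z + h • m) (𝓝[>] 0) (𝓝 z) := by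
    have hc : Continuous fun h : ℝ => z + h • m := by fun_prop
    simpa using (hc.tendsto 0).mono_left (nhdsWithin_le_nhds (s := Ioi 0))
  have hev := htend.eventually (eventually_nhdsWithin_iff.1 hbound)
  have hsmall : ∀ᶠ h in 𝓝[>] (0 : ℝ), h ∈ Ioo 0 (r / (‖m‖ + κ)) :=
    Ioo_mem_nhdsGT (by positivity)
  filter_upwards [hev, hsmall] with h hh hr'
  have h0 : 0 < h := hr'.1
  have hr'' : h * (‖m‖ + κ) < r := by
    rw [← lt_div_iff₀ (by positivity)]; exact hr'.2
  have hmem : z + h • m ∈ refTriangle :=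
    refInterior_subset (hball h h0 hr'' _ (by rw [sub_self, norm_zero]; positivity))
  have h1 := hh hmem
  rw [add_sub_cancel_left, norm_smul, Real.norm_of_nonneg h0.le, map_smul, hm,
    K.jac_jacInv hzT] at h1
  refine hpre (z + h • m) (κ * h) (by positivity) (hball h h0 hr'') _ ?_
  rw [norm_sub_rev]
  have e : K.map (z + h • m) - (K.edgeCurve a s + h • w) =
      K.map (z + h • K.jacInv z w) - K.map z - h • w := by
    simp only [edgeCurve, hz, hm]; abel
  rw [e]
  refine h1.trans ?_
  rw [← hm, div_mul_eq_mul_div, div_le_iff₀ hm1]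
  have : 0 ≤ q * κ * h := by positivity
  nlinarith

end CurvedTriangle

/-! ### Piecewise polynomial functions on one curved triangle -/

lemma contDiff_mvPolynomial_eval (p : MvPolynomial (Fin 2) ℝ) {n : WithTop ℕ∞} :
    ContDiff ℝ n fun y : Plane => MvPolynomial.eval (fun i => y i) p := by
  simp_rw [MvPolynomial.eval_eq']
  refine ContDiff.sum fun d _ => contDiff_const.mul (contDiff_prod fun i _ => ?_)
  exact ContDiff.pow (by fun_prop) _

/-- The cross product of two covectors. -/
def covCross (A C : Plane →L[ℝ] ℝ) : ℝ :=
  A (unitVec 0) * C (unitVec 1) - A (unitVec 1) * C (unitVec 0)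

namespace CurvedTriangle

variable (K : CurvedTriangle)

/-- The derivative of the inverse is `jacInv` composed with the inverse, so regularity is gained one
order at a time: continuity gives `C¹` here, and `C¹` gives `C²` in `contDiffOn_inv`. -/
lemma contDiffOn_inv_one : ContDiffOn ℝ 1 K.inv K.carrier := by
  rw [show (1 : WithTop ℕ∞) = 0 + 1 by simp, contDiffOn_succ_iff_fderivWithin
    K.uniqueDiffOn_carrier]
  refine ⟨fun y hy => (K.hasFDerivWithinAt_inv hy).differentiableWithinAt, by simp, ?_⟩
  rw [contDiffOn_zero]
  have hcont : ContinuousOn K.jacInv refTriangle := by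
    intro z hz
    have h : ContDiffAt ℝ 1 ContinuousLinearMap.inverse (K.jac z) := by
      rw [← K.coe_jacEquiv hz]; exact contDiffAt_map_inverse _
    exact h.continuousAt.comp_continuousWithinAt (K.continuousOn_jac z hz)
  exact (hcont.comp K.continuousOn_inv fun y hy => inv_mem hy).congr fun y hy =>
    (K.hasFDerivWithinAt_inv hy).fderivWithin (K.uniqueDiffOn_carrier y hy)

lemma contDiffOn_inv (hK : ContDiffOn ℝ 2 K.map refTriangle) :
    ContDiffOn ℝ 2 K.inv K.carrier := by
  rw [show (2 : WithTop ℕ∞) = 1 + 1 by norm_num, contDiffOn_succ_iff_fderivWithin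
    K.uniqueDiffOn_carrier]
  refine ⟨fun y hy => (K.hasFDerivWithinAt_inv hy).differentiableWithinAt, by simp, ?_⟩
  exact ((K.contDiffOn_jacInv hK).comp K.contDiffOn_inv_one fun y hy => inv_mem hy).congr
    fun y hy => (K.hasFDerivWithinAt_inv hy).fderivWithin (K.uniqueDiffOn_carrier y hy)

lemma MemShape.contDiffOn {K : CurvedTriangle} {k : ℕ} {v : Plane → ℝ} (hv : K.MemShape k v)
    (hK : ContDiffOn ℝ 2 K.map refTriangle) : ContDiffOn ℝ 2 v K.carrier := by
  obtain ⟨p, -, hp⟩ := hv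
  refine ((contDiff_mvPolynomial_eval p).comp_contDiffOn (K.contDiffOn_inv hK)).congr
    fun y hy => ?_
  rw [Function.comp_apply, ← hp _ (inv_mem hy), map_inv hy]

/-- The differential of `v|_K`. -/
def grad (v : Plane → ℝ) (y : Plane) : Plane →L[ℝ] ℝ := fderivWithin ℝ v K.carrier y

/-- The second differential of `v|_K`. -/
def hess (v : Plane → ℝ) (y : Plane) : Plane →L[ℝ] Plane →L[ℝ] ℝ :=
  fderivWithin ℝ (K.grad v) K.carrier y

variable {K} {v : Plane → ℝ}

lemma hasFDerivWithinAt_grad (hv : ContDiffOn ℝ 2 v K.carrier) {y : Plane} (hy : y ∈ K.carrier) :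
    HasFDerivWithinAt v (K.grad v y) K.carrier y :=
  (hv.differentiableOn two_ne_zero y hy).hasFDerivWithinAt

lemma contDiffOn_grad (hv : ContDiffOn ℝ 2 v K.carrier) :
    ContDiffOn ℝ 1 (K.grad v) K.carrier :=
  hv.fderivWithin K.uniqueDiffOn_carrier (by norm_num)

lemma hasFDerivWithinAt_hess (hv : ContDiffOn ℝ 2 v K.carrier) {y : Plane} (hy : y ∈ K.carrier) :
    HasFDerivWithinAt (K.grad v) (K.hess v y) K.carrier y :=
  ((contDiffOn_grad hv).differentiableOn one_ne_zero y hy).hasFDerivWithinAt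

lemma continuousOn_hess (hv : ContDiffOn ℝ 2 v K.carrier) :
    ContinuousOn (K.hess v) K.carrier :=
  (contDiffOn_grad hv).continuousOn_fderivWithin K.uniqueDiffOn_carrier le_rfl

/-- Symmetry of one-sided second derivatives at boundary points is inherited from the interior,
since `K` lies in the closure of its interior. -/
lemma hess_symm (hv : ContDiffOn ℝ 2 v K.carrier) {y : Plane} (hy : y ∈ K.carrier)
    (u w : Plane) : K.hess v y u w = K.hess v y w u :=
  (hv y hy).isSymmSndFDerivWithinAt (by simp) K.uniqueDiffOn_carrier
    (K.carrier_subset_closure_interior hy) hy u w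

lemma secondPartial_eq (hv : ContDiffOn ℝ 2 v K.carrier) {y : Plane} (hy : y ∈ K.carrier)
    (i j : Fin 2) :
    secondPartial v K.carrier i j y = K.hess v y (unitVec i) (unitVec j) := by
  have h := (hasFDerivWithinAt_hess hv hy).clm_apply
    (hasFDerivWithinAt_const (unitVec j) y K.carrier)
  rw [secondPartial]
  change fderivWithin ℝ (fun z => K.grad v z (unitVec j)) K.carrier y (unitVec i) = _
  rw [h.fderivWithin (K.uniqueDiffOn_carrier y hy)]
  simp

lemma continuousOn_hess_apply (hv : ContDiffOn ℝ 2 v K.carrier) (u w : Plane) :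
    ContinuousOn (fun y => K.hess v y u w) K.carrier :=
  ((continuousOn_hess hv).clm_apply continuousOn_const).clm_apply continuousOn_const

lemma continuousOn_secondPartial (hv : ContDiffOn ℝ 2 v K.carrier) (i j : Fin 2) :
    ContinuousOn (secondPartial v K.carrier i j) K.carrier :=
  (continuousOn_hess_apply hv _ _).congr fun _ hy => secondPartial_eq hv hy i j

lemma integrableOn_laplacianOn_sq (hv : ContDiffOn ℝ 2 v K.carrier) :
    IntegrableOn (fun y => laplacianOn v K.carrier y ^ 2) K.carrier := by
  refine ContinuousOn.integrableOn_compact K.isCompact_carrier ?_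
  have := fun i => continuousOn_secondPartial hv i i
  unfold laplacianOn
  exact (continuousOn_finsetSum _ fun i _ => this i).pow 2

lemma integrableOn_hessianNormSqOn (hv : ContDiffOn ℝ 2 v K.carrier) :
    IntegrableOn (hessianNormSqOn v K.carrier) K.carrier := by
  refine ContinuousOn.integrableOn_compact K.isCompact_carrier ?_
  exact continuousOn_finsetSum _ fun i _ => continuousOn_finsetSum _ fun j _ =>
    (continuousOn_secondPartial hv i j).pow 2

variable (K) in
/-- The contribution of the edge opposite to `a` to `∫_K (Δv)² - |D²v|²`. -/
def edgeTerm (v : Plane → ℝ) (a : Fin 3) : ℝ :=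
  K.orient * ∫ s in (0 : ℝ)..1,
    covCross (K.grad v (K.edgeCurve a s)) (K.hess v (K.edgeCurve a s) (K.edgeVel a s))

lemma continuousOn_edgeCurve (a : Fin 3) : ContinuousOn (K.edgeCurve a) (Icc 0 1) :=
  K.contDiffOn_map.continuousOn.comp (continuous_refEdgePt a).continuousOn
    fun _ hs => refEdgePt_mem hs

lemma continuousOn_edgeVel (a : Fin 3) : ContinuousOn (K.edgeVel a) (Icc 0 1) :=
  (K.continuousOn_jac.comp (continuous_refEdgePt a).continuousOn
    fun _ hs => refEdgePt_mem hs).clm_apply continuousOn_const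

lemma hasDerivWithinAt_edgeCurve (a : Fin 3) {s : ℝ} (hs : s ∈ Icc (0 : ℝ) 1) :
    HasDerivWithinAt (K.edgeCurve a) (K.edgeVel a s) (Icc 0 1) s :=
  (K.hasFDerivWithinAt_map (refEdgePt_mem hs)).comp_hasDerivWithinAt s
    (hasDerivAt_refEdgePt a s).hasDerivWithinAt fun _ hr => refEdgePt_mem hr

lemma hasDerivWithinAt_grad_edgeCurve (hv : ContDiffOn ℝ 2 v K.carrier) (a : Fin 3) {s : ℝ}
    (hs : s ∈ Icc (0 : ℝ) 1) :
    HasDerivWithinAt (fun s => K.grad v (K.edgeCurve a s))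
      (K.hess v (K.edgeCurve a s) (K.edgeVel a s)) (Icc 0 1) s :=
  (hasFDerivWithinAt_hess hv (edgeCurve_mem hs)).comp_hasDerivWithinAt s
    (hasDerivWithinAt_edgeCurve a hs) fun _ hr => edgeCurve_mem hr

lemma continuousOn_grad_edgeCurve (hv : ContDiffOn ℝ 2 v K.carrier) (a : Fin 3) :
    ContinuousOn (fun s => K.grad v (K.edgeCurve a s)) (Icc 0 1) :=
  (contDiffOn_grad hv).continuousOn.comp (continuousOn_edgeCurve a) fun _ hr => edgeCurve_mem hr

lemma continuousOn_hess_edgeCurve (hv : ContDiffOn ℝ 2 v K.carrier) (a : Fin 3) :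
    ContinuousOn (fun s => K.hess v (K.edgeCurve a s) (K.edgeVel a s)) (Icc 0 1) :=
  ((continuousOn_hess hv).comp (continuousOn_edgeCurve a)
    fun _ hr => edgeCurve_mem hr).clm_apply (continuousOn_edgeVel a)

/-- `∫_K (Δv)² - |D²v|²` is a boundary term. -/
theorem integral_laplacianOn_sq (hv : ContDiffOn ℝ 2 v K.carrier) :
    ∫ y in K.carrier, laplacianOn v K.carrier y ^ 2 =
      (∫ y in K.carrier, hessianNormSqOn v K.carrier y) + ∑ a, K.edgeTerm v a := by
  have hm : MeasurableSet refTriangle := isCompact_refTriangle.isClosed.measurableSet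
  -- The partial derivatives of `v` are pulled back to the reference triangle; being only `C¹`, they
  -- need the low regularity form of Green's formula.
  set f : Fin 2 → Plane → ℝ := fun i z => K.grad v (K.map z) (unitVec i) with hf
  set f' : Fin 2 → Plane → Plane →L[ℝ] ℝ := fun i z =>
    ((K.hess v (K.map z)).comp (K.jac z)).flip (unitVec i) with hf'
  have hderiv : ∀ i, ∀ z ∈ refTriangle, HasFDerivWithinAt (f i) (f' i z) refTriangle z := by
    intro i z hz
    have h := ((hasFDerivWithinAt_hess hv (map_mem hz)).comp z (K.hasFDerivWithinAt_map hz)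
      fun _ hw => map_mem hw).clm_apply (hasFDerivWithinAt_const (unitVec i) z refTriangle)
    rw [ContinuousLinearMap.comp_zero, zero_add] at h
    exact h
  have hcont : ∀ i, ContinuousOn (f' i) refTriangle := by
    intro i
    have h1 : ContinuousOn (fun z => (K.hess v (K.map z)).comp (K.jac z)) refTriangle :=
      ((continuousOn_hess hv).comp K.contDiffOn_map.continuousOn
        fun _ hz => map_mem hz).clm_comp K.continuousOn_jac
    have h2 := (ContinuousLinearMap.flipₗᵢ ℝ Plane Plane ℝ).continuous.comp_continuousOn h1
    exact h2.clm_apply continuousOn_const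
  -- Using both orders of the pair, one with the opposite sign, accounts for the factor `2` in `2
  -- det D²v` and yields the antisymmetric form `covCross` on the edges.
  have g01 := green_refTriangle (hderiv 0) (hderiv 1) (hcont 0) (hcont 1)
  have g10 := green_refTriangle (hderiv 1) (hderiv 0) (hcont 1) (hcont 0)
  have ganti : ∫ z in refTriangle, (f' 1 z (unitVec 0) * f' 0 z (unitVec 1)
      - f' 1 z (unitVec 1) * f' 0 z (unitVec 0)) = -∫ z in refTriangle,
      (f' 0 z (unitVec 0) * f' 1 z (unitVec 1) - f' 0 z (unitVec 1) * f' 1 z (unitVec 0)) := by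
    rw [← integral_neg]
    congr 1; ext z; ring
  rw [ganti] at g10
  -- The integrand is `2 det D²v`. Its product with the Jacobian determinant of `F_K` is twice the
  -- determinant of the pulled back pair, and `orient` removes the absolute value from the change of
  -- variables.
  have hdiff : (∫ y in K.carrier, laplacianOn v K.carrier y ^ 2) -
      ∫ y in K.carrier, hessianNormSqOn v K.carrier y =
      2 * (K.orient * ∫ z in refTriangle, (f' 0 z (unitVec 0) * f' 1 z (unitVec 1)
        - f' 0 z (unitVec 1) * f' 1 z (unitVec 0))) := by
    rw [← integral_sub (integrableOn_laplacianOn_sq hv) (integrableOn_hessianNormSqOn hv)]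
    have hcv := integral_image_eq_integral_abs_det_fderiv_smul volume hm
      (fun z hz => K.hasFDerivWithinAt_map hz) K.injOn_map
      (fun y => laplacianOn v K.carrier y ^ 2 - hessianNormSqOn v K.carrier y)
    refine hcv.trans ?_
    rw [← integral_const_mul, ← integral_const_mul]
    refine setIntegral_congr_fun hm fun z hz => ?_
    have hy := map_mem (K := K) hz
    have hs := hess_symm hv hy (unitVec 0) (unitVec 1)
    simp only [laplacianOn, hessianNormSqOn, Fin.sum_univ_two, secondPartial_eq hv hy]
    rw [det_eq_planeDet, K.abs_planeDet_jac hz]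
    have e : ∀ i j : Fin 2, f' i z (unitVec j) =
        K.jac z (unitVec j) 0 * K.hess v (K.map z) (unitVec 0) (unitVec i) +
        K.jac z (unitVec j) 1 * K.hess v (K.map z) (unitVec 1) (unitVec i) := by
      intro i j
      simp only [hf', ContinuousLinearMap.flip_apply, ContinuousLinearMap.comp_apply]
      rw [clm_apply_plane (K.hess v (K.map z)) (K.jac z (unitVec j))]
      simp
    rw [e 0 0, e 0 1, e 1 0, e 1 1, hs, smul_eq_mul, planeDet, planeCross]
    ring
  have hterm : ∀ a, K.edgeTerm v a = K.orient * ((∫ s in (0 : ℝ)..1, f 0 (refEdgePt a s) *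
      f' 1 (refEdgePt a s) (refEdgeDir a)) - ∫ s in (0 : ℝ)..1, f 1 (refEdgePt a s) *
      f' 0 (refEdgePt a s) (refEdgeDir a)) := by
    intro a
    have hi : ∀ i j, IntervalIntegrable (fun s => f i (refEdgePt a s) *
        f' j (refEdgePt a s) (refEdgeDir a)) volume 0 1 := by
      intro i j
      refine ContinuousOn.intervalIntegrable ?_
      rw [uIcc_of_le zero_le_one]
      have c1 : ContinuousOn (fun s => f i (refEdgePt a s)) (Icc 0 1) :=
        (continuousOn_grad_edgeCurve hv a).clm_apply continuousOn_const
      have c2 : ContinuousOn (fun s => f' j (refEdgePt a s)) (Icc 0 1) :=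
        (hcont j).comp (continuous_refEdgePt a).continuousOn fun _ hs => refEdgePt_mem hs
      exact c1.mul (c2.clm_apply continuousOn_const)
    rw [← intervalIntegral.integral_sub (hi 0 1) (hi 1 0)]
    rfl
  simp_rw [hterm]
  rw [← Finset.mul_sum, Finset.sum_sub_distrib, ← g01, ← g10]
  linarith

end CurvedTriangle

/-! ### Edges and outward normals of a curved triangle -/

lemma planeCross_eq_zero_iff {t u : Plane} (ht : ‖t‖ = 1) :
    planeCross t u = 0 ↔ u = (inner ℝ t u : ℝ) • t := by
  rw [plane_norm_eq_one_iff] at ht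
  rw [plane_inner]
  constructor
  · intro h
    simp only [planeCross] at h
    apply plane_ext
    · simp only [PiLp.smul_apply, smul_eq_mul]
      linear_combination (-u 0) * ht - t 1 * h
    · simp only [PiLp.smul_apply, smul_eq_mul]
      linear_combination (-u 1) * ht + t 0 * h
  · intro h
    rw [h, planeCross_smul_right]
    simp only [planeCross]; ring

lemma norm_rot90 (w : Plane) : ‖rot90 w‖ = ‖w‖ := by
  have h : ‖rot90 w‖ ^ 2 = ‖w‖ ^ 2 := by
    rw [plane_norm_sq, plane_norm_sq]; simp; ring
  exact (sq_eq_sq₀ (norm_nonneg _) (norm_nonneg _)).1 h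

lemma rot90_neg (w : Plane) : rot90 (-w) = -rot90 w := by
  apply plane_ext <;> simp

lemma inner_rot90_self (w : Plane) : inner ℝ w (rot90 w) = (0 : ℝ) := by
  rw [plane_inner]; simp; ring

lemma planeCross_rot90_right (u w : Plane) : planeCross u (rot90 w) = inner ℝ u w := by
  rw [plane_inner]; simp [planeCross]

/-- Unit vectors orthogonal to a common unit vector agree up to sign. -/
lemma eq_or_eq_neg_of_orthogonal {t n m : Plane} (ht : ‖t‖ = 1) (hn : ‖n‖ = 1) (hm : ‖m‖ = 1)
    (h1 : inner ℝ n t = (0 : ℝ)) (h2 : inner ℝ m t = (0 : ℝ)) : m = n ∨ m = -n := by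
  have e1 : n = (inner ℝ (rot90 t) n : ℝ) • rot90 t := by
    rw [← planeCross_eq_zero_iff (by rwa [norm_rot90]), planeCross_rot90_left,
      real_inner_comm, h1, neg_zero]
  have e2 : m = (inner ℝ (rot90 t) m : ℝ) • rot90 t := by
    rw [← planeCross_eq_zero_iff (by rwa [norm_rot90]), planeCross_rot90_left,
      real_inner_comm, h2, neg_zero]
  set α : ℝ := inner ℝ (rot90 t) n
  set β : ℝ := inner ℝ (rot90 t) m
  have a1 : |α| = 1 := by
    rw [← hn, e1, norm_smul, norm_rot90, ht, mul_one, Real.norm_eq_abs]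
  have b1 : |β| = 1 := by
    rw [← hm, e2, norm_smul, norm_rot90, ht, mul_one, Real.norm_eq_abs]
  rcases abs_eq_abs.1 (b1.trans a1.symm) with h | h
  · left; rw [e2, h, ← e1]
  · right; rw [e2, h, neg_smul, ← e1]

namespace CurvedTriangle

variable {K : CurvedTriangle}

lemma edge_eq_image (a : Fin 3) : K.edge a = K.edgeCurve a '' Icc 0 1 := by
  rw [edge, refEdge_eq_image, image_image]; rfl

lemma edgeCurve_mem_edge {a : Fin 3} {s : ℝ} (hs : s ∈ Icc (0 : ℝ) 1) :
    K.edgeCurve a s ∈ K.edge a := by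
  rw [edge_eq_image]; exact mem_image_of_mem _ hs

lemma edge_subset_carrier (a : Fin 3) : K.edge a ⊆ K.carrier := by
  rw [edge_eq_image]
  rintro _ ⟨s, hs, rfl⟩
  exact edgeCurve_mem hs

lemma isCompact_edge (a : Fin 3) : IsCompact (K.edge a) := by
  rw [edge_eq_image]
  exact isCompact_Icc.image_of_continuousOn (continuousOn_edgeCurve a)

lemma edgeCurve_zero (a : Fin 3) : K.edgeCurve a 0 = K.vertex (a + 1) := by
  rw [edgeCurve, refEdgePt_left, vertex]

lemma edgeCurve_one (a : Fin 3) : K.edgeCurve a 1 = K.vertex (a + 2) := by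
  rw [edgeCurve, refEdgePt_right, vertex]

lemma vertex_mem (a : Fin 3) : K.vertex a ∈ K.carrier := map_mem (refVertex_mem a)

lemma injOn_edgeCurve (a : Fin 3) : InjOn (K.edgeCurve a) (Icc 0 1) := fun _ hs _ hr h =>
  refEdgePt_injective a (K.injOn_map (refEdgePt_mem hs) (refEdgePt_mem hr) h)

lemma edgeCurve_ne_vertex {a c : Fin 3} {s : ℝ} (hs : s ∈ Ioo (0 : ℝ) 1) :
    K.edgeCurve a s ≠ K.vertex c := fun h =>
  refEdgePt_ne_vertex hs
    (K.injOn_map (refEdgePt_mem (Ioo_subset_Icc_self hs)) (refVertex_mem c) h)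

lemma mem_Ioo_of_ne_vertex {a : Fin 3} {s : ℝ} (hs : s ∈ Icc (0 : ℝ) 1)
    (h : ∀ c, K.edgeCurve a s ≠ K.vertex c) : s ∈ Ioo (0 : ℝ) 1 := by
  refine ⟨lt_of_le_of_ne hs.1 ?_, lt_of_le_of_ne hs.2 ?_⟩
  · rintro rfl; exact h _ (edgeCurve_zero a)
  · rintro rfl; exact h _ (edgeCurve_one a)

lemma edgeCurve_edge_unique {a c : Fin 3} {s : ℝ} (hs : s ∈ Ioo (0 : ℝ) 1)
    (h : K.edgeCurve a s ∈ K.edge c) : c = a := by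
  rw [edge_eq_image] at h
  obtain ⟨r, hr, h⟩ := h
  exact refEdgePt_edge_unique hs (K.injOn_map (refEdgePt_mem (Ioo_subset_Icc_self hs))
    (refEdgePt_mem hr) h.symm)

lemma edge_injective : Function.Injective K.edge := by
  intro c a h
  have hs : (1 / 2 : ℝ) ∈ Ioo (0 : ℝ) 1 := by norm_num
  refine edgeCurve_edge_unique (K := K) hs ?_
  rw [h]
  exact edgeCurve_mem_edge (Ioo_subset_Icc_self hs)

lemma notMem_edge_of_mem_openCarrier {y : Plane} (hy : y ∈ K.openCarrier) (a : Fin 3) :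
    y ∉ K.edge a := by
  obtain ⟨z, hz, rfl⟩ := hy
  rw [edge_eq_image]
  rintro ⟨s, hs, h⟩
  have := K.injOn_map (refEdgePt_mem hs) (refInterior_subset hz) h
  exact refEdgePt_notMem_refInterior a s (this ▸ hz)

lemma vertex_mem_edge (a : Fin 3) : K.vertex a ∈ K.edge (a + 1) := by
  have := edgeCurve_mem_edge (K := K) (a := a + 1) (s := 1) (by simp)
  rwa [edgeCurve_one, add_assoc, show (1 + 2 : Fin 3) = 0 from rfl, add_zero] at this

lemma mem_openCarrier_or_edge {y : Plane} (hy : y ∈ K.carrier) :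
    y ∈ K.openCarrier ∨ ∃ a, y ∈ K.edge a := by
  obtain ⟨z, hz, rfl⟩ := hy
  rcases refInterior_or_edge hz with h | ⟨a, s, hs, rfl⟩
  · exact Or.inl (mem_image_of_mem _ h)
  · exact Or.inr ⟨a, edgeCurve_mem_edge hs⟩

lemma edgeVel_ne_zero {a : Fin 3} {s : ℝ} (hs : s ∈ Icc (0 : ℝ) 1) : K.edgeVel a s ≠ 0 := by
  intro h
  exact refEdgeDir_ne_zero a ((K.jac_injective (refEdgePt_mem hs)) (by rw [map_zero]; exact h))

/-! #### Straight edges -/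

lemma vertex_ne (a : Fin 3) : K.vertex (a + 1) ≠ K.vertex (a + 2) := by
  rw [← edgeCurve_zero, ← edgeCurve_one]
  intro h
  have := injOn_edgeCurve a (by simp) (by simp) h
  norm_num at this

/-- The velocity of the parametrized edge is parallel to a unit tangent of the edge. -/
lemma edgeVel_eq_smul {a : Fin 3} {t : Plane} (ht : IsUnitTangent (K.edge a) t) {s : ℝ}
    (hs : s ∈ Icc (0 : ℝ) 1) : K.edgeVel a s = (inner ℝ t (K.edgeVel a s) : ℝ) • t := by
  rw [← planeCross_eq_zero_iff ht.1]
  have h1 : HasDerivWithinAt (fun r => planeCrossL t (K.edgeCurve a r - K.edgeCurve a s))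
      (planeCrossL t (K.edgeVel a s)) (Icc 0 1) s :=
    (planeCrossL t).hasFDerivAt.comp_hasDerivWithinAt s
      ((hasDerivWithinAt_edgeCurve a hs).sub_const _)
  have h2 : HasDerivWithinAt (fun r => planeCrossL t (K.edgeCurve a r - K.edgeCurve a s))
      0 (Icc 0 1) s := by
    refine (hasDerivWithinAt_const s (Icc (0 : ℝ) 1) (0 : ℝ)).congr ?_ (by simp)
    intro r hr
    obtain ⟨c, hc⟩ := ht.2 _ (edgeCurve_mem_edge hs) _ (edgeCurve_mem_edge hr)
    rw [hc, planeCrossL_apply, planeCross_smul_right]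
    simp only [planeCross]; ring
  rw [← planeCrossL_apply]
  exact (uniqueDiffOn_Icc zero_lt_one s hs).eq_deriv _ h1 h2

lemma exists_isUnitTangent {a : Fin 3} (ha : K.IsStraightEdge a) :
    ∃ t, IsUnitTangent (K.edge a) t := by
  set p := K.vertex (a + 1)
  set q := K.vertex (a + 2)
  have hpq : ‖q - p‖ ≠ 0 := by
    rw [norm_ne_zero_iff, sub_ne_zero]; exact (vertex_ne a).symm
  refine ⟨‖q - p‖⁻¹ • (q - p), ?_, ?_⟩
  · rw [norm_smul, norm_inv, norm_norm, inv_mul_cancel₀ hpq]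
  · intro y hy z hz
    rw [ha, segment_eq_image'] at hy hz
    obtain ⟨α, -, rfl⟩ := hy
    obtain ⟨β, -, rfl⟩ := hz
    refine ⟨(β - α) * ‖q - p‖, ?_⟩
    rw [smul_smul, mul_assoc, mul_inv_cancel₀ hpq, mul_one]
    module

lemma isOutwardNormal_inner {F : Set Plane} {n t : Plane} {a : Fin 3} (hF : F = K.edge a)
    (ht : IsUnitTangent F t) (hn : ∀ y ∈ F, ∀ z ∈ F, inner ℝ n (z - y) = (0 : ℝ)) :
    inner ℝ n t = (0 : ℝ) := by
  subst hF
  have h0 := edgeCurve_mem_edge (K := K) (a := a) (s := 0) (by simp)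
  have h1 := edgeCurve_mem_edge (K := K) (a := a) (s := 1) (by simp)
  obtain ⟨c, hc⟩ := ht.2 _ h0 _ h1
  have h2 := hn _ h0 _ h1
  rw [hc, inner_smul_right] at h2
  rcases mul_eq_zero.1 h2 with h | h
  · exfalso
    rw [h, zero_smul, sub_eq_zero, edgeCurve_zero, edgeCurve_one] at hc
    exact vertex_ne a hc.symm
  · exact h

/-- The normal is picked by a choice operator, so existence and uniqueness must both be shown. A
unit normal can be given one sign along the entire edge because the tangential speed never vanishes.
The opposite unit vector points into `K` at the midpoint parameter, so it cannot be outward. -/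
lemma outwardNormal_spec {a : Fin 3} (ha : K.IsStraightEdge a) :
    ‖outwardNormal K.carrier (K.edge a)‖ = 1 ∧
    (∀ y ∈ K.edge a, ∀ z ∈ K.edge a,
      inner ℝ (outwardNormal K.carrier (K.edge a)) (z - y) = (0 : ℝ)) ∧
    ∀ s ∈ Icc (0 : ℝ) 1,
      K.orient * planeCross (K.edgeVel a s) (outwardNormal K.carrier (K.edge a)) < 0 := by
  obtain ⟨t, ht⟩ := exists_isUnitTangent ha
  set τ : ℝ → ℝ := fun s => inner ℝ t (K.edgeVel a s) with hτ
  have hvel : ∀ s ∈ Icc (0 : ℝ) 1, K.edgeVel a s = τ s • t := fun s hs => edgeVel_eq_smul ht hs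
  have hτ0 : ∀ s ∈ Icc (0 : ℝ) 1, τ s ≠ 0 := fun s hs h => edgeVel_ne_zero hs (by
    rw [hvel s hs, h, zero_smul])
  have hτc : ContinuousOn τ (Icc 0 1) := continuousOn_const.inner (continuousOn_edgeVel a)
  have hor : K.orient ≠ 0 := fun h => by
    have := K.orient_sq; rw [h] at this; norm_num at this
  have hord := (isPreconnected_Icc.image _ (hτc.const_smul K.orient)).ordConnected
  have hsign : ∃ σ : ℝ, |σ| = 1 ∧ ∀ s ∈ Icc (0 : ℝ) 1, σ * (K.orient * τ s) < 0 := by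
    have hne : (0 : ℝ) ∉ (K.orient • τ) '' Icc 0 1 := by
      rintro ⟨s, hs, h⟩
      rcases mul_eq_zero.1 h with h | h
      exacts [hor h, hτ0 s hs h]
    have h0 : K.orient * τ 0 ∈ (K.orient • τ) '' Icc 0 1 := ⟨0, by simp, rfl⟩
    by_cases hpos : 0 < K.orient * τ 0
    · refine ⟨-1, by simp, fun s hs => ?_⟩
      by_contra! h
      exact hne (hord.out ⟨s, hs, rfl⟩ h0 ⟨by simp; linarith, hpos.le⟩)
    · refine ⟨1, by simp, fun s hs => ?_⟩
      by_contra! h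
      exact hne (hord.out h0 ⟨s, hs, rfl⟩ ⟨not_lt.1 hpos, by simp; linarith⟩)
  obtain ⟨σ, hσ1, hσ⟩ := hsign
  set n : Plane := σ • rot90 t with hn
  have hn1 : ‖n‖ = 1 := by
    rw [hn, norm_smul, norm_rot90, ht.1, mul_one, Real.norm_eq_abs, hσ1]
  have hnt : inner ℝ n t = (0 : ℝ) := by
    rw [hn, inner_smul_left, real_inner_comm, inner_rot90_self, mul_zero]
  have hnF : ∀ y ∈ K.edge a, ∀ z ∈ K.edge a, inner ℝ n (z - y) = (0 : ℝ) := by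
    intro y hy z hz
    obtain ⟨c, hc⟩ := ht.2 y hy z hz
    rw [hc, inner_smul_right, hnt, mul_zero]
  have hcross : ∀ s ∈ Icc (0 : ℝ) 1, K.orient * planeCross (K.edgeVel a s) n < 0 := by
    intro s hs
    have := hσ s hs
    rw [hvel s hs, hn, planeCross_smul_right, planeCross_smul_left, planeCross_rot90_right,
      real_inner_self_eq_norm_sq, ht.1]
    linarith
  have hout : IsOutwardNormal K.carrier (K.edge a) n := by
    refine ⟨hn1, hnF, fun y hy => ?_⟩
    rw [edge_eq_image] at hy
    obtain ⟨s, hs, rfl⟩ := hy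
    exact eventually_notMem_carrier hs (hcross s hs)
  have hN : IsOutwardNormal K.carrier (K.edge a) (outwardNormal K.carrier (K.edge a)) :=
    Classical.epsilon_spec ⟨n, hout⟩
  have hNn : outwardNormal K.carrier (K.edge a) = n := by
    rcases eq_or_eq_neg_of_orthogonal ht.1 hn1 hN.1 hnt (isOutwardNormal_inner rfl ht hN.2.1)
      with h | h
    · exact h
    · exfalso
      have hs : (1 / 2 : ℝ) ∈ Ioo (0 : ℝ) 1 := by norm_num
      have hsI := Ioo_subset_Icc_self hs
      have h1 := hN.2.2 _ (edgeCurve_mem_edge hsI)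
      have h2 : ∀ᶠ h in 𝓝[>] (0 : ℝ), K.edgeCurve a (1 / 2) +
          h • outwardNormal K.carrier (K.edge a) ∈ K.openCarrier := by
        refine eventually_mem_openCarrier hs ?_
        rw [h, planeCross_neg_right]
        linarith [hcross _ hsI]
      obtain ⟨h, h3, h4⟩ := (h1.and h2).exists
      exact h3 (K.openCarrier_subset h4)
  rw [hNn]
  exact ⟨hn1, hnF, hcross⟩

/-- The tangential speed of the parametrization of a straight edge, in the direction which has the
outward normal on its right. -/
def edgeSpeed (K : CurvedTriangle) (a : Fin 3) (s : ℝ) : ℝ :=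
  inner ℝ (rot90 (outwardNormal K.carrier (K.edge a))) (K.edgeVel a s)

lemma isUnitTangent_rot90 {a : Fin 3} (ha : K.IsStraightEdge a) :
    IsUnitTangent (K.edge a) (rot90 (outwardNormal K.carrier (K.edge a))) := by
  obtain ⟨h1, h2, -⟩ := outwardNormal_spec ha
  refine ⟨by rw [norm_rot90, h1], fun y hy z hz =>
    ⟨inner ℝ (rot90 (outwardNormal K.carrier (K.edge a))) (z - y), ?_⟩⟩
  refine (planeCross_eq_zero_iff (by rw [norm_rot90, h1])).1 ?_
  rw [planeCross_rot90_left, h2 y hy z hz, neg_zero]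

lemma edgeVel_eq_edgeSpeed_smul {a : Fin 3} (ha : K.IsStraightEdge a) {s : ℝ}
    (hs : s ∈ Icc (0 : ℝ) 1) :
    K.edgeVel a s = K.edgeSpeed a s • rot90 (outwardNormal K.carrier (K.edge a)) :=
  edgeVel_eq_smul (isUnitTangent_rot90 ha) hs

lemma orient_mul_edgeSpeed_pos {a : Fin 3} (ha : K.IsStraightEdge a) {s : ℝ}
    (hs : s ∈ Icc (0 : ℝ) 1) : 0 < K.orient * K.edgeSpeed a s := by
  obtain ⟨h1, -, h2⟩ := outwardNormal_spec ha
  have h3 := h2 s hs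
  rw [edgeVel_eq_edgeSpeed_smul ha hs, planeCross_smul_left, planeCross_rot90_left,
    real_inner_self_eq_norm_sq, h1] at h3
  linarith

/-- A point in the relative interior of a straight edge may be moved along the edge. -/
lemma eventually_mem_edge {a : Fin 3} (ha : K.IsStraightEdge a) {s : ℝ} (hs : s ∈ Ioo (0 : ℝ) 1)
    {t w : Plane} (ht : IsUnitTangent (K.edge a) t) {c : ℝ} (hw : w = c • t) :
    ∀ᶠ h in 𝓝 (0 : ℝ), K.edgeCurve a s + h • w ∈ K.edge a := by
  have hpF : K.vertex (a + 1) ∈ K.edge a := by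
    rw [← edgeCurve_zero]; exact edgeCurve_mem_edge (by simp)
  have hqF : K.vertex (a + 2) ∈ K.edge a := by
    rw [← edgeCurve_one]; exact edgeCurve_mem_edge (by simp)
  have hy := edgeCurve_mem_edge (K := K) (a := a) (Ioo_subset_Icc_self hs)
  obtain ⟨d, hd⟩ := ht.2 _ hpF _ hqF
  have hd0 : d ≠ 0 := by
    rintro rfl
    rw [zero_smul, sub_eq_zero] at hd
    exact vertex_ne a hd.symm
  have hw' : w = (c / d) • (K.vertex (a + 2) - K.vertex (a + 1)) := by
    rw [hd, smul_smul, div_mul_cancel₀ _ hd0, hw]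
  have ha' := ha
  rw [IsStraightEdge, segment_eq_image'] at ha'
  have hy2 := hy
  rw [ha'] at hy2
  obtain ⟨σ, hσ, hσy⟩ := hy2
  have hσ' : σ ∈ Ioo (0 : ℝ) 1 := by
    refine ⟨lt_of_le_of_ne hσ.1 ?_, lt_of_le_of_ne hσ.2 ?_⟩
    · rintro rfl
      exact edgeCurve_ne_vertex (c := a + 1) hs (by rw [← hσy]; simp)
    · rintro rfl
      exact edgeCurve_ne_vertex (c := a + 2) hs (by rw [← hσy]; simp)
  have hcont : Continuous fun h : ℝ => σ + h * (c / d) := by fun_prop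
  have hev : ∀ᶠ h in 𝓝 (0 : ℝ), σ + h * (c / d) ∈ Ioo (0 : ℝ) 1 := by
    refine hcont.tendsto 0 (isOpen_Ioo.mem_nhds ?_)
    simpa using hσ'
  filter_upwards [hev] with h hh
  rw [ha', ← hσy, hw']
  refine ⟨σ + h * (c / d), Ioo_subset_Icc_self hh, ?_⟩
  simp only
  module

end CurvedTriangle

/-! ### Combinatorics of an exact triangulation -/

/-- All vertices of the triangulation. -/
def meshVertices {ι : Type*} (T : ι → CurvedTriangle) : Set Plane :=
  range fun q : ι × Fin 3 => (T q.1).vertex q.2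

lemma finite_meshVertices {ι : Type*} [Finite ι] (T : ι → CurvedTriangle) :
    (meshVertices T).Finite := finite_range _

lemma ne_vertex_of_notMem_meshVertices {ι : Type*} {T : ι → CurvedTriangle} {y : Plane}
    (hy : y ∉ meshVertices T) (i : ι) (c : Fin 3) : y ≠ (T i).vertex c := by
  rintro rfl; exact hy ⟨(i, c), rfl⟩

lemma exists_edgeCurve_of_notMem_meshVertices {ι : Type*} {T : ι → CurvedTriangle} {y : Plane}
    (hy : y ∉ meshVertices T) {i : ι} {a : Fin 3} (h : y ∈ (T i).edge a) :
    ∃ s ∈ Ioo (0 : ℝ) 1, y = (T i).edgeCurve a s := by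
  rw [CurvedTriangle.edge_eq_image] at h
  obtain ⟨s, hs, rfl⟩ := h
  exact ⟨s, CurvedTriangle.mem_Ioo_of_ne_vertex hs
    (ne_vertex_of_notMem_meshVertices hy i), rfl⟩

namespace IsExactTriangulation

open CurvedTriangle

variable {ι : Type*} {Ω : Set Plane} {T : ι → CurvedTriangle}

lemma carrier_subset (hT : IsExactTriangulation Ω T) (i : ι) : (T i).carrier ⊆ closure Ω := by
  rw [← hT.cover]; exact subset_iUnion (fun i => (T i).carrier) i

/-- A common nonvertex point of two triangles lies on a common edge. -/
lemma exists_common_edge (hT : IsExactTriangulation Ω T) {i j : ι} (hij : i ≠ j) {y : Plane}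
    (hi : y ∈ (T i).carrier) (hj : y ∈ (T j).carrier) (hy : ∀ a, y ≠ (T i).vertex a) :
    ∃ a c, (T i).edge a = (T j).edge c ∧ y ∈ (T i).edge a := by
  rcases hT.conforming i j hij with h | ⟨a, c, -, h⟩ | ⟨a, c, hac, h⟩
  · exact absurd (show y ∈ (∅ : Set Plane) from h ▸ ⟨hi, hj⟩) (notMem_empty y)
  · exact absurd (show y ∈ ({(T i).vertex a} : Set Plane) from h ▸ ⟨hi, hj⟩) (hy a)
  · exact ⟨a, c, hac, h ▸ ⟨hi, hj⟩⟩

/-- Distinct triangles share only vertices or edges, and an open triangle contains points of neither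
kind from its own boundary. -/
lemma notMem_carrier_of_mem_openCarrier (hT : IsExactTriangulation Ω T) {i j : ι} (hij : i ≠ j)
    {y : Plane} (hy : y ∈ (T i).openCarrier) : y ∉ (T j).carrier := by
  intro hj
  obtain ⟨a, c, -, h⟩ := hT.exists_common_edge hij ((T i).openCarrier_subset hy) hj
    (fun a h => notMem_edge_of_mem_openCarrier hy _ (h ▸ vertex_mem_edge a))
  exact notMem_edge_of_mem_openCarrier hy a h

/-- Two triangles do not lie on the same side of a common edge point. -/
lemma no_overlap (hT : IsExactTriangulation Ω T) {i j : ι} (hij : i ≠ j) {a c : Fin 3} {s r : ℝ}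
    (hs : s ∈ Ioo (0 : ℝ) 1) (hr : r ∈ Ioo (0 : ℝ) 1)
    (h : (T i).edgeCurve a s = (T j).edgeCurve c r) {w : Plane}
    (hi : 0 < (T i).orient * planeCross ((T i).edgeVel a s) w)
    (hj : 0 < (T j).orient * planeCross ((T j).edgeVel c r) w) : False := by
  have h1 := eventually_mem_openCarrier hs hi
  have h2 := eventually_mem_openCarrier hr hj
  rw [← h] at h2
  obtain ⟨_, h3, h4⟩ := (h1.and h2).exists
  exact hT.notMem_carrier_of_mem_openCarrier hij h3 ((T j).openCarrier_subset h4)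

lemma common_edge_of_edgeCurve_mem (hT : IsExactTriangulation Ω T) {i j : ι} (hij : i ≠ j)
    {a : Fin 3} {s : ℝ} (hs : s ∈ Ioo (0 : ℝ) 1) (h : (T i).edgeCurve a s ∈ (T j).carrier) :
    ∃ c, (T j).edge c = (T i).edge a := by
  obtain ⟨a', c, hac, hy⟩ := hT.exists_common_edge hij (edgeCurve_mem (Ioo_subset_Icc_self hs)) h
    fun _ => edgeCurve_ne_vertex hs
  obtain rfl := edgeCurve_edge_unique hs hy
  exact ⟨c, hac.symm⟩

lemma isStraightEdge (hT : IsExactTriangulation Ω T) {i : ι} {a : Fin 3}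
    (h : ¬ (T i).edge a ⊆ frontier Ω) : (T i).IsStraightEdge a :=
  (hT.straight_or_boundary i a).resolve_right h

lemma exists_nonvertex_edgeCurve [Finite ι] (T : ι → CurvedTriangle) (i : ι) (a : Fin 3) :
    ∃ s ∈ Ioo (0 : ℝ) 1, (T i).edgeCurve a s ∉ meshVertices T := by
  by_contra! h
  have h1 : (T i).edgeCurve a '' Ioo 0 1 ⊆ meshVertices T := by
    rintro _ ⟨s, hs, rfl⟩; exact h s hs
  have h2 := ((finite_meshVertices T).subset h1).of_finite_image
    ((injOn_edgeCurve a).mono Ioo_subset_Icc_self)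
  exact (Ioo_infinite zero_lt_one) h2

/-- An edge that is not contained in the boundary belongs to a second triangle. -/
lemma exists_neighbor [Finite ι] (hT : IsExactTriangulation Ω T) (hΩ : IsOpen Ω) {i : ι}
    {a : Fin 3} (h : ¬ (T i).edge a ⊆ frontier Ω) :
    ∃ j, j ≠ i ∧ ∃ c, (T j).edge c = (T i).edge a := by
  have hstr := hT.isStraightEdge h
  obtain ⟨y, hyF, hy⟩ := not_subset.1 h
  have hyΩ : y ∈ Ω := by
    have h1 := hT.carrier_subset i (edge_subset_carrier a hyF)
    by_contra h2
    exact hy ⟨h1, by rwa [hΩ.interior_eq]⟩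
  rw [edge_eq_image] at hyF
  obtain ⟨s, hs, rfl⟩ := hyF
  -- The given point may be a vertex; since `Ω` is open it can be replaced by a nearby point of the
  -- relative interior of the edge.
  obtain ⟨r, hr, hrΩ⟩ : ∃ r ∈ Ioo (0 : ℝ) 1, (T i).edgeCurve a r ∈ Ω := by
    have hc := (continuousOn_edgeCurve (K := T i) a s hs).eventually (hΩ.mem_nhds hyΩ)
    have hcl : s ∈ closure (Ioo (0 : ℝ) 1) := by rwa [closure_Ioo zero_ne_one]
    have : (𝓝[Ioo (0 : ℝ) 1] s).NeBot := mem_closure_iff_nhdsWithin_neBot.1 hcl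
    obtain ⟨r, hr⟩ := ((hc.filter_mono (nhdsWithin_mono s Ioo_subset_Icc_self)).and
      (self_mem_nhdsWithin (s := Ioo (0 : ℝ) 1))).exists
    exact ⟨r, hr.2, hr.1⟩
  obtain ⟨-, -, hN⟩ := outwardNormal_spec hstr
  set n := outwardNormal (T i).carrier ((T i).edge a)
  have hrI := Ioo_subset_Icc_self hr
  have hout := eventually_notMem_carrier hrI (hN r hrI)
  have htend : Tendsto (fun h : ℝ => (T i).edgeCurve a r + h • n) (𝓝[>] 0)
      (𝓝 ((T i).edgeCurve a r)) := by
    have hc : Continuous fun h : ℝ => (T i).edgeCurve a r + h • n := by fun_prop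
    simpa using (hc.tendsto 0).mono_left (nhdsWithin_le_nhds (s := Ioi 0))
  have hin := htend.eventually (hΩ.mem_nhds hrΩ)
  have hex : ∀ᶠ h in 𝓝[>] (0 : ℝ), ∃ j, j ≠ i ∧ (T i).edgeCurve a r + h • n ∈ (T j).carrier := by
    filter_upwards [hout, hin] with h h1 h2
    have h3 : (T i).edgeCurve a r + h • n ∈ ⋃ j, (T j).carrier := by
      rw [hT.cover]; exact subset_closure h2
    obtain ⟨j, hj⟩ := mem_iUnion.1 h3
    exact ⟨j, by rintro rfl; exact h1 hj, hj⟩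
  -- Just across the edge every point lies in some other triangle. There are finitely many, so one
  -- of them occurs for arbitrarily small displacements, and being closed it contains the edge point
  -- too.
  obtain ⟨j, hj⟩ : ∃ j, ∃ᶠ h in 𝓝[>] (0 : ℝ), j ≠ i ∧
      (T i).edgeCurve a r + h • n ∈ (T j).carrier := by
    by_contra! hcon
    obtain ⟨h, ⟨j, hj⟩, h2⟩ := (hex.and (eventually_all.2 hcon)).exists
    exact h2 j hj.1 hj.2
  obtain ⟨hji, -⟩ := hj.exists.choose_spec
  have hmem : (T i).edgeCurve a r ∈ (T j).carrier :=
    (T j).isClosed_carrier.mem_of_frequently_of_tendsto (hj.mono fun _ h => h.2) htend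
  exact ⟨j, hji, hT.common_edge_of_edgeCurve_mem hji.symm hr hmem⟩

/-- The outward normals of two triangles on a common straight edge are opposite. -/
lemma outwardNormal_neg [Finite ι] (hT : IsExactTriangulation Ω T) {i j : ι} (hij : i ≠ j)
    {a c : Fin 3} (hac : (T j).edge c = (T i).edge a) (hi : (T i).IsStraightEdge a)
    (hj : (T j).IsStraightEdge c) :
    outwardNormal (T j).carrier ((T i).edge a) = -outwardNormal (T i).carrier ((T i).edge a) := by
  obtain ⟨t, ht⟩ := exists_isUnitTangent hi
  obtain ⟨n1, n2, n3⟩ := outwardNormal_spec hi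
  obtain ⟨m1, m2, m3⟩ := outwardNormal_spec hj
  rw [hac] at m1 m2 m3
  rcases eq_or_eq_neg_of_orthogonal ht.1 n1 m1 (isOutwardNormal_inner rfl ht n2)
    (isOutwardNormal_inner rfl ht m2) with h | h
  · exfalso
    -- If the normals coincided, both triangles would lie on the same side and overlap. Avoiding
    -- mesh vertices keeps the point in the relative interior for both parametrizations.
    obtain ⟨s, hs, hsV⟩ := exists_nonvertex_edgeCurve T i a
    have hsF : (T i).edgeCurve a s ∈ (T j).edge c := by
      rw [hac]; exact edgeCurve_mem_edge (Ioo_subset_Icc_self hs)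
    obtain ⟨r, hr, hsr⟩ := exists_edgeCurve_of_notMem_meshVertices hsV hsF
    refine hT.no_overlap hij hs hr hsr
      (w := -outwardNormal (T i).carrier ((T i).edge a)) ?_ ?_
    · rw [planeCross_neg_right]; linarith [n3 s (Ioo_subset_Icc_self hs)]
    · rw [planeCross_neg_right, ← h]; linarith [m3 r (Ioo_subset_Icc_self hr)]
  · exact h

/-- An interior edge has exactly two neighbors, with opposite outward normals. -/
lemma edgeNeighbors_eq_pair [Fintype ι] (hT : IsExactTriangulation Ω T) (hΩ : IsOpen Ω) {i : ι}
    {a : Fin 3} (h : ¬ (T i).edge a ⊆ frontier Ω) :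
    ∃ j c, i ≠ j ∧ (T j).edge c = (T i).edge a ∧ (T j).IsStraightEdge c ∧
      outwardNormal (T j).carrier ((T i).edge a) = -outwardNormal (T i).carrier ((T i).edge a) ∧
      ∀ l, l ∈ edgeNeighbors T ((T i).edge a) ↔ l = i ∨ l = j := by
  obtain ⟨j, hji, c, hc⟩ := hT.exists_neighbor hΩ h
  have hi := hT.isStraightEdge h
  have hj : (T j).IsStraightEdge c := hT.isStraightEdge (by rwa [hc])
  have hN := hT.outwardNormal_neg hji.symm hc hi hj
  refine ⟨j, c, hji.symm, hc, hj, hN, fun l => ?_⟩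
  simp only [edgeNeighbors, Finset.mem_filter, Finset.mem_univ, true_and]
  constructor
  · rintro ⟨d, hd⟩
    by_contra! hl
    have hl' : (T l).IsStraightEdge d := hT.isStraightEdge (by rwa [hd])
    -- The normal of a third triangle would have to be opposite both to `n` and to `-n`.
    have h1 := hT.outwardNormal_neg hl.1.symm hd hi hl'
    have h2 := hT.outwardNormal_neg hl.2.symm (hd.trans hc.symm) hj hl'
    rw [hc, hN, neg_neg, h1] at h2
    have h3 := (outwardNormal_spec hi).1
    have h4 : (2 : ℝ) • outwardNormal (T i).carrier ((T i).edge a) = 0 := by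
      rw [two_smul]; nth_rw 1 [← h2]; exact neg_add_cancel _
    rw [(smul_eq_zero.1 h4).resolve_left two_ne_zero, norm_zero] at h3
    exact zero_ne_one h3
  · rintro (rfl | rfl)
    exacts [⟨a, rfl⟩, ⟨c, hc⟩]

end IsExactTriangulation

/-! ### The boundary of the domain -/

section Boundary

open CurvedTriangle

variable {β : Type*} {Ω : Set Plane} {L : β → ℝ} {x : β → ℝ → Plane}

lemma norm_curveNormal (hx : IsC2BoundaryParam Ω L x) (b : β) (φ : ℝ) :
    ‖curveNormal (x b) φ‖ = 1 := by
  have h := hx.unit_speed b φ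
  rw [plane_norm_eq_one_iff] at h ⊢
  simp [curveNormal]; linarith

lemma rot90_curveNormal (γ : ℝ → Plane) (φ : ℝ) : rot90 (curveNormal γ φ) = deriv γ φ := by
  apply plane_ext <;> simp [curveNormal]

lemma curve_mem_frontier (hx : IsC2BoundaryParam Ω L x) (b : β) (φ : ℝ) :
    x b φ ∈ frontier Ω := by
  rw [← hx.range_eq]; exact mem_iUnion.2 ⟨b, φ, rfl⟩

lemma exists_normal_of_mem_frontier (hx : IsC2BoundaryParam Ω L x) {y : Plane}
    (hy : y ∈ frontier Ω) : ∃ n : Plane, ‖n‖ = 1 ∧ ∀ᶠ h in 𝓝[>] (0 : ℝ), y + h • n ∉ closure Ω := by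
  rw [← hx.range_eq] at hy
  obtain ⟨b, φ, rfl⟩ := mem_iUnion.1 hy
  exact ⟨_, norm_curveNormal hx b φ, (hx.outward b φ).mono fun _ h => h.1⟩

/-- From every boundary point the outward normal leaves the closed domain at once; the boundary
therefore has no slits inside the closure. -/
lemma notMem_frontier_of_mem_interior_closure (hx : IsC2BoundaryParam Ω L x) {y : Plane}
    {U : Set Plane} (hU : IsOpen U) (hUΩ : U ⊆ closure Ω) (hyU : y ∈ U) : y ∉ frontier Ω := by
  intro hy
  obtain ⟨n, -, hn⟩ := exists_normal_of_mem_frontier hx hy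
  have htend : Tendsto (fun h : ℝ => y + h • n) (𝓝[>] 0) (𝓝 y) := by
    have hc : Continuous fun h : ℝ => y + h • n := by fun_prop
    simpa using (hc.tendsto 0).mono_left (nhdsWithin_le_nhds (s := Ioi 0))
  obtain ⟨h, h1, h2⟩ := (hn.and (htend.eventually (hU.mem_nhds hyU))).exists
  exact h1 (hUΩ h2)

variable {ι : Type*} {T : ι → CurvedTriangle}

/-- Nonvertex points of interior edges are not on the boundary. -/
lemma notMem_frontier_of_mem_interior_edge [Fintype ι] (hT : IsExactTriangulation Ω T)
    (hΩ : IsOpen Ω) (hx : IsC2BoundaryParam Ω L x) {i : ι} {a : Fin 3}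
    (h : ¬ (T i).edge a ⊆ frontier Ω) {y : Plane} (hy : y ∈ (T i).edge a)
    (hyV : y ∉ meshVertices T) : y ∉ frontier Ω := by
  intro hyΩ
  obtain ⟨j, c, hij, hc, hj, hN, -⟩ := hT.edgeNeighbors_eq_pair hΩ h
  have hi := hT.isStraightEdge h
  obtain ⟨n, hn1, hn⟩ := exists_normal_of_mem_frontier hx hyΩ
  obtain ⟨s, hs, hys⟩ := exists_edgeCurve_of_notMem_meshVertices hyV hy
  obtain ⟨r, hr, hyr⟩ := exists_edgeCurve_of_notMem_meshVertices hyV (hc ▸ hy)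
  have hsI := Ioo_subset_Icc_self hs
  have hrI := Ioo_subset_Icc_self hr
  have e1 := edgeVel_eq_edgeSpeed_smul hi hsI
  have p1 := orient_mul_edgeSpeed_pos hi hsI
  have e2 := edgeVel_eq_edgeSpeed_smul hj hrI
  have p2 := orient_mul_edgeSpeed_pos hj hrI
  rw [hc, hN, rot90_neg] at e2
  set t := rot90 (outwardNormal (T i).carrier ((T i).edge a)) with ht
  have f1 : (T i).orient * planeCross ((T i).edgeVel a s) n =
      ((T i).orient * (T i).edgeSpeed a s) * planeCross t n := by
    rw [e1, planeCross_smul_left]; ring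
  have f2 : (T j).orient * planeCross ((T j).edgeVel c r) n =
      -(((T j).orient * (T j).edgeSpeed c r) * planeCross t n) := by
    rw [e2, smul_neg, ← neg_smul, planeCross_smul_left]; ring
  have hno : ∀ (l : ι) (d : Fin 3) (q : ℝ), q ∈ Ioo (0 : ℝ) 1 → y = (T l).edgeCurve d q →
      ¬ 0 < (T l).orient * planeCross ((T l).edgeVel d q) n := by
    intro l d q hq hyq hpos
    have h1 := eventually_mem_openCarrier hq hpos
    rw [← hyq] at h1
    obtain ⟨_, h2, h3⟩ := (hn.and h1).exists
    exact h2 (hT.carrier_subset l ((T l).openCarrier_subset h3))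
  have g1 := hno i a s hs hys
  have g2 := hno j c r hr hyr
  rw [f1] at g1
  rw [f2] at g2
  -- The exterior direction at a boundary point would enter one of the two triangles or run along
  -- their straight common edge. In all three cases it stays in the closed domain.
  rcases lt_trichotomy (planeCross t n) 0 with h0 | h0 | h0
  · exact g2 (by nlinarith)
  · have htan := isUnitTangent_rot90 hi
    rw [← ht] at htan
    rw [planeCross_eq_zero_iff htan.1] at h0
    have h1 := eventually_mem_edge hi hs htan h0
    rw [← hys] at h1
    obtain ⟨_, h2, h3⟩ := (hn.and (h1.filter_mono nhdsWithin_le_nhds)).exists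
    exact h2 (hT.carrier_subset i (edge_subset_carrier a h3))
  · exact g1 (by positivity)

end Boundary

/-! ### Contributions of straight edges -/

/-- A determinant is unchanged by rotation of the orthonormal basis; this is what allows a different
basis on every edge. -/
lemma covCross_eq_of_norm_eq_one (A C : Plane →L[ℝ] ℝ) {n : Plane} (hn : ‖n‖ = 1) :
    covCross A C = A n * C (rot90 n) - A (rot90 n) * C n := by
  rw [plane_norm_eq_one_iff] at hn
  rw [clm_apply_plane A n, clm_apply_plane A (rot90 n), clm_apply_plane C n,
    clm_apply_plane C (rot90 n)]
  simp only [covCross, smul_eq_mul, rot90_apply_zero, rot90_apply_one]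
  linear_combination (-(A (unitVec 0) * C (unitVec 1) - A (unitVec 1) * C (unitVec 0))) * hn

namespace CurvedTriangle

variable {K : CurvedTriangle} {v : Plane → ℝ}

/-- Along a straight edge, the second tangential derivative is an entry of the Hessian. -/
lemma secondTangential_eq (hv : ContDiffOn ℝ 2 v K.carrier) {a : Fin 3}
    (ha : K.IsStraightEdge a) {s : ℝ} (hs : s ∈ Ioo (0 : ℝ) 1) {t : Plane}
    (ht : IsUnitTangent (K.edge a) t) :
    secondTangential v t (K.edgeCurve a s) = K.hess v (K.edgeCurve a s) t t := by
  set y := K.edgeCurve a s with hy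
  have hline : ∀ h : ℝ, HasDerivAt (fun h : ℝ => y + h • t) t h := by
    intro h
    have h1 := (hasDerivAt_id h).smul_const t
    rw [one_smul] at h1
    exact HasDerivAt.const_add _ h1
  have hev : ∀ᶠ h in 𝓝 (0 : ℝ), y + h • t ∈ K.carrier :=
    (eventually_mem_edge ha hs ht (one_smul ℝ t).symm).mono fun _ h => edge_subset_carrier a h
  have hd1 : ∀ᶠ h in 𝓝 (0 : ℝ), HasDerivAt (fun h : ℝ => v (y + h • t))
      (K.grad v (y + h • t) t) h := by
    filter_upwards [hev.eventually_nhds] with h hh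
    have hS : {h : ℝ | y + h • t ∈ K.carrier} ∈ 𝓝 h := hh
    exact ((hasFDerivWithinAt_grad hv hh.self_of_nhds).comp_hasDerivWithinAt h
      (hline h).hasDerivWithinAt fun _ h => h).hasDerivAt hS
  have hd2 : HasDerivAt (fun h : ℝ => K.grad v (y + h • t) t) (K.hess v y t t) 0 := by
    have hS : {h : ℝ | y + h • t ∈ K.carrier} ∈ 𝓝 (0 : ℝ) := hev
    have h0 : y + (0 : ℝ) • t = y := by simp
    have h1 : HasFDerivWithinAt (K.grad v) (K.hess v y) K.carrier (y + (0 : ℝ) • t) := by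
      rw [h0]; exact hasFDerivWithinAt_hess hv (edgeCurve_mem (Ioo_subset_Icc_self hs))
    have h2 := (h1.comp_hasDerivWithinAt (0 : ℝ) (s := {h : ℝ | y + h • t ∈ K.carrier})
      (hline 0).hasDerivWithinAt fun _ h => h).hasDerivAt hS
    have h3 := h2.clm_apply (hasDerivAt_const (0 : ℝ) t)
    simpa using h3
  rw [secondTangential, iteratedDeriv_succ, iteratedDeriv_one]
  have : deriv (fun h : ℝ => v (y + h • t)) =ᶠ[𝓝 0] fun h => K.grad v (y + h • t) t :=
    hd1.mono fun _ h => h.deriv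
  rw [this.deriv_eq, hd2.deriv]

/-- Arc length on a straight edge. -/
lemma hausdorffMeasure_restrict_edge {a : Fin 3} {t : Plane} (ht : IsUnitTangent (K.edge a) t) :
    (Measure.hausdorffMeasure 1 : Measure Plane).restrict (K.edge a) =
      Measure.map (fun u : ℝ => K.edgeCurve a 0 + u • t)
        (volume.restrict ((fun s => (inner ℝ t (K.edgeCurve a s - K.edgeCurve a 0) : ℝ)) ''
          Icc 0 1)) ∧
    MeasurableEmbedding (fun u : ℝ => K.edgeCurve a 0 + u • t) ∧
    ∀ s ∈ Icc (0 : ℝ) 1, K.edgeCurve a 0 +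
      (inner ℝ t (K.edgeCurve a s - K.edgeCurve a 0) : ℝ) • t = K.edgeCurve a s := by
  set P := K.edgeCurve a 0 with hP
  set iso : ℝ → Plane := fun u => P + u • t with hiso
  set σ : ℝ → ℝ := fun s => inner ℝ t (K.edgeCurve a s - P) with hσ
  have hPF : P ∈ K.edge a := edgeCurve_mem_edge (by simp)
  have hγ : ∀ s ∈ Icc (0 : ℝ) 1, iso (σ s) = K.edgeCurve a s := by
    intro s hs
    obtain ⟨c, hc⟩ := ht.2 _ hPF _ (edgeCurve_mem_edge hs)
    simp only [hiso, hσ]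
    rw [hc, inner_smul_right, real_inner_self_eq_norm_sq, ht.1, one_pow, mul_one, ← hc]
    abel
  have hI : Isometry iso := by
    refine Isometry.of_dist_eq fun u w => ?_
    rw [dist_eq_norm, dist_eq_norm]
    have : iso u - iso w = (u - w) • t := by simp only [hiso]; module
    rw [this, norm_smul, ht.1, mul_one]
  have hem : MeasurableEmbedding iso := hI.isClosedEmbedding.measurableEmbedding
  have hpre : iso ⁻¹' K.edge a = σ '' Icc 0 1 := by
    ext u
    constructor
    · intro hu
      rw [mem_preimage, edge_eq_image] at hu
      obtain ⟨s, hs, hsu⟩ := hu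
      exact ⟨s, hs, hI.injective ((hγ s hs).trans hsu)⟩
    · rintro ⟨s, hs, rfl⟩
      rw [mem_preimage, hγ s hs]
      exact edgeCurve_mem_edge hs
  have hsub : K.edge a ⊆ range iso := by
    rw [edge_eq_image]
    rintro _ ⟨s, hs, rfl⟩
    exact ⟨_, hγ s hs⟩
  refine ⟨?_, hem, hγ⟩
  -- The edge sits on an isometric copy of the real line, on which one-dimensional Hausdorff measure
  -- is Lebesgue measure.
  have hmap := hI.map_hausdorffMeasure (d := 1) (Or.inl zero_le_one)
  rw [hausdorffMeasure_real] at hmap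
  rw [← hpre, ← hem.restrict_map, hmap, Measure.restrict_restrict_of_subset hsub]

lemma integral_edge_hausdorff {a : Fin 3} {t : Plane} (ht : IsUnitTangent (K.edge a) t)
    (g : Plane → ℝ) :
    ∫ y in K.edge a, g y ∂(Measure.hausdorffMeasure 1) =
      ∫ s in (0 : ℝ)..1, |(inner ℝ t (K.edgeVel a s) : ℝ)| * g (K.edgeCurve a s) := by
  obtain ⟨h1, h2, h3⟩ := hausdorffMeasure_restrict_edge ht
  rw [h1, h2.integral_map, integral_image_eq_integral_abs_deriv_smul measurableSet_Icc
    (f' := fun s => inner ℝ t (K.edgeVel a s)), intervalIntegral.integral_of_le zero_le_one,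
    ← integral_Icc_eq_integral_Ioc]
  · refine setIntegral_congr_fun measurableSet_Icc fun s hs => ?_
    simp only [smul_eq_mul]
    rw [h3 s hs]
  · intro s hs
    have := (innerSL ℝ t).hasFDerivAt.comp_hasDerivWithinAt s
      ((hasDerivWithinAt_edgeCurve (K := K) a hs).sub_const (K.edgeCurve a 0))
    exact this
  · intro s hs r hr hsr
    refine injOn_edgeCurve (K := K) a hs hr ?_
    rw [← h3 s hs, ← h3 r hr]
    simp only at hsr
    rw [hsr]

lemma integrableOn_edge_hausdorff {a : Fin 3} {t : Plane} (ht : IsUnitTangent (K.edge a) t)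
    {g : Plane → ℝ} (hg : ContinuousOn g (K.edge a)) :
    IntegrableOn g (K.edge a) (Measure.hausdorffMeasure 1) := by
  obtain ⟨h1, h2, h3⟩ := hausdorffMeasure_restrict_edge ht
  rw [IntegrableOn, h1, h2.integrable_map_iff]
  have hc : ContinuousOn (fun s => (inner ℝ t (K.edgeCurve a s - K.edgeCurve a 0) : ℝ))
      (Icc 0 1) :=
    continuousOn_const.inner ((continuousOn_edgeCurve a).sub continuousOn_const)
  refine ContinuousOn.integrableOn_compact (isCompact_Icc.image_of_continuousOn hc) ?_
  refine hg.comp (by fun_prop) ?_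
  rintro _ ⟨s, hs, rfl⟩
  simp only
  rw [h3 s hs]
  exact edgeCurve_mem_edge hs

/-- The contribution of a straight edge, after integration by parts along the edge. -/
lemma edgeTerm_eq_of_isStraightEdge (hv : ContDiffOn ℝ 2 v K.carrier) {a : Fin 3}
    (ha : K.IsStraightEdge a) {n T : Plane} (hn : n = outwardNormal K.carrier (K.edge a))
    (hT : T = rot90 n) :
    K.edgeTerm v a = 2 * (∫ y in K.edge a, K.grad v y n * K.hess v y T T
        ∂(Measure.hausdorffMeasure 1))
      - K.orient * (K.grad v (K.edgeCurve a 1) n * K.grad v (K.edgeCurve a 1) T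
        - K.grad v (K.edgeCurve a 0) n * K.grad v (K.edgeCurve a 0) T) := by
  have hTt : IsUnitTangent (K.edge a) T := by rw [hT, hn]; exact isUnitTangent_rot90 ha
  have hn1 : ‖n‖ = 1 := by rw [hn]; exact (outwardNormal_spec ha).1
  set A : ℝ → Plane →L[ℝ] ℝ := fun s => K.grad v (K.edgeCurve a s) with hA
  set C : ℝ → Plane →L[ℝ] ℝ := fun s => K.hess v (K.edgeCurve a s) (K.edgeVel a s) with hC
  have cA : ContinuousOn A (Icc 0 1) := continuousOn_grad_edgeCurve hv a
  have cC : ContinuousOn C (Icc 0 1) := continuousOn_hess_edgeCurve hv a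
  have dA : ∀ (w : Plane), ∀ s ∈ Icc (0 : ℝ) 1,
      HasDerivWithinAt (fun s => A s w) (C s w) (Icc 0 1) s := by
    intro w s hs
    have := (hasDerivWithinAt_grad_edgeCurve hv a hs).clm_apply
      (hasDerivWithinAt_const s (Icc (0 : ℝ) 1) w)
    simpa using this
  have cAw : ∀ w, ContinuousOn (fun s => A s w) (Icc 0 1) := fun w =>
    cA.clm_apply continuousOn_const
  have cCw : ∀ w, ContinuousOn (fun s => C s w) (Icc 0 1) := fun w =>
    cC.clm_apply continuousOn_const
  have ii : ∀ f : ℝ → ℝ, ContinuousOn f (Icc 0 1) → IntervalIntegrable f volume 0 1 := by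
    intro f hf
    exact ContinuousOn.intervalIntegrable (by rwa [uIcc_of_le zero_le_one])
  have ftc : ∫ s in (0 : ℝ)..1, (C s n * A s T + A s n * C s T) = A 1 n * A 1 T - A 0 n * A 0 T := by
    refine intervalIntegral.integral_eq_sub_of_hasDerivAt_of_le zero_le_one
      ((cAw n).mul (cAw T)) ?_ (ii _ (((cCw n).mul (cAw T)).add ((cAw n).mul (cCw T))))
    intro s hs
    exact ((dA n s (Ioo_subset_Icc_self hs)).mul (dA T s (Ioo_subset_Icc_self hs))).hasDerivAt
      (Icc_mem_nhds hs.1 hs.2)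
  -- In the constant basis `n`, `T` the form is `∂ₙv (∂_T v)' - ∂_T v (∂ₙv)'`, that is, `2 ∂ₙv (∂_T
  -- v)'` minus the derivative of the product.
  have e1 : ∫ s in (0 : ℝ)..1, covCross (A s) (C s) =
      2 * (∫ s in (0 : ℝ)..1, A s n * C s T)
        - ∫ s in (0 : ℝ)..1, (C s n * A s T + A s n * C s T) := by
    have i1 : IntervalIntegrable (fun s => 2 * (A s n * C s T)) volume 0 1 :=
      (ii _ ((cAw n).mul (cCw T))).const_mul 2
    have i2 : IntervalIntegrable (fun s => C s n * A s T + A s n * C s T) volume 0 1 :=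
      ii _ (((cCw n).mul (cAw T)).add ((cAw n).mul (cCw T)))
    rw [← intervalIntegral.integral_const_mul, ← intervalIntegral.integral_sub i1 i2]
    congr 1; ext s
    rw [covCross_eq_of_norm_eq_one _ _ hn1, ← hT]
    ring
  have e2 : ∫ y in K.edge a, K.grad v y n * K.hess v y T T ∂(Measure.hausdorffMeasure 1) =
      K.orient * ∫ s in (0 : ℝ)..1, A s n * C s T := by
    rw [integral_edge_hausdorff hTt, ← intervalIntegral.integral_const_mul]
    refine intervalIntegral.integral_congr fun s hs => ?_
    rw [uIcc_of_le zero_le_one] at hs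
    have h1 := edgeVel_eq_smul hTt hs
    have h2 := orient_mul_edgeSpeed_pos ha hs
    rw [edgeSpeed, ← hn, ← hT] at h2
    have h3 : |(inner ℝ T (K.edgeVel a s) : ℝ)| = K.orient * inner ℝ T (K.edgeVel a s) := by
      rw [← abs_of_pos h2, abs_mul]
      have : |K.orient| = 1 := by unfold orient; split_ifs <;> simp
      rw [this, one_mul]
    simp only [hA, hC]
    rw [h3, h1, inner_smul_right, real_inner_self_eq_norm_sq, hTt.1, map_smul]
    simp only [smul_apply, smul_eq_mul]
    ring
  rw [edgeTerm, e2]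
  change K.orient * (∫ s in (0 : ℝ)..1, covCross (A s) (C s)) = _
  rw [e1, ftc]
  ring

/-- The endpoints of a straight edge, ordered along the direction with the outward normal on its
right. -/
lemma exists_ordered_endpoints {a : Fin 3} (ha : K.IsStraightEdge a) {T : Plane}
    (hT : T = rot90 (outwardNormal K.carrier (K.edge a))) :
    ∃ d₀ d₁ : Fin 3, K.vertex d₀ ∈ K.edge a ∧ K.vertex d₁ ∈ K.edge a ∧
      (∀ Q : Plane → ℝ, K.orient * (Q (K.edgeCurve a 1) - Q (K.edgeCurve a 0)) =
        Q (K.vertex d₁) - Q (K.vertex d₀)) ∧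
      ∀ y ∈ K.edge a, (inner ℝ T (K.vertex d₀) : ℝ) ≤ inner ℝ T y ∧
        (inner ℝ T y : ℝ) ≤ inner ℝ T (K.vertex d₁) := by
  have hmono : MonotoneOn (fun s => K.orient * inner ℝ T (K.edgeCurve a s)) (Icc 0 1) := by
    refine monotoneOn_of_hasDerivWithinAt_nonneg (convex_Icc 0 1)
      (f' := fun s => K.orient * inner ℝ T (K.edgeVel a s)) ?_ ?_ ?_
    · exact continuousOn_const.mul (continuousOn_const.inner (continuousOn_edgeCurve a))
    · intro s hs
      refine HasDerivWithinAt.mono ?_ interior_subset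
      exact ((innerSL ℝ T).hasFDerivAt.comp_hasDerivWithinAt s
        (hasDerivWithinAt_edgeCurve (K := K) a (interior_subset hs))).const_mul _
    · intro s hs
      have := orient_mul_edgeSpeed_pos ha (interior_subset hs)
      rw [edgeSpeed, ← hT] at this
      exact this.le
  have h0 : (0 : ℝ) ∈ Icc (0 : ℝ) 1 := by simp
  have h1 : (1 : ℝ) ∈ Icc (0 : ℝ) 1 := by simp
  have m0 := edgeCurve_mem_edge (K := K) (a := a) h0
  have m1 := edgeCurve_mem_edge (K := K) (a := a) h1
  have e0 := edgeCurve_zero (K := K) a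
  have e1 := edgeCurve_one (K := K) a
  have hle : ∀ y ∈ K.edge a, K.orient * inner ℝ T (K.edgeCurve a 0) ≤ K.orient * inner ℝ T y ∧
      K.orient * inner ℝ T y ≤ K.orient * inner ℝ T (K.edgeCurve a 1) := by
    intro y hy
    rw [edge_eq_image] at hy
    obtain ⟨s, hs, rfl⟩ := hy
    exact ⟨hmono h0 hs hs.1, hmono hs h1 hs.2⟩
  have hor : K.orient = 1 ∨ K.orient = -1 := by unfold orient; split_ifs <;> simp
  rcases hor with ho | ho
  · refine ⟨a + 1, a + 2, e0 ▸ m0, e1 ▸ m1, fun Q => by rw [ho, one_mul, e0, e1], fun y hy => ?_⟩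
    have := hle y hy
    rwa [ho, one_mul, one_mul, one_mul, e0, e1] at this
  · refine ⟨a + 2, a + 1, e1 ▸ m1, e0 ▸ m0, fun Q => by rw [ho, e0, e1]; ring, fun y hy => ?_⟩
    have := hle y hy
    rw [ho, e0, e1] at this
    constructor <;> linarith

end CurvedTriangle

/-! ### Interior edges -/

namespace CurvedTriangle

variable {K : CurvedTriangle} {v : Plane → ℝ}

/-- At nonvertex points of a straight edge `(∂v/∂n) ∂²v/∂t²` is an expression in the Hessian. -/
lemma ae_secondTangential_eq (hv : ContDiffOn ℝ 2 v K.carrier) {a : Fin 3}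
    (ha : K.IsStraightEdge a) {t : Plane} (ht : IsUnitTangent (K.edge a) t) :
    ∀ᵐ y ∂((Measure.hausdorffMeasure 1 : Measure Plane).restrict (K.edge a)),
      secondTangential v t y = K.hess v y t t := by
  have : NullSingletonClass (Measure.hausdorffMeasure 1 : Measure Plane) :=
    Measure.nullSingletonClass_hausdorff Plane one_pos
  -- At a vertex the line through the edge leaves the triangle, so the formula for the second
  -- tangential derivative is claimed only off this null set.
  have hfin : (Measure.hausdorffMeasure 1 : Measure Plane) (range K.vertex) = 0 :=
    (finite_range _).measure_zero _
  rw [ae_restrict_iff' (isCompact_edge a).isClosed.measurableSet]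
  filter_upwards [measure_eq_zero_iff_ae_notMem.1 hfin] with y hy hyF
  rw [edge_eq_image] at hyF
  obtain ⟨s, hs, rfl⟩ := hyF
  exact secondTangential_eq hv ha
    (mem_Ioo_of_ne_vertex hs fun c h => hy ⟨c, h.symm⟩) ht

lemma integrableOn_grad_mul_secondTangential (hv : ContDiffOn ℝ 2 v K.carrier) {a : Fin 3}
    (ha : K.IsStraightEdge a) {t : Plane} (ht : IsUnitTangent (K.edge a) t) (n : Plane) :
    IntegrableOn (fun y => K.grad v y n * secondTangential v t y) (K.edge a)
      (Measure.hausdorffMeasure 1) ∧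
    ∫ y in K.edge a, K.grad v y n * secondTangential v t y ∂(Measure.hausdorffMeasure 1) =
      ∫ y in K.edge a, K.grad v y n * K.hess v y t t ∂(Measure.hausdorffMeasure 1) := by
  have hae := ae_secondTangential_eq hv ha ht
  have hae' : (fun y => K.grad v y n * secondTangential v t y)
      =ᵐ[(Measure.hausdorffMeasure 1 : Measure Plane).restrict (K.edge a)]
      fun y => K.grad v y n * K.hess v y t t := by
    filter_upwards [hae] with y hy
    rw [hy]
  refine ⟨?_, integral_congr_ae hae'⟩
  refine Integrable.congr (integrableOn_edge_hausdorff ht ?_) hae'.symm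
  exact (((contDiffOn_grad hv).continuousOn.clm_apply continuousOn_const).mul
    (continuousOn_hess_apply hv t t)).mono (edge_subset_carrier a)

end CurvedTriangle

namespace IsExactTriangulation

open CurvedTriangle

variable {ι : Type*} [Fintype ι] {Ω : Set Plane} {T : ι → CurvedTriangle} {v : Plane → ℝ}

/-- The sum of the contributions of the two triangles at an interior edge. -/
lemma interior_edge (hT : IsExactTriangulation Ω T) (hΩ : IsOpen Ω)
    (hv : ∀ i, ContDiffOn ℝ 2 v (T i).carrier)
    (hvert : ∀ i j a c, (T i).vertex a = (T j).vertex c →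
      (T i).grad v ((T i).vertex a) = (T j).grad v ((T j).vertex c))
    {i : ι} {a : Fin 3} (h : ¬ (T i).edge a ⊆ frontier Ω) {t : Plane}
    (ht : IsUnitTangent ((T i).edge a) t) :
    IntegrableOn (fun y => normalJump T v ((T i).edge a) y * secondTangential v t y)
        ((T i).edge a) (Measure.hausdorffMeasure 1) ∧
    ∑ q : ι × Fin 3 with (T q.1).edge q.2 = (T i).edge a, (T q.1).edgeTerm v q.2 =
      2 * ∫ y in (T i).edge a, normalJump T v ((T i).edge a) y * secondTangential v t y
        ∂(Measure.hausdorffMeasure 1) := by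
  classical
  obtain ⟨j, c, hij, hc, hj, hN, hnb⟩ := hT.edgeNeighbors_eq_pair hΩ h
  have hi := hT.isStraightEdge h
  set F := (T i).edge a with hF
  set n := outwardNormal (T i).carrier F with hn
  have hnb' : edgeNeighbors T F = {i, j} := by
    ext l; rw [hnb, Finset.mem_insert, Finset.mem_singleton]
  have hjump : ∀ y, normalJump T v F y = (T i).grad v y n + (T j).grad v y (-n) := by
    intro y
    rw [normalJump, hnb', Finset.sum_pair hij, hN]
    rfl
  have htj : IsUnitTangent ((T j).edge c) t := by rwa [hc]
  obtain ⟨I1, J1⟩ := integrableOn_grad_mul_secondTangential (hv i) hi ht n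
  obtain ⟨I2, J2⟩ := integrableOn_grad_mul_secondTangential (hv j) hj htj (-n)
  rw [hc] at I2 J2
  rw [← hF] at I1 J1
  have hsplit : (fun y => normalJump T v F y * secondTangential v t y) =
      fun y => (T i).grad v y n * secondTangential v t y
        + (T j).grad v y (-n) * secondTangential v t y := by
    ext y; rw [hjump]; ring
  rw [hsplit]
  refine ⟨I1.add I2, ?_⟩
  rw [integral_add I1 I2, J1, J2]
  have hfilter : (Finset.univ.filter fun q : ι × Fin 3 => (T q.1).edge q.2 = F) =
      {(i, a), (j, c)} := by
    ext ⟨l, d⟩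
    simp only [Finset.mem_filter, Finset.mem_univ, true_and, Finset.mem_insert,
      Finset.mem_singleton, Prod.mk.injEq]
    constructor
    · intro hl
      have : l ∈ edgeNeighbors T F := by
        simp only [edgeNeighbors, Finset.mem_filter, Finset.mem_univ, true_and]
        exact ⟨d, hl⟩
      rcases (hnb l).1 this with rfl | rfl
      · exact Or.inl ⟨rfl, edge_injective (hl.trans hF)⟩
      · exact Or.inr ⟨rfl, edge_injective (hl.trans hc.symm)⟩
    · rintro (⟨rfl, rfl⟩ | ⟨rfl, rfl⟩)
      exacts [rfl, hc]
  rw [hfilter, Finset.sum_pair (by simp [hij])]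
  set τ := rot90 n with hτ
  have hNj : -n = outwardNormal (T j).carrier ((T j).edge c) := by rw [hc, hN]
  have E1 := edgeTerm_eq_of_isStraightEdge (hv i) hi hn hτ
  have E2 := edgeTerm_eq_of_isStraightEdge (hv j) hj hNj (T := -τ) (by rw [hτ, rot90_neg])
  obtain ⟨d₀, d₁, k0, k1, kQ, kle⟩ := exists_ordered_endpoints hi (T := τ) (by rw [hτ, hn, hF])
  obtain ⟨e₀, e₁, l0, l1, lQ, lle⟩ := exists_ordered_endpoints hj (T := -τ)
    (by rw [← hNj, hτ, rot90_neg])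
  rw [kQ fun y => (T i).grad v y n * (T i).grad v y τ] at E1
  rw [lQ fun y => (T j).grad v y (-n) * (T j).grad v y (-τ)] at E2
  have hτt : IsUnitTangent F τ := isUnitTangent_rot90 hi
  -- The endpoints are identified as the extreme points of `F` in the direction `τ`. The second
  -- triangle orders them by `-τ`, so its first endpoint is the last one of the first triangle.
  have hsame : ∀ y ∈ F, ∀ z ∈ F, (inner ℝ τ y : ℝ) = inner ℝ τ z → y = z := by
    intro y hy z hz hyz
    obtain ⟨r, hr⟩ := hτt.2 y hy z hz
    have h1 : (inner ℝ τ (z - y) : ℝ) = 0 := by rw [inner_sub_right, hyz, sub_self]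
    rw [hr, inner_smul_right, real_inner_self_eq_norm_sq, hτt.1, one_pow, mul_one] at h1
    rw [h1, zero_smul] at hr
    exact (sub_eq_zero.1 hr).symm
  simp only [inner_neg_left, neg_le_neg_iff] at lle
  rw [hc] at l0 l1 lle
  have v1 : (T i).vertex d₁ = (T j).vertex e₀ :=
    hsame _ k1 _ l0 (le_antisymm (lle _ k1).1 (kle _ l0).2)
  have v0 : (T i).vertex d₀ = (T j).vertex e₁ :=
    hsame _ k0 _ l1 (le_antisymm (kle _ l1).1 (lle _ k0).2)
  have g1 := hvert _ _ _ _ v1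
  have g0 := hvert _ _ _ _ v0
  -- The prescribed tangent is `τ` or `-τ`, and the sign disappears from a quadratic form.
  have htτ : ∀ A : Plane →L[ℝ] Plane →L[ℝ] ℝ, A t t = A τ τ := by
    intro A
    have h2 : inner ℝ (-n) t = (0 : ℝ) := by
      rw [inner_neg_left, neg_eq_zero]
      exact isOutwardNormal_inner hF ht (outwardNormal_spec hi).2.1
    have hn1 : ‖n‖ = 1 := (outwardNormal_spec hi).1
    have h3 : inner ℝ t n = (0 : ℝ) := by
      rw [inner_neg_left, neg_eq_zero, real_inner_comm] at h2; exact h2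
    have h4 : inner ℝ τ n = (0 : ℝ) := by rw [hτ, real_inner_comm, inner_rot90_self]
    rcases eq_or_eq_neg_of_orthogonal hn1 hτt.1 ht.1 h4 h3 with h5 | h5
    · rw [h5]
    · rw [h5]; simp
  simp only [htτ]
  simp only [map_neg, neg_apply, neg_neg, neg_mul, mul_neg] at E2 ⊢
  rw [hc] at E2
  rw [E1, E2, g1, g0]
  ring

end IsExactTriangulation

/-! ### Boundary edges -/

/-- Such a point is isolated in `A`, in particular isolated from the right. -/
lemma countable_setOf_not_accPt (A : Set ℝ) : {φ ∈ A | ¬ AccPt φ (𝓟 A)}.Countable := by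
  refine (countable_setOfPred_isolated_right_within (s := A)).mono ?_
  rintro φ ⟨hφ, hacc⟩
  refine ⟨hφ, ?_⟩
  rw [accPt_principal_iff_nhdsWithin, not_neBot] at hacc
  refine le_bot_iff.1 (hacc ▸ nhdsWithin_mono φ ?_)
  rintro r ⟨h1, h2⟩
  exact ⟨h1, (ne_of_gt h2)⟩

namespace CurvedTriangle

variable {K : CurvedTriangle}

/-- The parameter in `[0, 1]` of a point of the edge opposite to `a`. -/
def edgeParam (K : CurvedTriangle) (a : Fin 3) (y : Plane) : ℝ := refBary (a + 2) (K.inv y)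

lemma edgeParam_edgeCurve {a : Fin 3} {s : ℝ} (hs : s ∈ Icc (0 : ℝ) 1) :
    K.edgeParam a (K.edgeCurve a s) = s := by
  rw [edgeParam, edgeCurve, inv_map (refEdgePt_mem hs), refBary_edgePt_add_two]

lemma edgeParam_mem {a : Fin 3} {y : Plane} (hy : y ∈ K.edge a) :
    K.edgeParam a y ∈ Icc (0 : ℝ) 1 := by
  rw [edge_eq_image] at hy
  obtain ⟨s, hs, rfl⟩ := hy
  rwa [edgeParam_edgeCurve hs]

lemma edgeCurve_edgeParam {a : Fin 3} {y : Plane} (hy : y ∈ K.edge a) :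
    K.edgeCurve a (K.edgeParam a y) = y := by
  rw [edge_eq_image] at hy
  obtain ⟨s, hs, rfl⟩ := hy
  rw [edgeParam_edgeCurve hs]

/-- The derivative of the edge parameter along a curve. -/
def edgeParamDeriv (K : CurvedTriangle) (a : Fin 3) (γ : ℝ → Plane) (φ : ℝ) : ℝ :=
  planeCross (refEdgeDir (a + 2)) (K.jacInv (K.inv (γ φ)) (deriv γ φ))

lemma hasDerivWithinAt_edgeParam {a : Fin 3} {γ : ℝ → Plane} {A : Set ℝ}
    (hA : ∀ φ ∈ A, γ φ ∈ K.edge a) {φ : ℝ} (hφ : φ ∈ A) (hγ : DifferentiableAt ℝ γ φ) :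
    HasDerivWithinAt (fun φ => K.edgeParam a (γ φ)) (K.edgeParamDeriv a γ φ) A φ := by
  have h1 := (K.hasFDerivWithinAt_inv (edge_subset_carrier a (hA φ hφ))).comp_hasDerivWithinAt φ
    hγ.hasDerivAt.hasDerivWithinAt fun r hr => edge_subset_carrier a (hA r hr)
  have h2 := (planeCrossL (refEdgeDir (a + 2))).hasFDerivAt.comp_hasDerivWithinAt φ
    (h1.sub_const (refVertex (a + 2 + 1)))
  simp only [planeCrossL_apply] at h2
  refine h2.congr_of_eventuallyEq ?_ ?_
  · refine Eventually.of_forall fun r => ?_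
    simp [edgeParam, refBary, planeCrossL_apply]
  · simp [edgeParam, refBary, planeCrossL_apply]

/-- On `A` the curve equals the parametrized edge composed with its parameter, so the two velocities
agree wherever derivatives within `A` are unique. No neighborhood of `φ` has to be mapped into the
edge. -/
lemma deriv_eq_smul_edgeVel {a : Fin 3} {γ : ℝ → Plane} {A : Set ℝ}
    (hA : ∀ φ ∈ A, γ φ ∈ K.edge a) {φ : ℝ} (hφ : φ ∈ A) (hγ : DifferentiableAt ℝ γ φ)
    (hu : UniqueDiffWithinAt ℝ A φ) :
    deriv γ φ = K.edgeParamDeriv a γ φ • K.edgeVel a (K.edgeParam a (γ φ)) := by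
  have h1 := hasDerivWithinAt_edgeParam hA hφ hγ
  have h2 : HasDerivWithinAt (fun φ => K.edgeCurve a (K.edgeParam a (γ φ)))
      (K.edgeParamDeriv a γ φ • K.edgeVel a (K.edgeParam a (γ φ))) A φ :=
    HasDerivWithinAt.scomp (g₁ := K.edgeCurve a) (t' := Icc 0 1) φ
      (hasDerivWithinAt_edgeCurve a (edgeParam_mem (hA φ hφ))) h1
      fun r hr => edgeParam_mem (hA r hr)
  have h3 : HasDerivWithinAt (fun φ => K.edgeCurve a (K.edgeParam a (γ φ))) (deriv γ φ) A φ :=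
    hγ.hasDerivAt.hasDerivWithinAt.congr (fun r hr => edgeCurve_edgeParam (hA r hr))
      (edgeCurve_edgeParam (hA φ hφ))
  exact hu.eq_deriv _ h3 h2

end CurvedTriangle

section Boundary

open CurvedTriangle

variable {β ι : Type*} {Ω : Set Plane} {L : β → ℝ} {x : β → ℝ → Plane} {T : ι → CurvedTriangle}

lemma differentiableAt_curve (hx : IsC2BoundaryParam Ω L x) (b : β) (φ : ℝ) :
    DifferentiableAt ℝ (x b) φ :=
  ((hx.contDiff b).differentiable two_ne_zero) φ

lemma exists_edgeParams_of_mem_frontier (hx : IsC2BoundaryParam Ω L x) {y : Plane}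
    (hy : y ∈ frontier Ω) : ∃ b, ∃ φ ∈ Ico 0 (L b), x b φ = y := by
  rw [← hx.range_eq] at hy
  obtain ⟨b, φ, rfl⟩ := mem_iUnion.1 hy
  obtain ⟨r, hr, hφ⟩ := (hx.periodic b).exists_mem_Ico₀ (hx.length_pos b) φ
  exact ⟨b, r, hr, hφ.symm⟩

/-- A boundary edge has a nonvertex point where it is tangent to the boundary curve. -/
lemma exists_accPt_edgeParams [Finite ι] [Finite β] (hx : IsC2BoundaryParam Ω L x) {i : ι}
    {a : Fin 3} (h : (T i).edge a ⊆ frontier Ω) :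
    ∃ b, ∃ φ ∈ edgeParams (L b) (x b) ((T i).edge a),
      UniqueDiffWithinAt ℝ (edgeParams (L b) (x b) ((T i).edge a)) φ ∧
        x b φ ∉ meshVertices T := by
  by_contra! hcon
  set A : β → Set ℝ := fun b => edgeParams (L b) (x b) ((T i).edge a) with hA
  -- Otherwise the edge would consist of finitely many vertices and countably many images of
  -- isolated parameters, although it is an injective image of `[0, 1]`.
  have hcov : (T i).edge a ⊆ meshVertices T ∪ ⋃ b, x b '' {φ ∈ A b | ¬ AccPt φ (𝓟 (A b))} := by
    intro y hy
    obtain ⟨b, φ, hφ, rfl⟩ := exists_edgeParams_of_mem_frontier hx (h hy)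
    by_cases hacc : AccPt φ (𝓟 (A b))
    · exact Or.inl (hcon b φ ⟨hφ, hy⟩ hacc.uniqueDiffWithinAt)
    · exact Or.inr (mem_iUnion.2 ⟨b, φ, ⟨⟨hφ, hy⟩, hacc⟩, rfl⟩)
  have hcount : ((T i).edge a).Countable :=
    ((finite_meshVertices T).countable.union
      (countable_iUnion fun b => (countable_setOf_not_accPt (A b)).image _)).mono hcov
  have hI : (Icc (0 : ℝ) 1).Countable :=
    MapsTo.countable_of_injOn (fun s hs => edgeCurve_mem_edge hs) (injOn_edgeCurve a) hcount
  have := hI.measure_zero volume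
  simp at this

lemma planeCross_deriv_curveNormal (hx : IsC2BoundaryParam Ω L x) (b : β) (φ : ℝ) :
    planeCross (deriv (x b) φ) (curveNormal (x b) φ) = -1 := by
  rw [← rot90_curveNormal, planeCross_rot90_left, real_inner_self_eq_norm_sq,
    norm_curveNormal hx, one_pow]

/-- Orientation of a boundary edge relative to the boundary curve. -/
lemma boundary_orientation (hT : IsExactTriangulation Ω T) (hx : IsC2BoundaryParam Ω L x) {i : ι}
    {a : Fin 3} {s : ℝ} (hs : s ∈ Ioo (0 : ℝ) 1) {b : β} {φ : ℝ}
    (h : x b φ = (T i).edgeCurve a s) {c : ℝ} (hc : deriv (x b) φ = c • (T i).edgeVel a s) :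
    (T i).orient * planeCross ((T i).edgeVel a s) (curveNormal (x b) φ) < 0 ∧
      0 < (T i).orient * c := by
  have h1 := planeCross_deriv_curveNormal hx b φ
  rw [hc, planeCross_smul_left] at h1
  have h2 := (T i).orient_sq
  set d := planeCross ((T i).edgeVel a s) (curveNormal (x b) φ)
  set o := (T i).orient
  -- The outward normal of `Ω` cannot point into a triangle of the mesh. Since the cross product of
  -- the velocity and this normal is `-1`, the sign of `c` is then determined.
  have h3 : ¬ 0 < o * d := by
    intro hpos
    have h4 := eventually_mem_openCarrier hs hpos
    rw [← h] at h4
    obtain ⟨_, h5, h6⟩ := (((hx.outward b φ).mono fun _ h => h.1).and h4).exists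
    exact h5 (hT.carrier_subset i ((T i).openCarrier_subset h6))
  have h5 : o * c * (o * d) = -1 := by
    rw [show o * c * (o * d) = o * o * (c * d) by ring, h2, h1]; norm_num
  have h6 : o * d < 0 := by
    rcases lt_trichotomy (o * d) 0 with h | h | h
    · exact h
    · rw [h] at h5; norm_num at h5
    · exact absurd h h3
  exact ⟨h6, by nlinarith⟩

/-- A boundary edge belongs to only one triangle. -/
lemma boundary_edge_unique [Finite ι] [Finite β] (hT : IsExactTriangulation Ω T)
    (hx : IsC2BoundaryParam Ω L x) {i j : ι} {a c : Fin 3} (hac : (T j).edge c = (T i).edge a)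
    (h : (T i).edge a ⊆ frontier Ω) : i = j := by
  by_contra hij
  obtain ⟨b, φ, hφ, hu, hV⟩ := exists_accPt_edgeParams hx h
  have hd := differentiableAt_curve hx b φ
  have h1 := deriv_eq_smul_edgeVel (K := T i) (a := a) (fun r hr => hr.2) hφ hd hu
  have h2 := deriv_eq_smul_edgeVel (K := T j) (a := c) (fun r hr => hac ▸ hr.2) hφ hd hu
  obtain ⟨s, hs, hys⟩ := exists_edgeCurve_of_notMem_meshVertices hV hφ.2
  obtain ⟨r, hr, hyr⟩ := exists_edgeCurve_of_notMem_meshVertices hV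
    (show x b φ ∈ (T j).edge c from hac ▸ hφ.2)
  have e1 : (T i).edgeParam a (x b φ) = s := by
    rw [hys, edgeParam_edgeCurve (Ioo_subset_Icc_self hs)]
  have e2 : (T j).edgeParam c (x b φ) = r := by
    rw [hyr, edgeParam_edgeCurve (Ioo_subset_Icc_self hr)]
  rw [e1] at h1
  rw [e2] at h2
  -- Both triangles would contain the points just inside the boundary.
  refine hT.no_overlap hij hs hr (hys.symm.trans hyr) (w := -curveNormal (x b) φ) ?_ ?_
  · rw [planeCross_neg_right]; linarith [(boundary_orientation hT hx hs hys h1).1]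
  · rw [planeCross_neg_right]; linarith [(boundary_orientation hT hx hr hyr h2).1]

/-- Near a nonvertex boundary point, the boundary is contained in a single edge, and the point
belongs to a single triangle. -/
lemma boundary_local [Fintype ι] [Finite β] (hT : IsExactTriangulation Ω T) (hΩ : IsOpen Ω)
    (hx : IsC2BoundaryParam Ω L x) {y : Plane} (hy : y ∈ frontier Ω) (hyV : y ∉ meshVertices T) :
    ∃ i a, y ∈ (T i).edge a ∧ (T i).edge a ⊆ frontier Ω ∧ (∀ j, y ∈ (T j).carrier → j = i) ∧
      ∀ᶠ y' in 𝓝 y, y' ∈ frontier Ω → y' ∈ (T i).edge a := by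
  have hopen : ∀ i, ∀ y' ∈ frontier Ω, y' ∈ (T i).carrier → ∃ a, y' ∈ (T i).edge a := by
    intro i y' hy' hi
    refine (mem_openCarrier_or_edge hi).resolve_left fun h => ?_
    exact notMem_frontier_of_mem_interior_closure hx (T i).isOpen_openCarrier
      ((T i).openCarrier_subset.trans (hT.carrier_subset i)) h hy'
  have hcov : ∀ y' ∈ frontier Ω, ∃ i, y' ∈ (T i).carrier := by
    intro y' hy'
    have h1 : y' ∈ ⋃ i, (T i).carrier := by rw [hT.cover]; exact frontier_subset_closure hy'
    exact mem_iUnion.1 h1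
  obtain ⟨i, hi⟩ := hcov y hy
  obtain ⟨a, ha⟩ := hopen i y hy hi
  have hF : (T i).edge a ⊆ frontier Ω := by
    by_contra h
    exact notMem_frontier_of_mem_interior_edge hT hΩ hx h ha hyV hy
  obtain ⟨s, hs, hys⟩ := exists_edgeCurve_of_notMem_meshVertices hyV ha
  have huniq : ∀ j, y ∈ (T j).carrier → j = i := by
    intro j hj
    by_contra hji
    rw [hys] at hj
    obtain ⟨c, hc⟩ := hT.common_edge_of_edgeCurve_mem (Ne.symm hji) hs hj
    exact hji (boundary_edge_unique hT hx hc hF).symm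
  refine ⟨i, a, ha, hF, huniq, ?_⟩
  -- Finitely many closed sets not containing `y`, the other triangles and the other two edges, can
  -- be avoided in a neighborhood; the boundary near `y` has only the one edge left to lie on.
  have h1 : ∀ᶠ y' in 𝓝 y, ∀ j, j ≠ i → y' ∉ (T j).carrier := by
    refine eventually_all.2 fun j => ?_
    by_cases hji : j = i
    · exact Eventually.of_forall fun _ h => absurd hji h
    · filter_upwards [(T j).isClosed_carrier.isOpen_compl.mem_nhds
        (fun h => hji (huniq j h))] with y' hy' _ using hy'
  have h2 : ∀ᶠ y' in 𝓝 y, ∀ c, c ≠ a → y' ∉ (T i).edge c := by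
    refine eventually_all.2 fun c => ?_
    by_cases hca : c = a
    · exact Eventually.of_forall fun _ h => absurd hca h
    · filter_upwards [(isCompact_edge (K := T i) c).isClosed.isOpen_compl.mem_nhds
        (fun h => hca (edgeCurve_edge_unique hs (hys ▸ h)))] with y' hy' _ using hy'
  filter_upwards [h1, h2] with y' h3 h4 hy'
  obtain ⟨j, hj⟩ := hcov y' hy'
  obtain rfl : j = i := by
    by_contra hji
    exact h3 j hji hj
  obtain ⟨c, hc⟩ := hopen j y' hy' hj
  by_cases hca : c = a
  · exact hca ▸ hc
  · exact absurd hc (h4 c hca)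

end Boundary

/-! ### The gradient on the boundary of the domain -/

namespace CurvedTriangle

variable {K : CurvedTriangle}

/-- Points in the relative interior of a straight edge are not endpoints of the segment. -/
lemma edgeCurve_ne_endpoint {a : Fin 3} (ha : K.IsStraightEdge a) {s : ℝ}
    (hs : s ∈ Ioo (0 : ℝ) 1) {p q : Plane} (hpq : K.edge a = segment ℝ p q) :
    K.edgeCurve a s ≠ p := by
  intro hp
  obtain ⟨t, ht⟩ := exists_isUnitTangent ha
  have h1 := (eventually_mem_edge ha hs ht (one_smul ℝ t).symm).filter_mono
    (nhdsWithin_le_nhds (s := Ioi 0))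
  have h2 := (eventually_mem_edge (w := -t) ha hs ht (neg_one_smul ℝ t).symm).filter_mono
    (nhdsWithin_le_nhds (s := Ioi 0))
  obtain ⟨h, ⟨h3, h4⟩, h0⟩ := ((h1.and h2).and (self_mem_nhdsWithin (s := Ioi (0 : ℝ)))).exists
  have h0 : 0 < h := h0
  rw [hp, hpq, segment_eq_image'] at h3 h4
  obtain ⟨α, hα, h3⟩ := h3
  obtain ⟨β, hβ, h4⟩ := h4
  simp only [add_right_inj] at h3 h4
  -- From an endpoint of a segment one cannot move in both directions: the two displacements are
  -- nonnegative multiples of `q - p` with sum zero.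
  have h5 : (α + β) • (q - p) = 0 := by rw [add_smul, h3, h4, smul_neg, add_neg_cancel]
  have h6 : h • t = 0 := by
    rcases smul_eq_zero.1 h5 with h7 | h7
    · have : α = 0 := by linarith [hα.1, hβ.1]
      rw [← h3, this, zero_smul]
    · rw [← h3, h7, smul_zero]
  rcases smul_eq_zero.1 h6 with h7 | h7
  · exact h0.ne' h7
  · have := ht.1
    rw [h7, norm_zero] at this
    exact zero_ne_one this

end CurvedTriangle

section Boundary

open CurvedTriangle

variable {β ι : Type*} [Fintype ι] [Finite β] {Ω : Set Plane} {L : β → ℝ} {x : β → ℝ → Plane}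
  {T : ι → CurvedTriangle} {v : Plane → ℝ}

/-- A vertex of the mesh is a vertex of every triangle that contains it. -/
lemma exists_vertex_of_mem_carrier (hT : IsExactTriangulation Ω T)
    (hx : IsC2BoundaryParam Ω L x) {y : Plane} (hy : y ∈ meshVertices T) {j : ι}
    (hj : y ∈ (T j).carrier) : ∃ d, y = (T j).vertex d := by
  obtain ⟨⟨l, d⟩, rfl⟩ := hy
  simp only at hj ⊢
  by_cases hlj : l = j
  · exact hlj ▸ ⟨d, rfl⟩
  have hl : (T l).vertex d ∈ (T l).carrier := vertex_mem d
  rcases hT.conforming l j hlj with h | ⟨a, c, hac, h⟩ | ⟨a, c, hac, h⟩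
  · exact absurd (show (T l).vertex d ∈ (∅ : Set Plane) from h ▸ ⟨hl, hj⟩) (notMem_empty _)
  · have h1 : (T l).vertex d ∈ ({(T l).vertex a} : Set Plane) := h ▸ ⟨hl, hj⟩
    exact ⟨c, (mem_singleton_iff.1 h1).trans hac⟩
  · have h1 : (T l).vertex d ∈ (T l).edge a := h ▸ ⟨hl, hj⟩
    by_contra! hne
    -- Conformity identifies shared edges only as sets. A shared edge is not a boundary edge, hence
    -- is straight, and a segment determines its endpoints.
    have hF : ¬ (T l).edge a ⊆ frontier Ω := fun hF =>
      hlj (boundary_edge_unique hT hx hac.symm hF)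
    have sl := hT.isStraightEdge hF
    have sj : (T j).IsStraightEdge c := hT.isStraightEdge (by rwa [← hac])
    have h2 := h1
    rw [hac, edge_eq_image] at h2
    obtain ⟨r, hr, hrd⟩ := h2
    have hr' : r ∈ Ioo (0 : ℝ) 1 := mem_Ioo_of_ne_vertex hr fun c => by rw [hrd]; exact hne c
    have seg : (T j).edge c = segment ℝ ((T l).vertex (a + 1)) ((T l).vertex (a + 2)) := by
      rw [← hac]; exact sl
    have hp := edgeCurve_ne_endpoint sj hr' seg
    have hq := edgeCurve_ne_endpoint sj hr' (seg.trans (segment_symm ..))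
    rw [hrd] at hp hq
    rw [edge_eq_image] at h1
    obtain ⟨s, hs, hsd⟩ := h1
    by_cases hs' : s ∈ Ioo (0 : ℝ) 1
    · exact edgeCurve_ne_vertex hs' hsd
    · have : s = 0 ∨ s = 1 := by
        by_contra! h01
        exact hs' ⟨lt_of_le_of_ne hs.1 h01.1.symm, lt_of_le_of_ne hs.2 h01.2⟩
      rcases this with rfl | rfl
      · exact hp (by rw [← hsd, edgeCurve_zero])
      · exact hq (by rw [← hsd, edgeCurve_one])

/-- At boundary points, the gradient of `v` taken within the closed domain is the gradient of the
restriction of `v` to any triangle. -/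
lemma fderivWithin_closure_eq_grad (hT : IsExactTriangulation Ω T) (hΩ : IsOpen Ω)
    (hx : IsC2BoundaryParam Ω L x) (hv : ∀ i, ContDiffOn ℝ 2 v (T i).carrier)
    (hvert : ∀ i j a c, (T i).vertex a = (T j).vertex c →
      (T i).grad v ((T i).vertex a) = (T j).grad v ((T j).vertex c)) {y : Plane}
    (hy : y ∈ frontier Ω) {i : ι} (hi : y ∈ (T i).carrier) :
    fderivWithin ℝ v (closure Ω) y = (T i).grad v y := by
  -- Several triangles meet at a boundary point only if it is a vertex, and there the gradients
  -- agree by hypothesis.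
  have hsame : ∀ j, y ∈ (T j).carrier → (T j).grad v y = (T i).grad v y := by
    intro j hj
    by_cases hyV : y ∈ meshVertices T
    · obtain ⟨d, hd⟩ := exists_vertex_of_mem_carrier hT hx hyV hi
      obtain ⟨e, he⟩ := exists_vertex_of_mem_carrier hT hx hyV hj
      have := hvert j i e d (he.symm.trans hd)
      rwa [← he, ← hd] at this
    · obtain ⟨k, -, -, -, hk, -⟩ := boundary_local hT hΩ hx hy hyV
      rw [hk j hj, hk i hi]
  have hder : HasFDerivWithinAt v ((T i).grad v y) (closure Ω) y := by
    -- Differentiability within a finite union follows from differentiability within each member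
    -- with the same derivative; triangles not containing `y` impose no condition.
    rw [← hT.cover, hasFDerivWithinAt_iff_tendsto, nhdsWithin_iUnion, tendsto_iSup]
    intro j
    rw [← hasFDerivWithinAt_iff_tendsto]
    by_cases hj : y ∈ (T j).carrier
    · rw [← hsame j hj]; exact hasFDerivWithinAt_grad (hv j) hj
    · exact HasFDerivWithinAt.of_notMem_closure (by rwa [(T j).isClosed_carrier.closure_eq])
  exact hder.fderivWithin (((T i).uniqueDiffOn_carrier y hi).mono (hT.carrier_subset i))

/-- Continuity is pasted over the finitely many closed pieces. Continuity across the vertices is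
what later removes the exact term from the boundary integral. -/
lemma continuousOn_fderivWithin_closure (hT : IsExactTriangulation Ω T) (hΩ : IsOpen Ω)
    (hx : IsC2BoundaryParam Ω L x) (hv : ∀ i, ContDiffOn ℝ 2 v (T i).carrier)
    (hvert : ∀ i j a c, (T i).vertex a = (T j).vertex c →
      (T i).grad v ((T i).vertex a) = (T j).grad v ((T j).vertex c)) :
    ContinuousOn (fderivWithin ℝ v (closure Ω)) (frontier Ω) := by
  have hcov : frontier Ω = ⋃ i, (T i).carrier ∩ frontier Ω := by
    rw [← iUnion_inter, hT.cover, inter_eq_right.2 frontier_subset_closure]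
  rw [hcov]
  refine (locallyFinite_of_finite _).continuousOn_iUnion
    (fun i => (T i).isClosed_carrier.inter isClosed_frontier) fun i => ?_
  exact ((contDiffOn_grad (hv i)).continuousOn.mono inter_subset_left).congr fun y hy =>
    fderivWithin_closure_eq_grad hT hΩ hx hv hvert hy.2 hy.1

end Boundary

/-! ### The oblique frame along the boundary -/

/-- `rot90` as a continuous linear map. -/
def rot90L : Plane →L[ℝ] Plane :=
  LinearMap.toContinuousLinearMap
    { toFun := rot90
      map_add' := fun u w => by apply plane_ext <;> simp; ring
      map_smul' := fun c u => by apply plane_ext <;> simp }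

lemma continuous_rot90 : Continuous rot90 := rot90L.continuous

lemma HasDerivAt.plane_apply {f : ℝ → Plane} {f' : Plane} {φ : ℝ} (hf : HasDerivAt f f' φ)
    (i : Fin 2) : HasDerivAt (fun φ => f φ i) (f' i) φ :=
  (EuclideanSpace.proj (𝕜 := ℝ) i).hasFDerivAt.comp_hasDerivAt φ hf

lemma HasDerivAt.rot90 {f : ℝ → Plane} {f' : Plane} {φ : ℝ} (hf : HasDerivAt f f' φ) :
    HasDerivAt (fun φ => rot90 (f φ)) (rot90 f') φ :=
  rot90L.hasFDerivAt.comp_hasDerivAt φ hf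

section Frame

variable {β : Type*} {Ω : Set Plane} {L : β → ℝ} {x ℓ : β → ℝ → Plane} {θ : β → ℝ → ℝ}

lemma hasDerivAt_deriv_curve (hx : IsC2BoundaryParam Ω L x) (b : β) (φ : ℝ) :
    HasDerivAt (deriv (x b)) (deriv (deriv (x b)) φ) φ := by
  have h : ContDiff ℝ (1 + 1) (x b) := by
    rw [show (1 + 1 : WithTop ℕ∞) = 2 by norm_num]; exact hx.contDiff b
  have h1 : ContDiff ℝ 1 (deriv (x b)) := (contDiff_succ_iff_deriv.1 h).2.2
  exact (h1.differentiable one_ne_zero φ).hasDerivAt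

/-- The second derivatives of a unit speed curve in terms of its curvature. -/
lemma second_deriv_curve (hx : IsC2BoundaryParam Ω L x) (b : β) (φ : ℝ) :
    deriv (deriv (x b)) φ 0 = curveCurvature (x b) φ * deriv (x b) φ 1 ∧
    deriv (deriv (x b)) φ 1 = -(curveCurvature (x b) φ * deriv (x b) φ 0) := by
  have h1 : ∀ φ, deriv (x b) φ 0 ^ 2 + deriv (x b) φ 1 ^ 2 = 1 := fun φ =>
    (plane_norm_eq_one_iff _).1 (hx.unit_speed b φ)
  have hd := hasDerivAt_deriv_curve hx b φ
  have h2 := ((hd.plane_apply 0).pow 2).add ((hd.plane_apply 1).pow 2)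
  have h3 : HasDerivAt (fun φ => deriv (x b) φ 0 ^ 2 + deriv (x b) φ 1 ^ 2) 0 φ := by
    simp_rw [h1]; exact hasDerivAt_const φ 1
  have h4 := h2.unique h3
  simp only [Nat.cast_ofNat, Nat.add_one_sub_one, pow_one] at h4
  have h5 := h1 φ
  unfold curveCurvature
  constructor
  · linear_combination (-(deriv (deriv (x b)) φ 0)) * h5 + (deriv (x b) φ 0 / 2) * h4
  · linear_combination (-(deriv (deriv (x b)) φ 1)) * h5 + (deriv (x b) φ 1 / 2) * h4

lemma differentiableAt_oblique (hℓ : IsObliqueField L ℓ) {b : β} {φ : ℝ}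
    (hφ : φ ∈ Ioo 0 (L b)) : DifferentiableAt ℝ (ℓ b) φ :=
  (((hℓ.contDiffOn b).differentiableOn one_ne_zero) φ
    (Ioo_subset_Icc_self hφ)).differentiableAt (Icc_mem_nhds hφ.1 hφ.2)

lemma oblique_components (hθ : IsObliqueAngle L x ℓ θ) {b : β} {φ : ℝ}
    (hφ : φ ∈ Icc 0 (L b)) :
    ℓ b φ 0 = Real.cos (θ b φ) * deriv (x b) φ 1 + Real.sin (θ b φ) * deriv (x b) φ 0 ∧
    ℓ b φ 1 = -(Real.cos (θ b φ) * deriv (x b) φ 0) + Real.sin (θ b φ) * deriv (x b) φ 1 := by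
  have h := hθ.eq_rotation b φ hφ
  rw [rot90_curveNormal] at h
  rw [h]
  constructor <;> simp [curveNormal]

/-- The angle is only assumed continuous. Near `φ` it is `θ₀ + arcsin h`, where `h = sin (θ - θ₀)`
is an expression in the components of `ℓ` and `ẋ` and hence differentiable; continuity keeps `θ` on
this branch. -/
lemma differentiableAt_obliqueAngle (hx : IsC2BoundaryParam Ω L x) (hℓ : IsObliqueField L ℓ)
    (hθ : IsObliqueAngle L x ℓ θ) {b : β} {φ : ℝ} (hφ : φ ∈ Ioo 0 (L b)) :
    DifferentiableAt ℝ (θ b) φ := by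
  have hnhds : Icc 0 (L b) ∈ 𝓝 φ := Icc_mem_nhds hφ.1 hφ.2
  set θ₀ := θ b φ with hθ₀
  set h : ℝ → ℝ := fun r => (ℓ b r 0 * deriv (x b) r 0 + ℓ b r 1 * deriv (x b) r 1) * Real.cos θ₀
    - (ℓ b r 0 * deriv (x b) r 1 - ℓ b r 1 * deriv (x b) r 0) * Real.sin θ₀ with hh
  have hsin : ∀ r ∈ Icc 0 (L b), h r = Real.sin (θ b r - θ₀) := by
    intro r hr
    obtain ⟨e0, e1⟩ := oblique_components hθ hr
    have h1 := (plane_norm_eq_one_iff _).1 (hx.unit_speed b r)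
    simp only [hh]
    rw [e0, e1, Real.sin_sub]
    linear_combination (Real.sin (θ b r) * Real.cos θ₀ - Real.cos (θ b r) * Real.sin θ₀) * h1
  have hd : DifferentiableAt ℝ h φ := by
    have dℓ := (differentiableAt_oblique hℓ hφ).hasDerivAt
    have dx := hasDerivAt_deriv_curve hx b φ
    have a0 := (dℓ.plane_apply 0).differentiableAt
    have a1 := (dℓ.plane_apply 1).differentiableAt
    have b0 := (dx.plane_apply 0).differentiableAt
    have b1 := (dx.plane_apply 1).differentiableAt
    exact (((a0.mul b0).add (a1.mul b1)).mul_const _).sub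
      (((a0.mul b1).sub (a1.mul b0)).mul_const _)
  have h0 : h φ = 0 := by rw [hsin φ (mem_of_mem_nhds hnhds), ← hθ₀, sub_self, Real.sin_zero]
  have hcont : ContinuousAt (θ b) φ := (hθ.continuousOn b).continuousAt hnhds
  have hnear : ∀ᶠ r in 𝓝 φ, θ b r - θ₀ ∈ Ioo (-(Real.pi / 2)) (Real.pi / 2) := by
    refine (hcont.sub continuousAt_const).eventually (isOpen_Ioo.mem_nhds ?_)
    simp [← hθ₀, Real.pi_pos]
  have heq : θ b =ᶠ[𝓝 φ] fun r => θ₀ + Real.arcsin (h r) := by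
    filter_upwards [hnear, hnhds] with r hr hrI
    rw [hsin r hrI, Real.arcsin_sin hr.1.le hr.2.le]
    ring
  have harc : DifferentiableAt ℝ (fun r => θ₀ + Real.arcsin (h r)) φ := by
    have : DifferentiableAt ℝ Real.arcsin (h φ) := by
      rw [h0]; exact Real.differentiableAt_arcsin.2 ⟨by norm_num, by norm_num⟩
    exact (this.comp φ hd).const_add θ₀
  exact harc.congr_of_eventuallyEq heq

/-- The oblique field rotates at the rate `θ̇ - χ`. -/
lemma hasDerivAt_oblique (hx : IsC2BoundaryParam Ω L x) (hℓ : IsObliqueField L ℓ)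
    (hθ : IsObliqueAngle L x ℓ θ) {b : β} {φ : ℝ} (hφ : φ ∈ Ioo 0 (L b)) :
    HasDerivAt (ℓ b) ((deriv (θ b) φ - curveCurvature (x b) φ) • rot90 (ℓ b φ)) φ := by
  have hnhds : Icc 0 (L b) ∈ 𝓝 φ := Icc_mem_nhds hφ.1 hφ.2
  have dℓ := (differentiableAt_oblique hℓ hφ).hasDerivAt
  have dx := hasDerivAt_deriv_curve hx b φ
  have dθ := (differentiableAt_obliqueAngle hx hℓ hθ hφ).hasDerivAt
  have d0 : HasDerivAt (fun r => Real.cos (θ b r) * deriv (x b) r 1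
      + Real.sin (θ b r) * deriv (x b) r 0) _ φ :=
    (dθ.cos.mul (dx.plane_apply 1)).add (dθ.sin.mul (dx.plane_apply 0))
  have d1 : HasDerivAt (fun r => -(Real.cos (θ b r) * deriv (x b) r 0)
      + Real.sin (θ b r) * deriv (x b) r 1) _ φ :=
    (dθ.cos.mul (dx.plane_apply 0)).neg.add (dθ.sin.mul (dx.plane_apply 1))
  have u0 := (dℓ.plane_apply 0).unique (d0.congr_of_eventuallyEq (by
    filter_upwards [hnhds] with r hr using (oblique_components hθ hr).1))
  have u1 := (dℓ.plane_apply 1).unique (d1.congr_of_eventuallyEq (by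
    filter_upwards [hnhds] with r hr using (oblique_components hθ hr).2))
  obtain ⟨s0, s1⟩ := second_deriv_curve hx b φ
  obtain ⟨e0, e1⟩ := oblique_components hθ (mem_of_mem_nhds hnhds)
  rw [s0, s1] at u0 u1
  have : deriv (ℓ b) φ = (deriv (θ b) φ - curveCurvature (x b) φ) • rot90 (ℓ b φ) := by
    apply plane_ext
    · rw [u0, PiLp.smul_apply, smul_eq_mul, rot90_apply_zero, e1]; ring
    · rw [u1, PiLp.smul_apply, smul_eq_mul, rot90_apply_one, e0]; ring
  rw [← this]
  exact dℓ

lemma exists_bound_deriv_oblique (hL : ∀ b, 0 < L b) (hℓ : IsObliqueField L ℓ) (b : β) :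
    ∃ C, ∀ φ ∈ Ioo 0 (L b), ‖deriv (ℓ b) φ‖ ≤ C := by
  have hc : ContinuousOn (derivWithin (ℓ b) (Icc 0 (L b))) (Icc 0 (L b)) :=
    (hℓ.contDiffOn b).continuousOn_derivWithin (uniqueDiffOn_Icc (hL b)) le_rfl
  obtain ⟨C, hC⟩ := isCompact_Icc.exists_bound_of_continuousOn hc
  refine ⟨C, fun φ hφ => ?_⟩
  rw [← derivWithin_of_mem_nhds (Icc_mem_nhds hφ.1 hφ.2)]
  exact hC φ (Ioo_subset_Icc_self hφ)

end Frame

/-- The tangential variation of a covector field in a rotating frame. -/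
lemma covCross_rotating_frame {W : ℝ → Plane →L[ℝ] ℝ} {W' : Plane →L[ℝ] ℝ} {ℓ : ℝ → Plane}
    {κ φ : ℝ} (hW : HasDerivAt W W' φ) (hℓ : HasDerivAt ℓ (κ • rot90 (ℓ φ)) φ)
    (h1 : ‖ℓ φ‖ = 1) :
    HasDerivAt (fun r => W r (ℓ r)) (W' (ℓ φ) + κ * W φ (rot90 (ℓ φ))) φ ∧
    HasDerivAt (fun r => W r (rot90 (ℓ r))) (W' (rot90 (ℓ φ)) - κ * W φ (ℓ φ)) φ ∧
    covCross (W φ) W' = (∑ i, W φ (unitVec i) ^ 2) * κ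
        - 2 * W φ (rot90 (ℓ φ)) * (W' (ℓ φ) + κ * W φ (rot90 (ℓ φ)))
      + ((W' (ℓ φ) + κ * W φ (rot90 (ℓ φ))) * W φ (rot90 (ℓ φ))
        + W φ (ℓ φ) * (W' (rot90 (ℓ φ)) - κ * W φ (ℓ φ))) := by
  refine ⟨?_, ?_, ?_⟩
  · have := hW.clm_apply hℓ
    simpa using this
  · have := hW.clm_apply hℓ.rot90
    have e : rot90 (κ • rot90 (ℓ φ)) = -(κ • ℓ φ) := by
      apply plane_ext <;> simp
    rw [e, map_neg, map_smul, smul_eq_mul, ← sub_eq_add_neg] at this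
    exact this
  · have hsq : ∑ i, W φ (unitVec i) ^ 2 = W φ (ℓ φ) ^ 2 + W φ (rot90 (ℓ φ)) ^ 2 := by
      rw [plane_norm_eq_one_iff] at h1
      rw [clm_apply_plane (W φ) (ℓ φ), clm_apply_plane (W φ) (rot90 (ℓ φ)), Fin.sum_univ_two]
      simp only [smul_eq_mul, rot90_apply_zero, rot90_apply_one]
      linear_combination (-(W φ (unitVec 0) ^ 2 + W φ (unitVec 1) ^ 2)) * h1
    rw [covCross_eq_of_norm_eq_one _ _ h1, hsq]
    ring

/-! ### Integrals along the boundary -/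

/-- `v` is `C²` on every triangle of an exact triangulation of a domain with `C²` boundary, with
gradients that agree at the vertices. -/
structure IsPiecewiseC2 {β ι : Type*} (Ω : Set Plane) (L : β → ℝ) (x : β → ℝ → Plane)
    (T : ι → CurvedTriangle) (v : Plane → ℝ) : Prop where
  isOpen : IsOpen Ω
  boundary : IsC2BoundaryParam Ω L x
  exact_mesh : IsExactTriangulation Ω T
  contDiffOn : ∀ i, ContDiffOn ℝ 2 v (T i).carrier
  grad_vertex : ∀ i j a c, (T i).vertex a = (T j).vertex c →
    (T i).grad v ((T i).vertex a) = (T j).grad v ((T j).vertex c)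

/-- The gradient of `v` along a boundary curve. -/
def boundaryGrad (Ω : Set Plane) (v : Plane → ℝ) (γ : ℝ → Plane) (φ : ℝ) : Plane →L[ℝ] ℝ :=
  fderivWithin ℝ v (closure Ω) (γ φ)

/-- The product `(∂v/∂ℓ) (∂v/∂ℓ^⊥)` along a boundary curve. -/
def obliqueProduct (Ω : Set Plane) (v : Plane → ℝ) (γ ℓ : ℝ → Plane) (φ : ℝ) : ℝ :=
  boundaryDeriv Ω v γ ℓ φ * boundaryDeriv Ω v γ (fun ψ => rot90 (ℓ ψ)) φ

/-- Parameters of mesh vertices, and the parameter `0`. -/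
def exceptionalParams {ι : Type*} (T : ι → CurvedTriangle) (l : ℝ) (γ : ℝ → Plane) : Set ℝ :=
  {φ | φ ∈ Ico 0 l ∧ (φ = 0 ∨ γ φ ∈ meshVertices T)}

namespace IsPiecewiseC2

open CurvedTriangle

variable {β ι : Type*} {Ω : Set Plane} {L : β → ℝ} {x : β → ℝ → Plane}
  {T : ι → CurvedTriangle} {v : Plane → ℝ} {ℓ : β → ℝ → Plane} {θ : β → ℝ → ℝ}

/-- The curve is injective on one period, so each of the finitely many vertices is met at most once.
-/
lemma finite_exceptionalParams [Finite ι] (h : IsPiecewiseC2 Ω L x T v) (b : β) :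
    (exceptionalParams T (L b) (x b)).Finite := by
  have h1 : exceptionalParams T (L b) (x b) ⊆
      {0} ∪ (Ico 0 (L b) ∩ x b ⁻¹' meshVertices T) := by
    rintro φ ⟨h1, rfl | h2⟩
    exacts [Or.inl rfl, Or.inr ⟨h1, h2⟩]
  refine ((finite_singleton 0).union ?_).subset h1
  refine Finite.of_finite_image (f := x b)
    ((finite_meshVertices T).subset (by rintro _ ⟨φ, hφ, rfl⟩; exact hφ.2)) ?_
  intro φ hφ ψ hψ hxy
  exact (h.boundary.simple_disjoint b b φ ψ hφ.1 hψ.1 hxy).2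

lemma ae_notMem_exceptionalParams [Finite ι] (h : IsPiecewiseC2 Ω L x T v) (b : β) :
    ∀ᵐ φ, φ ∉ exceptionalParams T (L b) (x b) :=
  measure_eq_zero_iff_ae_notMem.1 ((h.finite_exceptionalParams b).measure_zero _)

lemma mem_Ioo_of_notMem_exceptionalParams {b : β} {φ : ℝ} (hφ : φ ∈ Ico 0 (L b))
    (hφ' : φ ∉ exceptionalParams T (L b) (x b)) :
    φ ∈ Ioo 0 (L b) ∧ x b φ ∉ meshVertices T := by
  refine ⟨⟨lt_of_le_of_ne hφ.1 ?_, hφ.2⟩, fun h => hφ' ⟨hφ, Or.inr h⟩⟩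
  rintro rfl
  exact hφ' ⟨hφ, Or.inl rfl⟩

lemma continuous_boundaryGrad [Fintype ι] [Finite β] (h : IsPiecewiseC2 Ω L x T v) (b : β) :
    Continuous (boundaryGrad Ω v (x b)) :=
  (continuousOn_fderivWithin_closure h.exact_mesh h.isOpen h.boundary h.contDiffOn
    h.grad_vertex).comp_continuous (h.boundary.contDiff b).continuous
      (curve_mem_frontier h.boundary b)

lemma boundaryGrad_eq [Fintype ι] [Finite β] (h : IsPiecewiseC2 Ω L x T v) {b : β} {φ : ℝ} {i : ι}
    (hi : x b φ ∈ (T i).carrier) : boundaryGrad Ω v (x b) φ = (T i).grad v (x b φ) :=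
  fderivWithin_closure_eq_grad h.exact_mesh h.isOpen h.boundary h.contDiffOn h.grad_vertex
    (curve_mem_frontier h.boundary b φ) hi

/-- The gradient of `v` is differentiable along the boundary away from vertices. -/
lemma exists_boundary_edge [Fintype ι] [Finite β] (h : IsPiecewiseC2 Ω L x T v) {b : β} {φ : ℝ}
    (hφ : x b φ ∉ meshVertices T) :
    ∃ i a, x b φ ∈ (T i).edge a ∧ (T i).edge a ⊆ frontier Ω ∧
      (∀ j, x b φ ∈ (T j).carrier → j = i) ∧ (∀ᶠ r in 𝓝 φ, x b r ∈ (T i).edge a) ∧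
      HasDerivAt (boundaryGrad Ω v (x b)) ((T i).hess v (x b φ) (deriv (x b) φ)) φ := by
  obtain ⟨i, a, h1, h2, h3, h4⟩ := boundary_local h.exact_mesh h.isOpen h.boundary
    (curve_mem_frontier h.boundary b φ) hφ
  have hd := differentiableAt_curve h.boundary b φ
  have h5 : ∀ᶠ r in 𝓝 φ, x b r ∈ (T i).edge a :=
    (hd.continuousAt.eventually h4).mono fun r hr => hr (curve_mem_frontier h.boundary b r)
  refine ⟨i, a, h1, h2, h3, h5, ?_⟩
  have hS : {r | x b r ∈ (T i).edge a} ∈ 𝓝 φ := h5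
  have h6 := ((hasFDerivWithinAt_hess (h.contDiffOn i)
    (edge_subset_carrier a h1)).comp_hasDerivWithinAt φ (s := {r | x b r ∈ (T i).edge a})
    hd.hasDerivAt.hasDerivWithinAt fun r hr => edge_subset_carrier a hr).hasDerivAt hS
  refine h6.congr_of_eventuallyEq ?_
  filter_upwards [h5] with r hr using h.boundaryGrad_eq (edge_subset_carrier a hr)

/-- The derivative is a Hessian applied to a unit tangent, and each of the finitely many Hessians is
bounded on its compact triangle. -/
lemma exists_bound_deriv_boundaryGrad [Fintype ι] [Finite β] (h : IsPiecewiseC2 Ω L x T v) (b : β) :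
    ∃ C, ∀ φ, x b φ ∉ meshVertices T → ‖deriv (boundaryGrad Ω v (x b)) φ‖ ≤ C := by
  have hb : ∀ i, ∃ C, ∀ y ∈ (T i).carrier, ‖(T i).hess v y‖ ≤ C := by
    intro i
    have hc : ContinuousOn (fun y => ‖(T i).hess v y‖) (T i).carrier :=
      (continuous_norm (E := Plane →L[ℝ] Plane →L[ℝ] ℝ)).comp_continuousOn
        (continuousOn_hess (h.contDiffOn i))
    obtain ⟨C, hC⟩ := (T i).isCompact_carrier.exists_bound_of_continuousOn hc
    exact ⟨C, fun y hy => (norm_norm ((T i).hess v y)) ▸ hC y hy⟩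
  choose C hC using hb
  refine ⟨∑ i, |C i|, fun φ hφ => ?_⟩
  obtain ⟨i, a, h1, -, -, -, h2⟩ := h.exists_boundary_edge hφ
  rw [h2.deriv]
  calc ‖(T i).hess v (x b φ) (deriv (x b) φ)‖ ≤ ‖(T i).hess v (x b φ)‖ * ‖deriv (x b) φ‖ :=
        ContinuousLinearMap.le_opNorm _ _
    _ ≤ |C i| := by
        rw [h.boundary.unit_speed, mul_one]
        exact (hC i _ (edge_subset_carrier a h1)).trans (le_abs_self _)
    _ ≤ ∑ i, |C i| :=
        Finset.single_le_sum (f := fun i => |C i|) (fun i _ => abs_nonneg _) (Finset.mem_univ i)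

/-- The derivatives along the boundary at a nonexceptional parameter. -/
lemma oblique_calculus [Fintype ι] [Finite β] (h : IsPiecewiseC2 Ω L x T v) (hℓ : IsObliqueField L ℓ)
    (hθ : IsObliqueAngle L x ℓ θ) {b : β} {φ : ℝ} (hφ : φ ∈ Ioo 0 (L b))
    (hφ' : x b φ ∉ meshVertices T) :
    HasDerivAt (boundaryDeriv Ω v (x b) (ℓ b))
      (deriv (boundaryGrad Ω v (x b)) φ (ℓ b φ) + (deriv (θ b) φ - curveCurvature (x b) φ) *
        boundaryGrad Ω v (x b) φ (rot90 (ℓ b φ))) φ ∧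
    HasDerivAt (obliqueProduct Ω v (x b) (ℓ b))
      (deriv (obliqueProduct Ω v (x b) (ℓ b)) φ) φ ∧
    covCross (boundaryGrad Ω v (x b) φ) (deriv (boundaryGrad Ω v (x b)) φ) =
      boundaryIntegrand Ω v (x b) (ℓ b) (θ b) φ + deriv (obliqueProduct Ω v (x b) (ℓ b)) φ := by
  obtain ⟨i, a, -, -, -, -, hW⟩ := h.exists_boundary_edge hφ'
  have hW' := hW.differentiableAt.hasDerivAt
  obtain ⟨h1, h2, h3⟩ := covCross_rotating_frame hW' (hasDerivAt_oblique h.boundary hℓ hθ hφ)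
    (hℓ.unit b φ (Ioo_subset_Icc_self hφ))
  have h4 : HasDerivAt (obliqueProduct Ω v (x b) (ℓ b)) _ φ := h1.mul h2
  refine ⟨h1, h4.differentiableAt.hasDerivAt, ?_⟩
  have h5 : deriv (boundaryDeriv Ω v (x b) (ℓ b)) φ = _ := h1.deriv
  rw [h4.deriv, h3, boundaryIntegrand, h5]
  rfl

lemma integrableOn_of_bounded [Finite ι] (h : IsPiecewiseC2 Ω L x T v) {b : β} {f : ℝ → ℝ}
    (hf : AEStronglyMeasurable f (volume.restrict (Ico 0 (L b)))) {C : ℝ}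
    (hC : ∀ φ ∈ Ioo 0 (L b), x b φ ∉ meshVertices T → ‖f φ‖ ≤ C) :
    IntegrableOn f (Ico 0 (L b)) := by
  refine Integrable.of_bound hf C ?_
  rw [ae_restrict_iff' measurableSet_Ico]
  filter_upwards [h.ae_notMem_exceptionalParams b] with φ hφ hφI
  obtain ⟨h1, h2⟩ := mem_Ioo_of_notMem_exceptionalParams hφI hφ
  exact hC φ h1 h2

lemma continuousOn_boundaryDeriv [Fintype ι] [Finite β] (h : IsPiecewiseC2 Ω L x T v) (hℓ : IsObliqueField L ℓ) (b : β) :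
    ContinuousOn (boundaryDeriv Ω v (x b) (ℓ b)) (Icc 0 (L b)) ∧
    ContinuousOn (boundaryDeriv Ω v (x b) (fun ψ => rot90 (ℓ b ψ))) (Icc 0 (L b)) :=
  ⟨(h.continuous_boundaryGrad b).continuousOn.clm_apply (hℓ.contDiffOn b).continuousOn,
    (h.continuous_boundaryGrad b).continuousOn.clm_apply
      (continuous_rot90.comp_continuousOn (hℓ.contDiffOn b).continuousOn)⟩

lemma measurable_curveCurvature (γ : ℝ → Plane) : Measurable (curveCurvature γ) := by
  have h1 : ∀ i : Fin 2, Measurable fun φ => deriv γ φ i := fun i =>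
    (continuous_plane_apply i).measurable.comp (measurable_deriv γ)
  have h2 : ∀ i : Fin 2, Measurable fun φ => deriv (deriv γ) φ i := fun i =>
    (continuous_plane_apply i).measurable.comp (measurable_deriv (deriv γ))
  exact ((h2 0).mul (h1 1)).sub ((h2 1).mul (h1 0))

/-- All factors are bounded off the exceptional parameters, and derivatives of arbitrary real
functions are measurable, so no continuity of `θ̇` is needed. -/
lemma integrableOn_boundary [Fintype ι] [Finite β] (h : IsPiecewiseC2 Ω L x T v) (hℓ : IsObliqueField L ℓ)
    (hθ : IsObliqueAngle L x ℓ θ) (b : β) :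
    IntegrableOn (boundaryIntegrand Ω v (x b) (ℓ b) (θ b)) (Ico 0 (L b)) ∧
    IntegrableOn (deriv (obliqueProduct Ω v (x b) (ℓ b))) (Ico 0 (L b)) := by
  obtain ⟨C₁, hC₁⟩ := isCompact_Icc.exists_bound_of_continuousOn
    (h.continuous_boundaryGrad b).continuousOn (s := Icc 0 (L b))
  obtain ⟨C₂, hC₂⟩ := h.exists_bound_deriv_boundaryGrad b
  obtain ⟨C₃, hC₃⟩ := exists_bound_deriv_oblique h.boundary.length_pos hℓ b
  obtain ⟨c1, c2⟩ := h.continuousOn_boundaryDeriv hℓ b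
  have hsub : Ico 0 (L b) ⊆ Icc 0 (L b) := Ico_subset_Icc_self
  have bounds : ∀ φ ∈ Ioo 0 (L b), x b φ ∉ meshVertices T →
      (∀ i, |boundaryGrad Ω v (x b) φ (unitVec i)| ≤ C₁) ∧
      |deriv (θ b) φ - curveCurvature (x b) φ| ≤ C₃ ∧
      |boundaryDeriv Ω v (x b) (fun ψ => rot90 (ℓ b ψ)) φ| ≤ C₁ ∧
      |deriv (boundaryDeriv Ω v (x b) (ℓ b)) φ| ≤ C₂ + C₃ * C₁ ∧
      |covCross (boundaryGrad Ω v (x b) φ) (deriv (boundaryGrad Ω v (x b)) φ)| ≤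
        2 * (C₁ * C₂) := by
    intro φ hφ hφ'
    have hunit := hℓ.unit b φ (Ioo_subset_Icc_self hφ)
    have hW := hC₁ φ (Ioo_subset_Icc_self hφ)
    have hW' := hC₂ φ hφ'
    have happ : ∀ (A : Plane →L[ℝ] ℝ) (M : ℝ), ‖A‖ ≤ M → ∀ u : Plane, ‖u‖ = 1 → |A u| ≤ M := by
      intro A M hA u hu
      have := A.le_opNorm u
      rw [hu, mul_one] at this
      exact this.trans hA
    have he : ∀ i, ‖unitVec i‖ = 1 := by intro i; simp [unitVec]
    have hrot : ‖rot90 (ℓ b φ)‖ = 1 := by rw [norm_rot90, hunit]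
    -- The rate `θ̇ - χ` equals `‖ℓ̇‖` in absolute value, and `ℓ` is `C¹` up to the ends of the
    -- period.
    have hκ : |deriv (θ b) φ - curveCurvature (x b) φ| ≤ C₃ := by
      have h1 := hC₃ φ hφ
      rw [(hasDerivAt_oblique h.boundary hℓ hθ hφ).deriv, norm_smul, hrot, mul_one] at h1
      exact h1
    have hq := happ _ _ hW _ hrot
    refine ⟨fun i => happ _ _ hW _ (he i), hκ, hq, ?_, ?_⟩
    · rw [(h.oblique_calculus hℓ hθ hφ hφ').1.deriv]
      refine (abs_add_le _ _).trans (add_le_add (happ _ _ hW' _ hunit) ?_)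
      rw [abs_mul]
      exact mul_le_mul hκ hq (abs_nonneg _) ((abs_nonneg _).trans hκ)
    · rw [covCross]
      refine (abs_sub _ _).trans ?_
      rw [abs_mul, abs_mul, two_mul]
      have hC1 : 0 ≤ C₁ := (norm_nonneg _).trans hW
      exact add_le_add
        (mul_le_mul (happ _ _ hW _ (he 0)) (happ _ _ hW' _ (he 1)) (abs_nonneg _) hC1)
        (mul_le_mul (happ _ _ hW _ (he 1)) (happ _ _ hW' _ (he 0)) (abs_nonneg _) hC1)
  have hI : ∀ φ ∈ Ioo 0 (L b), x b φ ∉ meshVertices T →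
      ‖boundaryIntegrand Ω v (x b) (ℓ b) (θ b) φ‖ ≤
        (C₁ ^ 2 + C₁ ^ 2) * C₃ + 2 * C₁ * (C₂ + C₃ * C₁) := by
    intro φ hφ hφ'
    obtain ⟨b1, b2, b3, b4, -⟩ := bounds φ hφ hφ'
    have hC1 : 0 ≤ C₁ := (abs_nonneg _).trans b3
    rw [boundaryIntegrand, Real.norm_eq_abs]
    refine (abs_sub _ _).trans ?_
    rw [abs_mul, abs_mul, abs_mul, abs_two]
    refine add_le_add (mul_le_mul ?_ b2 (abs_nonneg _) (by positivity))
      (mul_le_mul (by linarith) b4 (abs_nonneg _) (by positivity))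
    rw [Fin.sum_univ_two]
    refine (abs_add_le _ _).trans ?_
    rw [abs_pow, abs_pow]
    exact add_le_add (pow_le_pow_left₀ (abs_nonneg _) (b1 0) 2)
      (pow_le_pow_left₀ (abs_nonneg _) (b1 1) 2)
  constructor
  · refine h.integrableOn_of_bounded ?_ hI
    have m1 : Measurable fun φ =>
        ∑ i, fderivWithin ℝ v (closure Ω) (x b φ) (unitVec i) ^ 2 :=
      (continuous_finsetSum _ fun i _ =>
        (((h.continuous_boundaryGrad b).clm_apply continuous_const).pow 2)).measurable
    have m2 := (c2.mono hsub).aestronglyMeasurable (μ := volume) measurableSet_Ico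
    have m3 : AEStronglyMeasurable (fun φ => 2 *
        boundaryDeriv Ω v (x b) (fun ψ => rot90 (ℓ b ψ)) φ)
        (volume.restrict (Ico 0 (L b))) := m2.const_mul 2
    exact (m1.mul ((measurable_deriv _).sub
      (measurable_curveCurvature _))).aestronglyMeasurable.sub
      (m3.mul (measurable_deriv _).aestronglyMeasurable)
  · refine h.integrableOn_of_bounded (measurable_deriv _).aestronglyMeasurable
      (C := 2 * (C₁ * C₂) + ((C₁ ^ 2 + C₁ ^ 2) * C₃ + 2 * C₁ * (C₂ + C₃ * C₁))) ?_
    intro φ hφ hφ'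
    -- The derivative of the product is bounded as the difference of the determinant form and the
    -- boundary integrand.
    have e := (h.oblique_calculus hℓ hθ hφ hφ').2.2
    rw [← sub_eq_iff_eq_add'] at e
    rw [← e]
    exact (norm_sub_le _ _).trans (add_le_add (bounds φ hφ hφ').2.2.2.2 (hI φ hφ hφ'))

/-- The total derivative integrates to zero over a closed boundary curve. -/
lemma integral_deriv_obliqueProduct [Fintype ι] [Finite β] (h : IsPiecewiseC2 Ω L x T v) (hℓ : IsObliqueField L ℓ)
    (hθ : IsObliqueAngle L x ℓ θ) (b : β) :
    ∫ φ in Ico 0 (L b), deriv (obliqueProduct Ω v (x b) (ℓ b)) φ = 0 := by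
  have hL := (h.boundary.length_pos b).le
  obtain ⟨c1, c2⟩ := h.continuousOn_boundaryDeriv hℓ b
  rw [integral_Ico_eq_integral_Ioo, ← integral_Ioc_eq_integral_Ioo,
    ← intervalIntegral.integral_of_le hL]
  -- At the finitely many vertices continuity of the product suffices. Its end values agree because
  -- both the curve and `ℓ` close up.
  rw [integral_eq_of_hasDerivAt_off_countable_of_le (obliqueProduct Ω v (x b) (ℓ b)) _ hL
    (h.finite_exceptionalParams b).countable (c1.mul c2)]
  · have e := (h.boundary.periodic b) 0
    rw [zero_add] at e
    simp only [obliqueProduct, boundaryDeriv]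
    rw [e, hℓ.closed b, sub_self]
  · rintro φ ⟨h1, h2⟩
    obtain ⟨h3, h4⟩ := mem_Ioo_of_notMem_exceptionalParams (Ioo_subset_Ico_self h1) h2
    exact (h.oblique_calculus hℓ hθ h3 h4).2.1
  · rw [intervalIntegrable_iff_integrableOn_Ico_of_le hL]
    exact (h.integrableOn_boundary hℓ hθ b).2

end IsPiecewiseC2

/-! ### Boundary edges expressed in arc length, and their summation. -/

namespace IsPiecewiseC2

open CurvedTriangle

variable {β ι : Type*} {Ω : Set Plane} {L : β → ℝ} {x : β → ℝ → Plane}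
  {T : ι → CurvedTriangle} {v : Plane → ℝ} {ℓ : β → ℝ → Plane} {θ : β → ℝ → ℝ}

lemma measurableSet_edgeParams (h : IsPiecewiseC2 Ω L x T v) (i : ι) (a : Fin 3) (b : β) :
    MeasurableSet (edgeParams (L b) (x b) ((T i).edge a)) :=
  measurableSet_Ico.inter
    ((isCompact_edge a).isClosed.preimage (h.boundary.contDiff b).continuous).measurableSet

/-- Away from vertices a boundary point lies on one edge of one triangle, so the edge found locally
must be the given one. -/
lemma edgeParams_mem_nhds [Fintype ι] [Finite β] (h : IsPiecewiseC2 Ω L x T v) {i : ι} {a : Fin 3}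
    {b : β} {φ : ℝ} (hφ : φ ∈ edgeParams (L b) (x b) ((T i).edge a))
    (hφ' : φ ∉ exceptionalParams T (L b) (x b)) :
    edgeParams (L b) (x b) ((T i).edge a) ∈ 𝓝 φ ∧
      deriv (boundaryGrad Ω v (x b)) φ = (T i).hess v (x b φ) (deriv (x b) φ) := by
  obtain ⟨h1, h2⟩ := mem_Ioo_of_notMem_exceptionalParams hφ.1 hφ'
  obtain ⟨j, c, hc, -, hj, hev, hder⟩ := h.exists_boundary_edge h2
  obtain rfl : i = j := hj i (edge_subset_carrier a hφ.2)
  obtain ⟨s, hs, hys⟩ := exists_edgeCurve_of_notMem_meshVertices h2 hφ.2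
  obtain rfl : c = a := edgeCurve_edge_unique hs (hys ▸ hc)
  refine ⟨?_, hder.deriv⟩
  filter_upwards [Ioo_mem_nhds h1.1 h1.2, hev] with r hr hr'
  exact ⟨Ioo_subset_Ico_self hr, hr'⟩

/-- The contribution of a boundary edge as an integral with respect to arc length. -/
lemma edgeTerm_boundary [Fintype ι] [Fintype β] (h : IsPiecewiseC2 Ω L x T v) {i : ι} {a : Fin 3}
    (hF : (T i).edge a ⊆ frontier Ω) :
    (T i).edgeTerm v a = ∑ b, ∫ φ in edgeParams (L b) (x b) ((T i).edge a),
      covCross (boundaryGrad Ω v (x b) φ) (deriv (boundaryGrad Ω v (x b)) φ) := by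
  set A : β → Set ℝ := fun b => edgeParams (L b) (x b) ((T i).edge a) with hA
  set σ : β → ℝ → ℝ := fun b φ => (T i).edgeParam a (x b φ) with hσ
  set g : ℝ → ℝ := fun s => covCross ((T i).grad v ((T i).edgeCurve a s))
    ((T i).hess v ((T i).edgeCurve a s) ((T i).edgeVel a s)) with hg
  have hAm : ∀ b, MeasurableSet (A b) := fun b => h.measurableSet_edgeParams i a b
  have hσd : ∀ b, ∀ φ ∈ A b,
      HasDerivWithinAt (σ b) ((T i).edgeParamDeriv a (x b) φ) (A b) φ := fun b φ hφ =>
    hasDerivWithinAt_edgeParam (fun r hr => hr.2) hφ (differentiableAt_curve h.boundary b φ)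
  have hσeq : ∀ b b', ∀ φ ∈ A b, ∀ ψ ∈ A b', σ b φ = σ b' ψ → b = b' ∧ φ = ψ := by
    intro b b' φ hφ ψ hψ e
    refine h.boundary.simple_disjoint b b' φ ψ hφ.1 hψ.1 ?_
    rw [← edgeCurve_edgeParam hφ.2, ← edgeCurve_edgeParam hψ.2]
    exact congrArg _ e
  have hinj : ∀ b, InjOn (σ b) (A b) := fun b φ hφ ψ hψ e => (hσeq b b φ hφ ψ hψ e).2
  have hm : ∀ b, MeasurableSet (σ b '' A b) := fun b =>
    (hAm b).image_of_continuousOn_injOn (fun φ hφ => (hσd b φ hφ).continuousWithinAt) (hinj b)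
  have hdisj : Pairwise (Function.onFun Disjoint fun b => σ b '' A b) := by
    intro b b' hbb
    refine Set.disjoint_left.2 ?_
    rintro _ ⟨φ, hφ, rfl⟩ ⟨ψ, hψ, e⟩
    exact hbb (hσeq b b' φ hφ ψ hψ e.symm).1
  have hsub : ∀ b, σ b '' A b ⊆ Icc 0 1 := by
    rintro b _ ⟨φ, hφ, rfl⟩
    exact edgeParam_mem hφ.2
  -- Every point of the edge has exactly one boundary parameter, so `[0, 1]` splits into the
  -- disjoint images of the parameter sets. Whether a single curve carries the whole edge need not
  -- be decided.
  have hcov : Icc (0 : ℝ) 1 = ⋃ b, σ b '' A b := by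
    refine subset_antisymm (fun s hs => ?_) (iUnion_subset hsub)
    obtain ⟨b, φ, hφ, e⟩ := exists_edgeParams_of_mem_frontier h.boundary
      (hF (edgeCurve_mem_edge (K := T i) (a := a) hs))
    refine mem_iUnion.2 ⟨b, φ, ⟨hφ, e ▸ edgeCurve_mem_edge hs⟩, ?_⟩
    simp only [hσ, e, edgeParam_edgeCurve hs]
  have hgi : IntegrableOn g (Icc 0 1) := by
    refine ContinuousOn.integrableOn_Icc ?_
    have c1 := continuousOn_grad_edgeCurve (h.contDiffOn i) a
    have c2 := continuousOn_hess_edgeCurve (h.contDiffOn i) a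
    exact ((c1.clm_apply continuousOn_const).mul (c2.clm_apply continuousOn_const)).sub
      ((c1.clm_apply continuousOn_const).mul (c2.clm_apply continuousOn_const))
  rw [edgeTerm, intervalIntegral.integral_of_le zero_le_one, ← integral_Icc_eq_integral_Ioc, hcov,
    integral_iUnion_fintype hm hdisj fun b => hgi.mono_set (hsub b), Finset.mul_sum]
  refine Finset.sum_congr rfl fun b _ => ?_
  rw [integral_image_eq_integral_abs_deriv_smul (hAm b) (hσd b) (hinj b), ← integral_const_mul]
  refine setIntegral_congr_ae (hAm b) ?_
  filter_upwards [h.ae_notMem_exceptionalParams b] with φ hφ' hφ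
  obtain ⟨hn, hder⟩ := h.edgeParams_mem_nhds hφ hφ'
  obtain ⟨h1, h2⟩ := mem_Ioo_of_notMem_exceptionalParams hφ.1 hφ'
  obtain ⟨s, hs, hys⟩ := exists_edgeCurve_of_notMem_meshVertices h2 hφ.2
  have hx' := deriv_eq_smul_edgeVel (K := T i) (a := a) (γ := x b) (A := A b) (fun r hr => hr.2) hφ
    (differentiableAt_curve h.boundary b φ) (uniqueDiffWithinAt_of_mem_nhds hn)
  have hs' : (T i).edgeParam a (x b φ) = s := by
    rw [hys, edgeParam_edgeCurve (Ioo_subset_Icc_self hs)]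
  have hpos := (boundary_orientation h.exact_mesh h.boundary hs hys (hs' ▸ hx')).2
  -- The boundary curve runs along the edge in the positive sense of the triangle, so `orient` turns
  -- the absolute value from the change of variables into the signed derivative.
  have habs : (T i).orient * |(T i).edgeParamDeriv a (x b) φ| =
      (T i).edgeParamDeriv a (x b) φ := by
    have h3 := (T i).orient_sq
    rcases mul_self_eq_one_iff.1 h3 with h4 | h4 <;> rw [h4] at hpos ⊢
    · rw [abs_of_pos (by linarith), one_mul]
    · rw [abs_of_neg (by linarith)]; ring
  have hpt : (T i).edgeCurve a (σ b φ) = x b φ := edgeCurve_edgeParam hφ.2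
  rw [h.boundaryGrad_eq (edge_subset_carrier a hφ.2), hder, hx', smul_eq_mul, ← mul_assoc, habs]
  simp only [hg, hpt, covCross, map_smul, _root_.smul_apply, smul_eq_mul]
  ring

/-- The contribution of a boundary edge in terms of the oblique derivatives. -/
lemma edgeTerm_oblique [Fintype ι] [Fintype β] (h : IsPiecewiseC2 Ω L x T v)
    (hℓ : IsObliqueField L ℓ) (hθ : IsObliqueAngle L x ℓ θ) {i : ι} {a : Fin 3}
    (hF : (T i).edge a ⊆ frontier Ω) :
    (T i).edgeTerm v a =
      (∑ b, ∫ φ in edgeParams (L b) (x b) ((T i).edge a),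
        boundaryIntegrand Ω v (x b) (ℓ b) (θ b) φ) +
      ∑ b, ∫ φ in edgeParams (L b) (x b) ((T i).edge a),
        deriv (obliqueProduct Ω v (x b) (ℓ b)) φ := by
  rw [h.edgeTerm_boundary hF, ← Finset.sum_add_distrib]
  refine Finset.sum_congr rfl fun b _ => ?_
  have hsub : edgeParams (L b) (x b) ((T i).edge a) ⊆ Ico 0 (L b) := fun φ hφ => hφ.1
  obtain ⟨i1, i2⟩ := h.integrableOn_boundary hℓ hθ b
  rw [← integral_add (i1.mono_set hsub) (i2.mono_set hsub)]
  refine setIntegral_congr_ae (h.measurableSet_edgeParams i a b) ?_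
  filter_upwards [h.ae_notMem_exceptionalParams b] with φ hφ' hφ
  obtain ⟨h1, h2⟩ := mem_Ioo_of_notMem_exceptionalParams hφ.1 hφ'
  exact (h.oblique_calculus hℓ hθ h1 h2).2.2

/-- The boundary edges subdivide a boundary curve. -/
lemma sum_integral_edgeParams [Fintype ι] [Finite β] (h : IsPiecewiseC2 Ω L x T v) (b : β)
    {f : ℝ → ℝ} (hf : IntegrableOn f (Ico 0 (L b))) :
    ∑ F ∈ boundaryEdges Ω T, ∫ φ in edgeParams (L b) (x b) F, f φ = ∫ φ in Ico 0 (L b), f φ := by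
  classical
  have hsub : ∀ F, edgeParams (L b) (x b) F ⊆ Ico 0 (L b) := fun F φ hφ => hφ.1
  have hF : ∀ F ∈ boundaryEdges Ω T, ∃ q : ι × Fin 3, (T q.1).edge q.2 = F := by
    intro F hF
    obtain ⟨q, -, hq⟩ := Finset.mem_image.1 (Finset.mem_filter.1 hF).1
    exact ⟨q, hq⟩
  have hm : ∀ F ∈ boundaryEdges Ω T, MeasurableSet (edgeParams (L b) (x b) F) := by
    intro F h1
    obtain ⟨q, rfl⟩ := hF F h1
    exact h.measurableSet_edgeParams q.1 q.2 b
  have h1 : ∀ F ∈ boundaryEdges Ω T, ∫ φ in edgeParams (L b) (x b) F, f φ =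
      ∫ φ in Ico 0 (L b), (edgeParams (L b) (x b) F).indicator f φ := by
    intro F hF
    rw [setIntegral_indicator (hm F hF), inter_eq_right.2 (hsub F)]
  rw [Finset.sum_congr rfl h1, ← integral_finsetSum _ fun F hF => hf.indicator (hm F hF)]
  refine setIntegral_congr_ae measurableSet_Ico ?_
  filter_upwards [h.ae_notMem_exceptionalParams b] with φ hφ' hφ
  obtain ⟨h2, h3⟩ := mem_Ioo_of_notMem_exceptionalParams hφ hφ'
  obtain ⟨i, a, ha, hfr, hi, -, -⟩ := h.exists_boundary_edge h3
  obtain ⟨s, hs, hys⟩ := exists_edgeCurve_of_notMem_meshVertices h3 ha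
  have hmem : (T i).edge a ∈ boundaryEdges Ω T := by
    rw [boundaryEdges, Finset.mem_filter, meshEdges, Finset.mem_image]
    exact ⟨⟨(i, a), Finset.mem_univ _, rfl⟩, hfr⟩
  -- For almost every parameter exactly one indicator is nonzero, since distinct boundary edges
  -- share only vertices.
  rw [Finset.sum_eq_single_of_mem _ hmem]
  · have h4 : φ ∈ edgeParams (L b) (x b) ((T i).edge a) := ⟨hφ, ha⟩
    exact indicator_of_mem h4 f
  · intro F h4 h5
    refine indicator_of_notMem (fun h6 => h5 ?_) f
    obtain ⟨⟨j, c⟩, rfl⟩ := hF F h4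
    obtain rfl : j = i := hi j (edge_subset_carrier c h6.2)
    obtain rfl : c = a := edgeCurve_edge_unique hs (hys ▸ h6.2)
    rfl

/-- The total contribution of the boundary edges. -/
lemma sum_edgeTerm_boundary [Fintype ι] [Fintype β] (h : IsPiecewiseC2 Ω L x T v)
    (hℓ : IsObliqueField L ℓ) (hθ : IsObliqueAngle L x ℓ θ) :
    ∑ F ∈ boundaryEdges Ω T, ∑ q : ι × Fin 3 with (T q.1).edge q.2 = F, (T q.1).edgeTerm v q.2 =
      ∑ F ∈ boundaryEdges Ω T, ∑ b, ∫ φ in edgeParams (L b) (x b) F,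
        boundaryIntegrand Ω v (x b) (ℓ b) (θ b) φ := by
  classical
  have h1 : ∀ F ∈ boundaryEdges Ω T,
      ∑ q : ι × Fin 3 with (T q.1).edge q.2 = F, (T q.1).edgeTerm v q.2 =
      (∑ b, ∫ φ in edgeParams (L b) (x b) F, boundaryIntegrand Ω v (x b) (ℓ b) (θ b) φ) +
      ∑ b, ∫ φ in edgeParams (L b) (x b) F, deriv (obliqueProduct Ω v (x b) (ℓ b)) φ := by
    intro F hF
    obtain ⟨h2, hfr⟩ := Finset.mem_filter.1 hF
    obtain ⟨⟨i, a⟩, -, rfl⟩ := Finset.mem_image.1 h2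
    rw [← h.edgeTerm_oblique hℓ hθ hfr]
    refine Finset.sum_eq_single_of_mem (i, a) (by simp) ?_
    rintro ⟨j, c⟩ h3 h4
    have h5 : (T j).edge c = (T i).edge a := (Finset.mem_filter.1 h3).2
    obtain rfl := boundary_edge_unique h.exact_mesh h.boundary h5 hfr
    obtain rfl : c = a := edge_injective h5
    exact absurd rfl h4
  -- The exact terms do not vanish edge by edge; they vanish after the edges are assembled into
  -- closed curves.
  have h2 : ∑ F ∈ boundaryEdges Ω T, ∑ b, ∫ φ in edgeParams (L b) (x b) F,
      deriv (obliqueProduct Ω v (x b) (ℓ b)) φ = 0 := by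
    rw [Finset.sum_comm]
    refine Finset.sum_eq_zero fun b _ => ?_
    rw [h.sum_integral_edgeParams b (h.integrableOn_boundary hℓ hθ b).2,
      h.integral_deriv_obliqueProduct hℓ hθ]
  rw [Finset.sum_congr rfl h1, Finset.sum_add_distrib, h2, add_zero]

end IsPiecewiseC2

end

/-! ### Assembly of the identity. -/

theorem theorem3p5
    {β ι : Type*} [Fintype β] [Fintype ι]
    (Ω : Set Plane) (hΩ_open : IsOpen Ω) (hΩ_conn : IsConnected Ω)
    (hΩ_bdd : Bornology.IsBounded Ω)
    (L : β → ℝ) (x : β → ℝ → Plane) (hx : IsC2BoundaryParam Ω L x)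
    (ℓ : β → ℝ → Plane) (hℓ : IsObliqueField L ℓ)
    (θ : β → ℝ → ℝ) (hθ : IsObliqueAngle L x ℓ θ)
    (T : ι → CurvedTriangle) (hT : IsExactTriangulation Ω T)
    (hT_C2 : ∀ i, ContDiffOn ℝ 2 (T i).map refTriangle)
    (t : Set Plane → Plane) (ht : ∀ F ∈ interiorEdges Ω T, IsUnitTangent F (t F))
    (k : ℕ) (hk : 3 ≤ k) (v : Plane → ℝ) (hv : MemVh k Ω T v) :
    (∀ i, IntegrableOn (fun y => laplacianOn v (T i).carrier y ^ 2) (T i).carrier) ∧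
    (∀ i, IntegrableOn (hessianNormSqOn v (T i).carrier) (T i).carrier) ∧
    (∀ F ∈ interiorEdges Ω T,
      IntegrableOn (fun y => normalJump T v F y * secondTangential v (t F) y) F
        (Measure.hausdorffMeasure 1)) ∧
    (∀ F ∈ boundaryEdges Ω T, ∀ b,
      IntegrableOn (boundaryIntegrand Ω v (x b) (ℓ b) (θ b)) (edgeParams (L b) (x b) F)) ∧
    (∑ i, ∫ y in (T i).carrier, laplacianOn v (T i).carrier y ^ 2) =
      (∑ i, ∫ y in (T i).carrier, hessianNormSqOn v (T i).carrier y)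
      + 2 * (∑ F ∈ interiorEdges Ω T,
          ∫ y in F, normalJump T v F y * secondTangential v (t F) y
            ∂(Measure.hausdorffMeasure 1))
      + (∑ F ∈ boundaryEdges Ω T, ∑ b,
          ∫ φ in edgeParams (L b) (x b) F,
            boundaryIntegrand Ω v (x b) (ℓ b) (θ b) φ) := by
  classical
  have hv2 : ∀ i, ContDiffOn ℝ 2 v (T i).carrier := fun i => (hv.memShape i).contDiffOn (hT_C2 i)
  have h : IsPiecewiseC2 Ω L x T v := ⟨hΩ_open, hx, hT, hv2, hv.c1_vertex⟩
  have hint : ∀ F ∈ interiorEdges Ω T,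
      IntegrableOn (fun y => normalJump T v F y * secondTangential v (t F) y) F
        (Measure.hausdorffMeasure 1) ∧
      ∑ q : ι × Fin 3 with (T q.1).edge q.2 = F, (T q.1).edgeTerm v q.2 =
        2 * ∫ y in F, normalJump T v F y * secondTangential v (t F) y
          ∂(Measure.hausdorffMeasure 1) := by
    intro F hF
    obtain ⟨h1, h2⟩ := Finset.mem_filter.1 hF
    obtain ⟨⟨i, a⟩, -, rfl⟩ := Finset.mem_image.1 h1
    obtain ⟨h3, h4⟩ := hT.interior_edge hΩ_open hv2 hv.c1_vertex h2 (ht _ hF)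
    refine ⟨h3, Eq.trans ?_ h4⟩
    congr!
  refine ⟨fun i => CurvedTriangle.integrableOn_laplacianOn_sq (hv2 i),
    fun i => CurvedTriangle.integrableOn_hessianNormSqOn (hv2 i), fun F hF => (hint F hF).1,
    fun F _ b => (h.integrableOn_boundary hℓ hθ b).1.mono_set fun φ hφ => hφ.1, ?_⟩
  -- The sum over all sides of all triangles is regrouped by the underlying edge, so that the
  -- contributions from both sides of an interior edge stand together.
  have hsplit : ∑ i, ∑ a, (T i).edgeTerm v a =
      (∑ F ∈ interiorEdges Ω T,
        ∑ q : ι × Fin 3 with (T q.1).edge q.2 = F, (T q.1).edgeTerm v q.2) +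
      ∑ F ∈ boundaryEdges Ω T,
        ∑ q : ι × Fin 3 with (T q.1).edge q.2 = F, (T q.1).edgeTerm v q.2 := by
    rw [← Fintype.sum_prod_type' fun i a => (T i).edgeTerm v a,
      ← Finset.sum_fiberwise_of_maps_to (t := meshEdges T)
        (g := fun q : ι × Fin 3 => (T q.1).edge q.2)
        fun q _ => Finset.mem_image_of_mem _ (Finset.mem_univ q),
      add_comm, boundaryEdges, interiorEdges]
    exact (Finset.sum_filter_add_sum_filter_not _ _ _).symm
  rw [Finset.sum_congr rfl fun i _ => CurvedTriangle.integral_laplacianOn_sq (hv2 i),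
    Finset.sum_add_distrib, hsplit, Finset.sum_congr rfl fun F hF => (hint F hF).2,
    h.sum_edgeTerm_boundary hℓ hθ, ← Finset.mul_sum, add_assoc]
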